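/- For a finite graph $G$ let $\nabla_r(G)=\sup_H |E(H)|/|V(H)|$ over all $r$-shallow minors $H$ of $G$, i.e. graphs $H$ whose vertices correspond to pairwise disjoint vertex sets (clusters) of $G$, each inducing a subgraph having a vertex from which all others are reached by paths with at most $r$ edges, such that clusters of adjacent vertices of $H$ are joined by an edge of $G$. A class $\mathcal C$ of finite graphs has polynomial expansion of order $k\in\mathbb N$ if $f(r)=\sup_{G\in\mathcal C}\nabla_r(G)$ is finite for all $r$ and $f(r)=O(r^k)$. An instance consists of a graph $G=(V,E)$ with $n$ vertices, sets $\mathcal{T},D\subseteq V$, and for every $v\in \mathcal{T}$ a demand $\delta(v)\in\mathbb N$ and a reach $\rho(v)\in\mathbb N$. A set $S\subseteq D$ is feasible if every $v\in \mathcal{T}$ has at least $\delta(v)$ vertices of $S$ within edge distance at most $\rho(v)$ in $G$ (where $v$ itself counts, at distance $0$); it is assumed that $D$ is feasible. The $\ell$-local search algorithm starts with $S=D$ and, as long as there is a feasible $S'$ with $|S'|<|S|$ and $|S\mathbin\triangle S'|\le\ell$, replaces $S$ by such an $S'$. A feasible set that admits no such $S'$ is called $\ell$-locally optimal. **Lemma.**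 There are a program for a unit-cost random access machine (with addition and subtraction, without multiplication) and a constant $c$ such that the program, given an instance with $D$ feasible and $\ell\ge 1$, carries out $\ell$-local search in at most $\max(n,2)^{c\ell}=n^{O(\ell)}$ steps. Moreover, let $\mathcal C$ be a class of graphs with polynomial expansion of order $k$ and let $\hat\delta,\hat\rho\in\mathbb N$ be constants. Then there is a constant $C>0$, depending only on $k$, $\mathcal C$, $\hat\delta$ and $\hat\rho$, such that the following holds for all $\varepsilon>0$ and $$\ell=\Bigl\lceil C\max\bigl(1,\ \varepsilon^{-(2k+6)}\log^{2k+5}(1/\varepsilon)\bigr)\Bigr\rceil$$ (for $\varepsilon\le 1/2$ the maximum is its second term). For every instance with $G\in\mathcal C$, with $D$ feasible, and with $\delta(v)\le\hat\delta$ and $\rho(v)\le\hat\rho$ for all $v\in \mathcal{T}$, every $\ell$-locally optimal set is a $(1+\varepsilon)$-approximation, that is, a feasible set of size at most $(1+\varepsilon)|X|$ for every feasible $X\subseteq D$. In particular, the $\ell$-local search algorithm computes a $(1+\varepsilon)$-approximation to the smallest feasible subset of $D$ in $n^{O(\ell)}$ time. -/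

import Mathlib

open Filter

/-! ## Shallow minors and polynomial expansion -/

/-- A vertex set is `t`-shallow in `G` if the subgraph that it induces has a vertex (a center) from
which every vertex of the induced subgraph is reached by a path with at most `t` edges.  In
particular the set is nonempty and connected. -/
def IsShallowCluster {V : Type*} (G : SimpleGraph V) (t : ℕ) (B : Set V) : Prop :=
  ∃ h : B, ∀ u : B, (G.induce B).edist h u ≤ (t : ℕ∞)

/-- `H` is a `t`-shallow minor of `G`: the vertices of `H` correspond to pairwise disjoint
`t`-shallow clusters of `G`, and adjacent vertices of `H` have clusters joined by an edge of `G`. -/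
def IsShallowMinor {W V : Type*} (t : ℕ) (H : SimpleGraph W) (G : SimpleGraph V) : Prop :=
  ∃ B : W → Set V,
    (∀ w, IsShallowCluster G t (B w)) ∧
    (∀ w w', w ≠ w' → Disjoint (B w) (B w')) ∧
    (∀ w w', H.Adj w w' → ∃ x ∈ B w, ∃ y ∈ B w', G.Adj x y)

/-- The `r`-shallow density of `G`: the supremum of `|E(H)| / |V(H)|` over the `r`-shallow minors
`H` of `G`.  For finite `G` all of these are finite, so `H` lives on `Fin m`
(for `m = 0` the quotient is `0`). -/
noncomputable def shallowDensity {V : Type*} (r : ℕ) (G : SimpleGraph V) : ENNReal :=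
  ⨆ (m : ℕ) (H : SimpleGraph (Fin m)) (_ : IsShallowMinor r H G),
    (H.edgeSet.ncard : ENNReal) / (m : ENNReal)

/-- A class of finite graphs, every finite graph being given on some vertex set `Fin n`. -/
abbrev GraphClass : Type := Set (Σ n : ℕ, SimpleGraph (Fin n))

/-- The expansion of a class of graphs. -/
noncomputable def GraphClass.expansion (𝒞 : GraphClass) (r : ℕ) : ENNReal :=
  ⨆ G ∈ 𝒞, shallowDensity r G.2

/-- Polynomial expansion of order `k`: the expansion `f` is finite and `f r = O(r ^ k)`. -/
def GraphClass.HasPolynomialExpansion (𝒞 : GraphClass) (k : ℕ) : Prop :=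
  (∀ r, 𝒞.expansion r ≠ ⊤) ∧
    ∃ a : NNReal, ∀ᶠ r : ℕ in atTop, 𝒞.expansion r ≤ (a : ENNReal) * (r : ENNReal) ^ k

/-! ## Dominating subsets with demands and reach -/

/-- An instance of the dominating subset problem with demands and reach: a graph on `n` vertices,
the set `targets` of vertices that have to be dominated, the set `candidates` from which the
dominators are chosen, and a demand and a reach for every vertex (only those of the targets
matter). -/
structure DominationInstance (n : ℕ) where
  graph : SimpleGraph (Fin n)
  targets : Finset (Fin n)
  candidates : Finset (Fin n)
  demand : Fin n → ℕ
  reach : Fin n → ℕ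

namespace DominationInstance

variable {n : ℕ}

open Classical in
/-- `S` is a set of candidates such that every target `v` has at least `demand v` vertices of `S`
at edge distance at most `reach v` (`v` itself counts, at distance zero). -/
def IsFeasible (I : DominationInstance n) (S : Finset (Fin n)) : Prop :=
  S ⊆ I.candidates ∧
    ∀ v ∈ I.targets,
      I.demand v ≤ (S.filter fun u => I.graph.edist u v ≤ (I.reach v : ℕ∞)).card

/-- `S` is a feasible solution of size at most `1 + ε` times that of any feasible solution. -/
def IsApproximation (I : DominationInstance n) (ε : ℝ) (S : Finset (Fin n)) : Prop :=
  I.IsFeasible S ∧ ∀ X, I.IsFeasible X → (S.card : ℝ) ≤ (1 + ε) * (X.card : ℝ)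

/-- One step of `ℓ`-local search: `B` is a strictly smaller feasible solution which differs from
`A` in at most `ℓ` vertices. -/
def IsImprovement (I : DominationInstance n) (ℓ : ℕ) (A B : Finset (Fin n)) : Prop :=
  I.IsFeasible B ∧ (symmDiff A B).card ≤ ℓ ∧ B.card < A.card

/-- A feasible solution that admits no improving `ℓ`-close exchange. -/
def IsLocallyOptimal (I : DominationInstance n) (ℓ : ℕ) (A : Finset (Fin n)) : Prop :=
  I.IsFeasible A ∧ ∀ B, ¬ I.IsImprovement ℓ A B

/-- `S` is a possible result of `ℓ`-local search started with all candidates: it is reached by a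
sequence of improving `ℓ`-close exchanges, and no such exchange is available any more. -/
def IsLocalSearchResult (I : DominationInstance n) (ℓ : ℕ) (S : Finset (Fin n)) : Prop :=
  Relation.ReflTransGen (I.IsImprovement ℓ) I.candidates S ∧ I.IsLocallyOptimal ℓ S

end DominationInstance

/-! ## A random access machine with a step count -/

/-- The store of the machine: registers and arrays of natural numbers. -/
structure RamState where
  reg : ℕ → ℕ
  arr : ℕ → ℕ → ℕ

/-- Programs of a random access machine, in structured form.  The only arithmetic operations are
addition and truncated subtraction (no multiplication), which keeps the unit-cost measure within a
polynomial of the number of steps of a Turing machine.  Registers and arrays are named by constants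
of the program, so a program uses only finitely many of them. -/
inductive RamProgram : Type
  /-- `const x c` sets register `x` to the constant `c` -/
  | const (x c : ℕ)
  /-- `add x y z` sets register `x` to the sum of the registers `y` and `z` -/
  | add (x y z : ℕ)
  /-- `sub x y z` sets register `x` to the truncated difference of the registers `y` and `z` -/
  | sub (x y z : ℕ)
  /-- `load x a i` sets register `x` to the entry of array `a` at the index held in register `i` -/
  | load (x a i : ℕ)
  /-- `store a i x` sets the entry of array `a` at the index held in register `i` to register `x` -/
  | store (a i x : ℕ)
  /-- `seq p q` executes `p`, then `q` -/
  | seq (p q : RamProgram)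
  /-- `ifLt x y p q` executes `p` if register `x` is less than register `y`, and `q` otherwise -/
  | ifLt (x y : ℕ) (p q : RamProgram)
  /-- `whileLt x y p` repeats `p` as long as register `x` is less than register `y` -/
  | whileLt (x y : ℕ) (p : RamProgram)

/-- Write `v` to register `x`. -/
def RamState.setReg (s : RamState) (x v : ℕ) : RamState :=
  { s with reg := Function.update s.reg x v }

/-- Write `v` to the entry `i` of array `a`. -/
def RamState.setArr (s : RamState) (a i v : ℕ) : RamState :=
  { s with arr := Function.update s.arr a (Function.update (s.arr a) i v) }

/-- `RamRuns p s t s'`: started in the store `s`, the program `p` halts in the store `s'` after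
exactly `t` steps.  Every elementary instruction and every test of a condition is one step. -/
inductive RamRuns : RamProgram → RamState → ℕ → RamState → Prop
  | const (s : RamState) (x c : ℕ) : RamRuns (.const x c) s 1 (s.setReg x c)
  | add (s : RamState) (x y z : ℕ) : RamRuns (.add x y z) s 1 (s.setReg x (s.reg y + s.reg z))
  | sub (s : RamState) (x y z : ℕ) : RamRuns (.sub x y z) s 1 (s.setReg x (s.reg y - s.reg z))
  | load (s : RamState) (x a i : ℕ) : RamRuns (.load x a i) s 1 (s.setReg x (s.arr a (s.reg i)))
  | store (s : RamState) (a i x : ℕ) : RamRuns (.store a i x) s 1 (s.setArr a (s.reg i) (s.reg x))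
  | seq {p q : RamProgram} {s₁ s₂ s₃ : RamState} {t₁ t₂ : ℕ} :
      RamRuns p s₁ t₁ s₂ → RamRuns q s₂ t₂ s₃ → RamRuns (.seq p q) s₁ (t₁ + t₂) s₃
  | ifLt_true {x y : ℕ} {p q : RamProgram} {s s' : RamState} {t : ℕ} :
      s.reg x < s.reg y → RamRuns p s t s' → RamRuns (.ifLt x y p q) s (t + 1) s'
  | ifLt_false {x y : ℕ} {p q : RamProgram} {s s' : RamState} {t : ℕ} :
      ¬ s.reg x < s.reg y → RamRuns q s t s' → RamRuns (.ifLt x y p q) s (t + 1) s'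
  | while_step {x y : ℕ} {p : RamProgram} {s₁ s₂ s₃ : RamState} {t₁ t₂ : ℕ} :
      s₁.reg x < s₁.reg y → RamRuns p s₁ t₁ s₂ → RamRuns (.whileLt x y p) s₂ t₂ s₃ →
      RamRuns (.whileLt x y p) s₁ (t₁ + t₂ + 1) s₃
  | while_stop {x y : ℕ} {p : RamProgram} {s : RamState} :
      ¬ s.reg x < s.reg y → RamRuns (.whileLt x y p) s 1 s

open Classical in
/-- The input of the machine: `n` in register `0` and `ℓ` in register `1`; the adjacency matrix of
the graph, row after row, in array `0`; the indicators of the targets and of the candidates in the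
arrays `1` and `2`; the demands and the reaches in the arrays `3` and `4`; zero elsewhere. -/
noncomputable def DominationInstance.encode {n : ℕ} (I : DominationInstance n) (ℓ : ℕ) :
    RamState where
  reg x := if x = 0 then n else if x = 1 then ℓ else 0
  arr a p :=
    if a = 0 then (if ∃ u v : Fin n, p = u.val * n + v.val ∧ I.graph.Adj u v then 1 else 0)
    else if a = 1 then (if ∃ v ∈ I.targets, p = v.val then 1 else 0)
    else if a = 2 then (if ∃ v ∈ I.candidates, p = v.val then 1 else 0)
    else if a = 3 then (if h : p < n then I.demand ⟨p, h⟩ else 0)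
    else if a = 4 then (if h : p < n then I.reach ⟨p, h⟩ else 0)
    else 0

/-- The output of the machine is the vertex set whose indicator is in array `5`. -/
def RamState.output (n : ℕ) (s : RamState) : Finset (Fin n) :=
  Finset.univ.filter fun v => s.arr 5 v.val = 1

/-- The program `P` carries out `ℓ`-local search (for every `ℓ ≥ 1`, read from its input) in
`n ^ O(ℓ)` steps: at most `n ^ (c * ℓ)` steps, where `n` is replaced by `2` if `n < 2`. -/
def IsLocalSearchProgram (P : RamProgram) (c : ℕ) : Prop :=
  ∀ (n : ℕ) (I : DominationInstance n) (ℓ : ℕ), 1 ≤ ℓ → I.IsFeasible I.candidates →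
    ∃ (t : ℕ) (s : RamState), RamRuns P (I.encode ℓ) t s ∧
      t ≤ (max n 2) ^ (c * ℓ) ∧ I.IsLocalSearchResult ℓ (s.output n)

/-- The exchange size `⌈C * max (1, ε ^ (-(2 k + 6)) * log (1 / ε) ^ (2 k + 5))⌉`.  For `ε ≤ 1/2`
the maximum is its second argument. -/
noncomputable def exchangeSize (C : ℝ) (k : ℕ) (ε : ℝ) : ℕ :=
  ⌈C * max 1 ((1 / ε) ^ (2 * k + 6) * Real.log (1 / ε) ^ (2 * k + 5))⌉₊

/-! Approximation. Let S be locally optimal and X feasible. Every vertex ranks the dominators by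
distance, ties broken by index. The preference cluster of a dominator a consists of the vertices
within distance ρ that rank a among their first δ choices. Such a cluster contains the shortest
paths from a to its members, and each vertex lies in at most δ clusters of S and δ clusters of X. So
the clusters have bounded radius and overlap; let H be their intersection graph on the disjoint sum
of S and X. If W contains all H-neighbours of J, then removing the S-part of J and adding the X-part
of W keeps feasibility: a target that loses one of its first choices a shares with a's cluster all
clusters of its first choices in X, and these are all added (`exchange_isFeasible`).

Cover H by parts W of size at most ℓ such that every edge lies inside a part, and let J be the
vertices of W that lie in no other part. Local optimality gives |J ∩ S| ≤ |W ∩ X|, and summation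
over the parts gives 2|S| ≤ ∑|W|. If the total size is at most (1 + η)(|S| + |X|), then |S| ≤ (1 +
η)/(1 - η) · |X|.

Such divisions arise by recursive splitting along balanced separators of order N^(1 - 1/(2k+6))
(`exists_division`). The separators come from the argument of Plotkin, Rao and Smith
(`hasSeparation_of_cliqueModel_card_le`): either a shallow clique model grows, or a slowly growing
ball is cut off. It remains to bound shallow clique models in H, which is not a minor of G. Such a
model yields pairwise intersecting clusters of G with bounded overlap. Sampling a random subfamily
and keeping the pairs whose connecting paths meet no other sampled cluster yields a genuine shallow
minor of G, so sparsity bounds the model by O(r^(k+1)) at depth r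
(`card_le_of_pairwise_intersecting`).

Algorithm. All pairwise distances are computed by relaxing edges. Each pass enumerates the numbers
below n^ℓ, whose base-n digits describe all nonempty sets of at most ℓ vertices to toggle. A pass
without change certifies local optimality and any other pass shrinks the solution, so n + 1 passes
suffice. -/

/-- There is a walk of length at most `d` from `u` to `v` all of whose vertices lie in `B`. -/
def WalkWithin {V : Type*} (G : SimpleGraph V) (B : Set V) (d : ℕ) (u v : V) : Prop :=
  ∃ p : G.Walk u v, p.length ≤ d ∧ ∀ z ∈ p.support, z ∈ B

/-! ### Short walks inside a vertex set -/

namespace WalkWithin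

variable {V : Type*} {G : SimpleGraph V} {B B' : Set V} {d e : ℕ} {u v w : V}

theorem refl (hu : u ∈ B) : WalkWithin G B d u u :=
  ⟨.nil, by simp, by simpa using hu⟩

theorem symm (h : WalkWithin G B d u v) : WalkWithin G B d v u := by
  obtain ⟨p, hp, hs⟩ := h
  exact ⟨p.reverse, by simpa using hp, by simpa using hs⟩

theorem trans (h : WalkWithin G B d u v) (h' : WalkWithin G B e v w) :
    WalkWithin G B (d + e) u w := by
  obtain ⟨p, hp, hs⟩ := h
  obtain ⟨q, hq, hs'⟩ := h'
  refine ⟨p.append q, by simp; omega, fun z hz => ?_⟩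
  rw [SimpleGraph.Walk.mem_support_append_iff] at hz
  exact hz.elim (hs z) (hs' z)

theorem mono (h : WalkWithin G B d u v) (hB : B ⊆ B') (hd : d ≤ e) : WalkWithin G B' e u v := by
  obtain ⟨p, hp, hs⟩ := h
  exact ⟨p, hp.trans hd, fun z hz => hB (hs z hz)⟩

theorem of_adj (h : G.Adj u v) (hu : u ∈ B) (hv : v ∈ B) : WalkWithin G B 1 u v :=
  ⟨.cons h .nil, by simp, by simp [hu, hv]⟩

theorem left_mem (h : WalkWithin G B d u v) : u ∈ B := by
  obtain ⟨p, -, hs⟩ := h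
  exact hs u p.start_mem_support

theorem right_mem (h : WalkWithin G B d u v) : v ∈ B := h.symm.left_mem

/-- The vertices of a short walk form a set in which they are all close to the start. -/
theorem exists_finset [DecidableEq V] (h : WalkWithin G B d u v) :
    ∃ P : Finset V, ↑P ⊆ B ∧ u ∈ P ∧ v ∈ P ∧ P.card ≤ d + 1 ∧
      ∀ z ∈ P, WalkWithin G (P : Set V) d u z := by
  obtain ⟨p, hp, hs⟩ := h
  refine ⟨p.support.toFinset, fun z hz => hs z (by simpa using hz), by simp, by simp,
    (List.toFinset_card_le _).trans (by simp; omega), fun z hz => ?_⟩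
  have hz' : z ∈ p.support := by simpa using hz
  refine ⟨p.takeUntil z hz', (p.length_takeUntil_le_length hz').trans hp, fun y hy => ?_⟩
  simpa using p.support_takeUntil_subset_support hz' hy

theorem isShallowCluster {c : V} (hc : c ∈ B) (h : ∀ u ∈ B, WalkWithin G B d c u) :
    IsShallowCluster G d B := by
  refine ⟨⟨c, hc⟩, fun u => ?_⟩
  obtain ⟨p, hp, hs⟩ := h u u.2
  have h1 := (p.induce B hs).edist_le
  have h2 : (p.induce B hs).length = p.length := by
    conv_rhs => rw [← p.map_induce hs]
    exact (SimpleGraph.Walk.length_map ..).symm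
  rw [h2] at h1
  exact h1.trans (by exact_mod_cast hp)

end WalkWithin

/-! ### Balanced separators or shallow clique models (Plotkin, Rao, Smith) -/

section Separation

set_option linter.unusedSectionVars false

variable {ι : Type*} [DecidableEq ι] (H : SimpleGraph ι)

/-- A model of a complete graph: pairwise disjoint and pairwise adjacent clusters of radius at
most `d`. -/
structure IsCliqueModel (d : ℕ) (𝒜 : Finset (Finset ι)) : Prop where
  shallow : ∀ A ∈ 𝒜, ∃ c ∈ A, ∀ u ∈ A, WalkWithin H (A : Set ι) d c u
  disjoint : ∀ A ∈ 𝒜, ∀ B ∈ 𝒜, A ≠ B → Disjoint A B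
  adjacent : ∀ A ∈ 𝒜, ∀ B ∈ 𝒜, A ≠ B → ∃ x ∈ A, ∃ y ∈ B, H.Adj x y

variable {H}

theorem IsCliqueModel.subset {d : ℕ} {𝒜 ℬ : Finset (Finset ι)} (h : IsCliqueModel H d 𝒜)
    (hs : ℬ ⊆ 𝒜) : IsCliqueModel H d ℬ :=
  ⟨fun A hA => h.shallow A (hs hA), fun A hA B hB => h.disjoint A (hs hA) B (hs hB),
    fun A hA B hB => h.adjacent A (hs hA) B (hs hB)⟩

theorem IsCliqueModel.insert {d : ℕ} {𝒜 : Finset (Finset ι)} {N : Finset ι}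
    (h : IsCliqueModel H d 𝒜) (hN : ∃ c ∈ N, ∀ u ∈ N, WalkWithin H (N : Set ι) d c u)
    (hd : ∀ A ∈ 𝒜, Disjoint A N) (ha : ∀ A ∈ 𝒜, ∃ x ∈ A, ∃ y ∈ N, H.Adj x y) :
    IsCliqueModel H d (insert N 𝒜) := by
  refine ⟨fun A hA => ?_, fun A hA B hB hAB => ?_, fun A hA B hB hAB => ?_⟩
  · rcases Finset.mem_insert.1 hA with rfl | hA
    · exact hN
    · exact h.shallow A hA
  · rcases Finset.mem_insert.1 hA with hA | hA <;> rcases Finset.mem_insert.1 hB with hB | hB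
    · exact absurd (hA.trans hB.symm) hAB
    · exact hA ▸ (hd B hB).symm
    · exact hB ▸ hd A hA
    · exact h.disjoint A hA B hB hAB
  · rcases Finset.mem_insert.1 hA with hA | hA <;> rcases Finset.mem_insert.1 hB with hB | hB
    · exact absurd (hA.trans hB.symm) hAB
    · obtain ⟨x, hx, y, hy, hxy⟩ := ha B hB
      exact ⟨y, hA ▸ hy, x, hx, hxy.symm⟩
    · exact hB ▸ ha A hA
    · exact h.adjacent A hA B hB hAB

open Classical in
/-- The ball of radius `i` about `v` in the subgraph induced by `R`. -/
noncomputable def ballWithin (H : SimpleGraph ι) (R : Finset ι) (v : ι) (i : ℕ) : Finset ι :=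
  R.filter fun u => WalkWithin H (R : Set ι) i v u

theorem mem_ballWithin {R : Finset ι} {v u : ι} {i : ℕ} :
    u ∈ ballWithin H R v i ↔ WalkWithin H (R : Set ι) i v u := by
  classical
  simp only [ballWithin, Finset.mem_filter, and_iff_right_iff_imp]
  exact fun h => by simpa using h.right_mem

theorem ballWithin_subset {R : Finset ι} {v : ι} {i : ℕ} : ballWithin H R v i ⊆ R := by
  classical exact Finset.filter_subset _ _

theorem ballWithin_mono {R : Finset ι} {v : ι} {i j : ℕ} (hij : i ≤ j) :
    ballWithin H R v i ⊆ ballWithin H R v j := fun _ hu =>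
  mem_ballWithin.2 ((mem_ballWithin.1 hu).mono subset_rfl hij)

/-- A ball whose cardinality stays small has a radius at which it grows slowly. -/
theorem exists_slow_growth {R : Finset ι} {v : ι} (hv : v ∈ R) {L d N : ℕ}
    (hN : (ballWithin H R v d).card ≤ N) (hd : N * L ^ d < (L + 1) ^ d) :
    ∃ j < d, L * (ballWithin H R v (j + 1) \ ballWithin H R v j).card
      ≤ (ballWithin H R v j).card := by
  by_contra! hcon
  -- If growth is fast at every radius, each step multiplies the ball by more than (L + 1)/L.
  have key : ∀ j ≤ d, (L + 1) ^ j ≤ (ballWithin H R v j).card * L ^ j := by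
    intro j
    induction j with
    | zero =>
      intro _
      have : 0 < (ballWithin H R v 0).card :=
        Finset.card_pos.2 ⟨v, mem_ballWithin.2 (.refl (by simpa using hv))⟩
      simpa using this
    | succ j ih =>
      intro hj
      have h1 := ih (by omega)
      have h2 := hcon j (by omega)
      have h3 := Finset.card_sdiff_add_card_eq_card
        (ballWithin_mono (H := H) (R := R) (v := v) (Nat.le_succ j))
      simp only [Nat.succ_eq_add_one] at h3
      rw [← h3, pow_succ, pow_succ]
      calc (L + 1) ^ j * (L + 1)
          ≤ ((ballWithin H R v j).card * L ^ j) * (L + 1) := Nat.mul_le_mul_right _ h1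
        _ = ((ballWithin H R v j).card + L * (ballWithin H R v j).card) * L ^ j := by ring
        _ ≤ (L * (ballWithin H R v (j + 1) \ ballWithin H R v j).card
              + L * (ballWithin H R v j).card) * L ^ j := by gcongr
        _ = _ := by ring
  have := key d le_rfl
  have h4 : (ballWithin H R v d).card * L ^ d ≤ N * L ^ d := Nat.mul_le_mul_right _ hN
  omega

/-- The invariant of the construction of a balanced separation of `U`: `R` is the part that has been
cut off, `Z` is the remaining part, and they are separated by `M` and the clusters in `𝒜`. -/
structure SeparationState (H : SimpleGraph ι) (U : Finset ι) (L d s : ℕ) (R M Z : Finset ι)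
    (𝒜 : Finset (Finset ι)) : Prop where
  model : IsCliqueModel H (2 * d) 𝒜
  card_cluster : ∀ A ∈ 𝒜, A.card ≤ s
  cluster_disjoint : ∀ A ∈ 𝒜, Disjoint A Z
  union : R ∪ M ∪ 𝒜.biUnion id ∪ Z = U
  disjoint : Disjoint R Z
  not_adj : ∀ x ∈ R, ∀ y ∈ Z, ¬ H.Adj x y
  card_sep : L * M.card ≤ R.card
  card_cut : 3 * R.card ≤ 2 * U.card

/-- A separation of `U` into two parts of total size at most `|U| + 2 σ`, each of size at most
`2/3 |U| + σ`. -/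
def HasSeparation (H : SimpleGraph ι) (U : Finset ι) (L σ : ℕ) : Prop :=
  ∃ A B M : Finset ι, A ∪ B = U ∧ (∀ x ∈ U, ∀ y ∈ U, H.Adj x y → x ∈ A ∧ y ∈ A ∨ x ∈ B ∧ y ∈ B) ∧
    L * M.card ≤ U.card ∧ A.card + B.card ≤ U.card + 2 * (M.card + σ) ∧
    3 * A.card ≤ 2 * U.card + 3 * (M.card + σ) ∧ 3 * B.card ≤ 2 * U.card + 3 * (M.card + σ)

/-- Both sides receive the separator, made of `M` and all clusters; there are at most `h` clusters
of size at most `s`. -/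
theorem SeparationState.hasSeparation {U : Finset ι} {L d s h : ℕ} {R M Z : Finset ι}
    {𝒜 : Finset (Finset ι)} (S : SeparationState H U L d s R M Z 𝒜) (h𝒜 : 𝒜.card ≤ h)
    (hZ : 3 * Z.card ≤ 2 * U.card) : HasSeparation H U L (h * s) := by
  have hsep : (M ∪ 𝒜.biUnion id).card ≤ M.card + h * s := by
    refine (Finset.card_union_le _ _).trans (Nat.add_le_add_left ?_ _)
    exact (Finset.card_biUnion_le_card_mul _ _ s fun A hA => S.card_cluster A hA).trans
      (Nat.mul_le_mul_right _ h𝒜)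
  have hRU : R ⊆ U := by
    rw [← S.union]; intro x hx; simp [hx]
  have hZU : Z ⊆ U := by
    rw [← S.union]; intro x hx; simp [hx]
  have hRZ : R.card + Z.card ≤ U.card := by
    rw [← Finset.card_union_of_disjoint S.disjoint]
    exact Finset.card_le_card (Finset.union_subset hRU hZU)
  have hA := Finset.card_union_le R (M ∪ 𝒜.biUnion id)
  have hB := Finset.card_union_le Z (M ∪ 𝒜.biUnion id)
  have hR3 := S.card_cut
  refine ⟨R ∪ (M ∪ 𝒜.biUnion id), Z ∪ (M ∪ 𝒜.biUnion id), M, ?_, fun x hx y hy hxy => ?_,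
    S.card_sep.trans (Finset.card_le_card hRU), by omega, by omega, by omega⟩
  · rw [← S.union]; ext x; simp only [Finset.mem_union]; tauto
  · rw [← S.union] at hx hy
    have h1 := S.not_adj x
    have h2 := S.not_adj y
    have h3 := hxy.symm
    simp only [Finset.mem_union] at hx hy ⊢
    by_cases hxR : x ∈ R <;> by_cases hyR : y ∈ R <;> by_cases hxZ : x ∈ Z <;>
      by_cases hyZ : y ∈ Z <;> simp_all

/-- A cluster without neighbours in `Z` no longer helps to separate and can join `R`. As `Z` exceeds
two thirds of `U`, the enlarged `R` stays below one third. -/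
theorem SeparationState.drop {U : Finset ι} {L d s : ℕ} {R M Z : Finset ι}
    {𝒜 : Finset (Finset ι)} (S : SeparationState H U L d s R M Z 𝒜) (hZ : 2 * U.card < 3 * Z.card)
    {A : Finset ι} (hA : A ∈ 𝒜) (hAZ : ∀ x ∈ A, ∀ y ∈ Z, ¬ H.Adj x y) :
    SeparationState H U L d s (R ∪ A) M Z (𝒜.erase A) := by
  have hun : (R ∪ A) ∪ M ∪ (𝒜.erase A).biUnion id ∪ Z = U := by
    rw [← S.union]
    conv_rhs => rw [← Finset.insert_erase hA, Finset.biUnion_insert]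
    ext x; simp only [Finset.mem_union, id]; tauto
  have hdis : Disjoint (R ∪ A) Z := Finset.disjoint_union_left.2 ⟨S.disjoint, S.cluster_disjoint A hA⟩
  have hc : (R ∪ A).card + Z.card ≤ U.card := by
    rw [← Finset.card_union_of_disjoint hdis]
    refine Finset.card_le_card fun x hx => ?_
    rw [← hun]; simp only [Finset.mem_union] at hx ⊢; tauto
  exact
    { model := S.model.subset (Finset.erase_subset _ _)
      card_cluster := fun B hB => S.card_cluster B (Finset.mem_of_mem_erase hB)
      cluster_disjoint := fun B hB => S.cluster_disjoint B (Finset.mem_of_mem_erase hB)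
      union := hun
      disjoint := hdis
      not_adj := fun x hx y hy =>
        (Finset.mem_union.1 hx).elim (fun h => S.not_adj x h y hy) (fun h => hAZ x h y hy)
      card_sep := S.card_sep.trans (Finset.card_le_card Finset.subset_union_left)
      card_cut := by omega }

theorem SeparationState.add {U : Finset ι} {L d s : ℕ} {R M Z : Finset ι}
    {𝒜 : Finset (Finset ι)} (S : SeparationState H U L d s R M Z 𝒜) {N : Finset ι} (hNZ : N ⊆ Z)
    (hNs : N.card ≤ s) (hN : ∃ c ∈ N, ∀ u ∈ N, WalkWithin H (N : Set ι) (2 * d) c u)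
    (ha : ∀ A ∈ 𝒜, ∃ x ∈ A, ∃ y ∈ N, H.Adj x y) :
    SeparationState H U L d s R M (Z \ N) (insert N 𝒜) where
  model := S.model.insert hN (fun A hA => (S.cluster_disjoint A hA).mono_right hNZ) ha
  card_cluster := fun B hB => (Finset.mem_insert.1 hB).elim (fun h => h ▸ hNs) (S.card_cluster B)
  cluster_disjoint := fun B hB => (Finset.mem_insert.1 hB).elim (fun h => h ▸ Finset.disjoint_sdiff)
    fun h => (S.cluster_disjoint B h).mono_right Finset.sdiff_subset
  union := by
    rw [← S.union, Finset.biUnion_insert]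
    ext x
    have := @hNZ x
    simp only [Finset.mem_union, Finset.mem_sdiff, id]; tauto
  disjoint := S.disjoint.mono_right Finset.sdiff_subset
  not_adj := fun x hx y hy => S.not_adj x hx y (Finset.sdiff_subset hy)
  card_sep := S.card_sep
  card_cut := S.card_cut

/-- The ball is cut off at a radius where it grows slowly. The next layer goes to `M` and is paid
for by the ball, which goes to `R`. -/
theorem SeparationState.cut {U : Finset ι} {L d s : ℕ} {R M Z : Finset ι}
    {𝒜 : Finset (Finset ι)} (S : SeparationState H U L d s R M Z 𝒜) (hZ : 2 * U.card < 3 * Z.card)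
    (hd : U.card * L ^ d < (L + 1) ^ d) {v : ι} (hv : v ∈ Z)
    (hb : 2 * (ballWithin H Z v d).card ≤ Z.card) :
    ∃ R' M' Z', SeparationState H U L d s R' M' Z' 𝒜 ∧ Z'.card < Z.card := by
  have hZU : Z ⊆ U := by
    rw [← S.union]; intro x hx; simp [hx]
  have hRZ : R.card + Z.card ≤ U.card := by
    rw [← Finset.card_union_of_disjoint S.disjoint]
    refine Finset.card_le_card (Finset.union_subset ?_ hZU)
    rw [← S.union]; intro x hx; simp [hx]
  obtain ⟨j, hj, hgrow⟩ := exists_slow_growth hv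
    ((Finset.card_le_card ballWithin_subset).trans (Finset.card_le_card hZU)) hd
  have hbZ : ballWithin H Z v j ⊆ Z := ballWithin_subset
  have hbZ' : ballWithin H Z v (j + 1) ⊆ Z := ballWithin_subset
  have hjj : ballWithin H Z v j ⊆ ballWithin H Z v (j + 1) := ballWithin_mono (Nat.le_succ j)
  have hRb : (R ∪ ballWithin H Z v j).card = R.card + (ballWithin H Z v j).card :=
    Finset.card_union_of_disjoint (S.disjoint.mono_right hbZ)
  have hM := Finset.card_union_le M (ballWithin H Z v (j + 1) \ ballWithin H Z v j)
  have hbd := Finset.card_le_card (ballWithin_mono (H := H) (R := Z) (v := v) hj.le)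
  refine ⟨R ∪ ballWithin H Z v j, M ∪ (ballWithin H Z v (j + 1) \ ballWithin H Z v j),
    Z \ ballWithin H Z v (j + 1), ⟨S.model, S.card_cluster,
      fun A hA => (S.cluster_disjoint A hA).mono_right Finset.sdiff_subset, ?_, ?_, ?_, ?_, ?_⟩, ?_⟩
  · rw [← S.union]
    ext x
    have h1 := @hbZ x
    have h2 := @hbZ' x
    have h3 := @hjj x
    simp only [Finset.mem_union, Finset.mem_sdiff]; tauto
  · refine Finset.disjoint_union_left.2 ⟨S.disjoint.mono_right Finset.sdiff_subset, ?_⟩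
    exact Finset.disjoint_of_subset_left hjj Finset.disjoint_sdiff
  · intro x hx y hy hxy
    obtain ⟨hyZ, hyb⟩ := Finset.mem_sdiff.1 hy
    rcases Finset.mem_union.1 hx with hx | hx
    · exact S.not_adj x hx y hyZ hxy
    · exact hyb (mem_ballWithin.2 ((mem_ballWithin.1 hx).trans
        (.of_adj hxy (by simpa using hbZ hx) (by simpa using hyZ))))
  · calc _ ≤ L * (M.card + (ballWithin H Z v (j + 1) \ ballWithin H Z v j).card) :=
        Nat.mul_le_mul_left _ hM
      _ ≤ R.card + (ballWithin H Z v j).card := by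
        rw [Nat.mul_add]; exact Nat.add_le_add S.card_sep hgrow
      _ = _ := hRb.symm
  -- With |R| + |Z| ≤ |U|, ball at most |Z|/2 and |Z| > 2|U|/3: |R| + |Z|/2 ≤ |U| - |Z|/2 < 2|U|/3.
  · omega
  · refine Finset.card_lt_card ⟨Finset.sdiff_subset, fun hcon => ?_⟩
    have hvb : v ∈ ballWithin H Z v (j + 1) := mem_ballWithin.2 (.refl (by simpa using hv))
    exact (Finset.mem_sdiff.1 (hcon hv)).2 hvb

/-- Either every cluster has a neighbour close to `v`, or some vertex has a small ball. -/
theorem exists_cluster_or_small_ball {d s : ℕ} {Z : Finset ι} {𝒜 : Finset (Finset ι)} {v : ι}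
    (hv : v ∈ Z)
    (hnb : ∀ A ∈ 𝒜, ∃ x ∈ A, ∃ y ∈ Z, H.Adj x y) (hs : 1 + 𝒜.card * (2 * d + 1) ≤ s) :
    (∃ N ⊆ Z, N.card ≤ s ∧ (∃ c ∈ N, ∀ u ∈ N, WalkWithin H (N : Set ι) (2 * d) c u) ∧
      ∀ A ∈ 𝒜, ∃ x ∈ A, ∃ y ∈ N, H.Adj x y) ∨
    ∃ w ∈ Z, 2 * (ballWithin H Z w d).card ≤ Z.card := by
  by_cases hfar : ∀ A ∈ 𝒜, ∃ x ∈ A, ∃ y ∈ Z, H.Adj x y ∧ WalkWithin H (Z : Set ι) (2 * d) v y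
  · left
    -- The new cluster is the union of one walk from `v` to each old cluster, hence adjacent to all
    -- of them and of radius 2d about `v`.
    have hP : ∀ A : Finset ι, ∃ P : Finset ι, A ∈ 𝒜 → P ⊆ Z ∧ P.card ≤ 2 * d + 1 ∧
        (∀ z ∈ P, WalkWithin H (P : Set ι) (2 * d) v z) ∧ ∃ x ∈ A, ∃ y ∈ P, H.Adj x y := by
      intro A
      by_cases hA : A ∈ 𝒜
      · obtain ⟨x, hx, y, hy, hxy, hw⟩ := hfar A hA
        obtain ⟨P, h1, h2, h3, h4, h5⟩ := hw.exists_finset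
        exact ⟨P, fun _ => ⟨by exact_mod_cast h1, h4, h5, x, hx, y, h3, hxy⟩⟩
      · exact ⟨∅, fun h => absurd h hA⟩
    choose P hP using hP
    refine ⟨insert v (𝒜.biUnion P), ?_, ?_, ⟨v, Finset.mem_insert_self _ _, fun u hu => ?_⟩, ?_⟩
    · refine Finset.insert_subset hv (Finset.biUnion_subset.2 fun A hA => (hP A hA).1)
    · refine (Finset.card_insert_le _ _).trans ?_
      have := Finset.card_biUnion_le_card_mul 𝒜 P (2 * d + 1) fun A hA => (hP A hA).2.1
      omega
    · rcases Finset.mem_insert.1 hu with rfl | hu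
      · exact .refl (by simp)
      · obtain ⟨A, hA, huA⟩ := Finset.mem_biUnion.1 hu
        refine ((hP A hA).2.2.1 u huA).mono ?_ le_rfl
        exact_mod_cast (Finset.subset_biUnion_of_mem P hA).trans (Finset.subset_insert _ _)
    · intro A hA
      obtain ⟨x, hx, y, hy, hxy⟩ := (hP A hA).2.2.2
      exact ⟨x, hx, y, Finset.mem_insert_of_mem (Finset.mem_biUnion.2 ⟨A, hA, hy⟩), hxy⟩
  · right
    push Not at hfar
    obtain ⟨A, hA, hA'⟩ := hfar
    obtain ⟨x, hx, y, hy, hxy⟩ := hnb A hA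
    have hno := hA' x hx y hy hxy
    -- `y` is farther than 2d from `v`, so the two balls of radius d are disjoint and one of them
    -- has at most half of `Z`.
    have hdis : Disjoint (ballWithin H Z v d) (ballWithin H Z y d) := by
      refine Finset.disjoint_left.2 fun u hu hu' => hno ?_
      rw [two_mul]
      exact (mem_ballWithin.1 hu).trans (mem_ballWithin.1 hu').symm
    have hsum : (ballWithin H Z v d).card + (ballWithin H Z y d).card ≤ Z.card := by
      rw [← Finset.card_union_of_disjoint hdis]
      exact Finset.card_le_card (Finset.union_subset ballWithin_subset ballWithin_subset)
    rcases le_total (ballWithin H Z v d).card (ballWithin H Z y d).card with h | h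
    · exact ⟨v, hv, by omega⟩
    · exact ⟨y, hy, by omega⟩

theorem SeparationState.exists_hasSeparation {U : Finset ι} {L d h : ℕ}
    (hK : ∀ 𝒜 : Finset (Finset ι), IsCliqueModel H (2 * d) 𝒜 → 𝒜.card ≤ h)
    (hd : U.card * L ^ d < (L + 1) ^ d) :
    ∀ (m : ℕ) {R M Z : Finset ι} {𝒜 : Finset (Finset ι)}, 2 * Z.card + 𝒜.card ≤ m →
      SeparationState H U L d (1 + h * (2 * d + 1)) R M Z 𝒜 →
      HasSeparation H U L (h * (1 + h * (2 * d + 1))) := by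
  -- The measure 2|Z| + |𝒜| decreases in every move: a new cluster adds one to |𝒜| but takes at
  -- least one vertex from `Z`.
  intro m
  induction m with
  | zero =>
    intro R M Z 𝒜 hm S
    exact S.hasSeparation (hK _ S.model) (by omega)
  | succ m ih =>
    intro R M Z 𝒜 hm S
    rcases le_or_gt (3 * Z.card) (2 * U.card) with hZ | hZ
    · exact S.hasSeparation (hK _ S.model) hZ
    by_cases hnb : ∀ A ∈ 𝒜, ∃ x ∈ A, ∃ y ∈ Z, H.Adj x y
    · obtain ⟨v, hv⟩ : Z.Nonempty := Finset.card_pos.1 (by omega)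
      rcases exists_cluster_or_small_ball hv hnb
        (Nat.add_le_add_left (Nat.mul_le_mul_right _ (hK _ S.model)) _) with
        ⟨N, hNZ, hNs, hN, hNA⟩ | ⟨w, hw, hwb⟩
      · obtain ⟨c, hc, _⟩ := id hN
        have h1 : (Z \ N).card < Z.card :=
          Finset.card_lt_card ⟨Finset.sdiff_subset, fun hcon =>
            (Finset.mem_sdiff.1 (hcon (hNZ hc))).2 hc⟩
        have h2 := Finset.card_insert_le N 𝒜
        exact ih (by omega) (S.add hNZ hNs hN hNA)
      · obtain ⟨R', M', Z', S', hlt⟩ := S.cut hZ hd hw hwb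
        exact ih (by omega) S'
    · push Not at hnb
      obtain ⟨A, hA, hAZ⟩ := hnb
      have h1 := Finset.card_erase_lt_of_mem hA
      exact ih (by omega) (S.drop hZ hA hAZ)

/-- A graph without shallow models of large complete graphs has small balanced separators. -/
theorem hasSeparation_of_cliqueModel_card_le (U : Finset ι) {L d h : ℕ}
    (hK : ∀ 𝒜 : Finset (Finset ι), IsCliqueModel H (2 * d) 𝒜 → 𝒜.card ≤ h)
    (hd : U.card * L ^ d < (L + 1) ^ d) :
    HasSeparation H U L (h * (1 + h * (2 * d + 1))) := by
  refine SeparationState.exists_hasSeparation hK hd (2 * U.card) (R := ∅) (M := ∅) (Z := U) (𝒜 := ∅)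
    (by simp) ?_
  exact
    { model := ⟨by simp, by simp, by simp⟩
      card_cluster := by simp
      cluster_disjoint := by simp
      union := by simp
      disjoint := by simp
      not_adj := by simp
      card_sep := by simp
      card_cut := by simp }

end Separation

/-! ### Pairwise intersecting clusters: a shallow minor by random sampling -/

section Sampling

/-- The walk is cut at its first entry into `S`: `y` is the last vertex before it and `z` the entry.
-/
theorem WalkWithin.exists_exit {V : Type*} {G : SimpleGraph V} {B S : Set V} {d : ℕ} {a x : V}
    (h : WalkWithin G B d a x) (ha : a ∉ S) (hx : x ∈ S) :
    ∃ y z, WalkWithin G (B \ S) d a y ∧ G.Adj y z ∧ z ∈ B ∧ z ∈ S := by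
  obtain ⟨p, hp, hs⟩ := h
  induction p generalizing d with
  | nil => exact absurd hx ha
  | @cons a b x hab p ih =>
    have haB : a ∈ B := hs a (by simp)
    have hbB : b ∈ B := hs b (by simp)
    by_cases hb : b ∈ S
    · exact ⟨a, b, WalkWithin.refl (Set.mem_sdiff_of_mem haB ha), hab, hbB, hb⟩
    · simp only [SimpleGraph.Walk.length_cons] at hp
      obtain ⟨y, z, hw, h1, h2, h3⟩ := ih (d := d - 1) hb hx (by omega)
        fun z hz => hs z (by simp [hz])
      refine ⟨y, z, ?_, h1, h2, h3⟩
      exact ((WalkWithin.of_adj hab (Set.mem_sdiff_of_mem haB ha) (Set.mem_sdiff_of_mem hbB hb)).trans hw).mono subset_rfl (by omega)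

/-- Two touching clusters contain disjoint adjacent paths which start at their centers. -/
theorem exists_disjoint_adjacent_sides {V : Type*} {G : SimpleGraph V} {B B' : Set V} {d : ℕ}
    {c c' : V} (hB : ∀ u ∈ B, WalkWithin G B d c u) (hB' : ∀ u ∈ B', WalkWithin G B' d c' u)
    (hne : (B ∩ B').Nonempty) (hc : c ∉ B') :
    ∃ P Q : Finset V, (↑P ⊆ B ∧ c ∈ P ∧ P.card ≤ d + 1 ∧ ∀ z ∈ P, WalkWithin G (P : Set V) d c z) ∧
      (↑Q ⊆ B' ∧ c' ∈ Q ∧ Q.card ≤ d + 1 ∧ ∀ z ∈ Q, WalkWithin G (Q : Set V) d c' z) ∧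
      Disjoint P Q ∧ ∃ x ∈ P, ∃ y ∈ Q, G.Adj x y := by
  classical
  obtain ⟨x, hx, hx'⟩ := hne
  -- The first path stops just before entering `B'`, so it is disjoint from every path inside `B'`;
  -- this is where `c ∉ B'` is needed.
  obtain ⟨y, z, hw, hyz, -, hz⟩ := (hB x hx).exists_exit hc hx'
  obtain ⟨P, hP1, hP2, hP3, hP4, hP5⟩ := hw.exists_finset
  obtain ⟨Q, hQ1, hQ2, hQ3, hQ4, hQ5⟩ := (hB' z hz).exists_finset
  refine ⟨P, Q, ⟨hP1.trans Set.sdiff_subset, hP2, hP4, hP5⟩, ⟨hQ1, hQ2, hQ4, hQ5⟩, ?_,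
    y, hP3, z, hQ3, hyz⟩
  exact Finset.disjoint_left.2 fun v hv hv' => (hP1 hv).2 (hQ1 hv')

theorem card_darts_eq {W : Type*} [Fintype W] [DecidableEq W] (M : SimpleGraph W)
    [DecidableRel M.Adj] :
    (Finset.univ.filter fun p : W × W => M.Adj p.1 p.2).card = 2 * M.edgeSet.ncard := by
  rw [← SimpleGraph.coe_edgeFinset, Set.ncard_coe_finset, ← M.sum_degrees_eq_twice_card_edges,
    Finset.card_filter, Fintype.sum_prod_type]
  refine Finset.sum_congr rfl fun v _ => ?_
  rw [← SimpleGraph.card_neighborFinset_eq_degree, SimpleGraph.neighborFinset_eq_filter,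
    Finset.card_filter]

open Classical in
/-- A bound on the edge density of shallow minors, for minors with arbitrary finite vertex sets and
arbitrarily many isolated vertices that have no cluster. -/
theorem card_darts_le_of_shallow {V W : Type*} [Fintype W] {G : SimpleGraph V} {d F : ℕ}
    (hF : ∀ (m : ℕ) (M : SimpleGraph (Fin m)), IsShallowMinor d M G → M.edgeSet.ncard ≤ F * m)
    (M : SimpleGraph W) (D : W → Set V)
    (hD : ∀ i, (∃ j, M.Adj i j) → IsShallowCluster G d (D i))
    (hdis : ∀ i j, i ≠ j → Disjoint (D i) (D j))
    (hadj : ∀ i j, M.Adj i j → ∃ x ∈ D i, ∃ y ∈ D j, G.Adj x y) :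
    (Finset.univ.filter fun p : W × W => M.Adj p.1 p.2).card
      ≤ 2 * F * (Finset.univ.filter fun i => ∃ j, M.Adj i j).card := by
  set T := Finset.univ.filter fun i => ∃ j, M.Adj i j with hT
  let e : Fin T.card ≃ T := T.equivFin.symm
  let φ : Fin T.card → W := fun a => (e a : W)
  have hφ : Function.Injective φ := Subtype.val_injective.comp e.injective
  have hφT : ∀ i, (∃ j, M.Adj i j) → ∃ a, φ a = i := fun i hi =>
    ⟨e.symm ⟨i, by simpa [hT] using hi⟩, by simp [φ]⟩
  have h1 := hF T.card (M.comap φ) ⟨fun a => D (φ a), fun a => hD _ ?_,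
    fun a b hab => hdis _ _ fun h => hab (hφ h), fun a b hab => hadj _ _ hab⟩
  · have h2 := card_darts_eq (M.comap φ)
    have h3 : (Finset.univ.filter fun p : W × W => M.Adj p.1 p.2).card
        ≤ (Finset.univ.filter fun p : Fin T.card × Fin T.card => (M.comap φ).Adj p.1 p.2).card := by
      refine Finset.card_le_card_of_surjOn (fun p => (φ p.1, φ p.2)) ?_
      rintro ⟨i, j⟩ hij
      have hij' : M.Adj i j := by simpa using hij
      obtain ⟨a, rfl⟩ := hφT i ⟨j, hij'⟩
      obtain ⟨b, rfl⟩ := hφT j ⟨_, hij'.symm⟩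
      exact ⟨(a, b), by simpa using hij', rfl⟩
    calc _ ≤ _ := h3
      _ = 2 * (M.comap φ).edgeSet.ncard := by convert h2
      _ ≤ 2 * (F * T.card) := Nat.mul_le_mul_left _ h1
      _ = _ := by ring
  · exact (Finset.mem_filter.1 (e a).2).2

/-- Counting form of independence: for a uniform function to `Fin q`, the zero set contains `S` with
probability q^(-|S|). -/
theorem card_functions_zero_on {W : Type*} [Fintype W] [DecidableEq W] {q : ℕ} [NeZero q]
    (S : Finset W) :
    (Finset.univ.filter fun f : W → Fin q => ∀ x ∈ S, f x = 0).card * q ^ S.card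
      = q ^ Fintype.card W := by
  have h1 : (Finset.univ.filter fun f : W → Fin q => ∀ x ∈ S, f x = 0)
      = Fintype.piFinset fun x => if x ∈ S then {0} else Finset.univ := by
    ext f
    simp only [Finset.mem_filter, Finset.mem_univ, true_and, Fintype.mem_piFinset]
    refine forall_congr' fun x => ?_
    by_cases hx : x ∈ S <;> simp [hx]
  rw [h1, Fintype.card_piFinset]
  have h2 : ∀ x, (if x ∈ S then ({0} : Finset (Fin q)) else Finset.univ).card
      = if x ∈ S then 1 else q := fun x => by by_cases hx : x ∈ S <;> simp [hx]
  simp only [h2]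
  rw [Finset.prod_ite]
  simp only [Finset.prod_const_one, one_mul, Finset.prod_const]
  rw [← pow_add, ← Finset.card_univ]
  congr 1
  have := Finset.card_filter_add_card_filter_not (s := (Finset.univ : Finset W)) (fun x => x ∈ S)
  simp at this ⊢
  omega

open Classical in
/-- Averaging over random vertex subsets: if a bound on the number of conflict free pairs inside
a vertex subset, linear in its size, holds for every subset, then there are few pairs. -/
theorem card_pairs_le_of_sampling {W : Type*} [Fintype W] {Γ : Finset (W × W)}
    (hΓ : ∀ p ∈ Γ, p.1 ≠ p.2) {K : W × W → Finset W} {Q b : ℕ} (hQ : 0 < Q)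
    (hK : ∀ p ∈ Γ, (K p).card ≤ Q) (hK' : ∀ p ∈ Γ, p.1 ∉ K p ∧ p.2 ∉ K p)
    (hb : ∀ A : Finset W, (Γ.filter fun p => p.1 ∈ A ∧ p.2 ∈ A ∧ ∀ k ∈ K p, k ∉ A).card
      ≤ b * A.card) :
    Γ.card ≤ 4 * b * Q * Fintype.card W := by
  -- A random subset is the zero set of a random function, so every element is chosen with
  -- probability 1/(2Q).
  set q := 2 * Q with hq
  have : NeZero q := ⟨by omega⟩
  let Z : (W → Fin q) → Finset W := fun f => Finset.univ.filter fun x => f x = 0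
  let F : Finset W → ℕ := fun S => (Finset.univ.filter fun f : W → Fin q => ∀ x ∈ S, f x = 0).card
  have hF : ∀ S : Finset W, F S * q ^ S.card = q ^ Fintype.card W := fun S => by
    simpa [F] using card_functions_zero_on (q := q) S
  have hup : ∑ f : W → Fin q, (Z f).card * q = Fintype.card W * q ^ Fintype.card W := by
    rw [← Finset.sum_mul]
    have : ∑ f : W → Fin q, (Z f).card = ∑ x : W, F {x} := by
      simp only [Z, F, Finset.card_filter, Finset.mem_singleton, forall_eq]
      exact Finset.sum_comm
    rw [this, Finset.sum_mul]
    have h2 : ∀ x : W, F {x} * q = q ^ Fintype.card W := fun x => by simpa using hF {x}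
    simp [h2]
  -- A pair survives with probability at least 1/q² - Q/q³ = Q/q³, by the union bound over its at
  -- most `Q` conflicts.
  have hlow : ∀ p ∈ Γ, Q * q ^ Fintype.card W ≤ (Finset.univ.filter fun f : W → Fin q =>
      p.1 ∈ Z f ∧ p.2 ∈ Z f ∧ ∀ k ∈ K p, k ∉ Z f).card * q ^ 3 := by
    intro p hp
    have hne := hΓ p hp
    have h1 : F {p.1, p.2} ≤ (Finset.univ.filter fun f : W → Fin q =>
        p.1 ∈ Z f ∧ p.2 ∈ Z f ∧ ∀ k ∈ K p, k ∉ Z f).card + ∑ k ∈ K p, F {k, p.1, p.2} := by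
      refine le_trans (Finset.card_le_card ?_)
        ((Finset.card_union_le _ _).trans (Nat.add_le_add_left Finset.card_biUnion_le _))
      intro f hf
      simp only [Finset.mem_filter, Finset.mem_univ, true_and, Finset.mem_insert,
        Finset.mem_singleton, forall_eq_or_imp, forall_eq, Finset.mem_union, Finset.mem_biUnion,
        Z] at hf ⊢
      by_cases hk : ∃ k ∈ K p, f k = 0
      · obtain ⟨k, hk, hk0⟩ := hk
        exact Or.inr ⟨k, hk, hk0, hf⟩
      · push Not at hk
        exact Or.inl ⟨hf.1, hf.2, hk⟩
    have h2 : F {p.1, p.2} * q ^ 2 = q ^ Fintype.card W := by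
      rw [← hF {p.1, p.2}, Finset.card_pair hne]
    have h3 : ∀ k ∈ K p, F {k, p.1, p.2} * q ^ 3 = q ^ Fintype.card W := by
      intro k hk
      have := hK' p hp
      rw [← hF {k, p.1, p.2}, Finset.card_insert_of_notMem, Finset.card_pair hne]
      simp only [Finset.mem_insert, Finset.mem_singleton, not_or]
      exact ⟨fun h => this.1 (h ▸ hk), fun h => this.2 (h ▸ hk)⟩
    have h4 := Nat.mul_le_mul_right (q ^ 3) h1
    rw [Nat.add_mul, Finset.sum_mul, Finset.sum_congr rfl h3, Finset.sum_const, smul_eq_mul] at h4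
    have h5 : F {p.1, p.2} * q ^ 3 = q * q ^ Fintype.card W := by rw [← h2]; ring
    have h6 := Nat.mul_le_mul_right (q ^ Fintype.card W) (hK p hp)
    have h8 : q * q ^ Fintype.card W = Q * q ^ Fintype.card W + Q * q ^ Fintype.card W := by
      rw [hq]; ring
    rw [h5, h8] at h4
    omega
  have hswap : ∑ f : W → Fin q, (Γ.filter fun p => p.1 ∈ Z f ∧ p.2 ∈ Z f ∧
      ∀ k ∈ K p, k ∉ Z f).card = ∑ p ∈ Γ, (Finset.univ.filter fun f : W → Fin q =>
      p.1 ∈ Z f ∧ p.2 ∈ Z f ∧ ∀ k ∈ K p, k ∉ Z f).card := by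
    simp only [Finset.card_filter]
    exact Finset.sum_comm
  have h7 : Γ.card * (Q * q ^ Fintype.card W)
      ≤ (b * q ^ 2) * (Fintype.card W * q ^ Fintype.card W) := by
    calc Γ.card * (Q * q ^ Fintype.card W) = ∑ p ∈ Γ, Q * q ^ Fintype.card W := by simp
      _ ≤ ∑ p ∈ Γ, (Finset.univ.filter fun f : W → Fin q =>
          p.1 ∈ Z f ∧ p.2 ∈ Z f ∧ ∀ k ∈ K p, k ∉ Z f).card * q ^ 3 := Finset.sum_le_sum hlow
      _ = (∑ f : W → Fin q, (Γ.filter fun p => p.1 ∈ Z f ∧ p.2 ∈ Z f ∧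
          ∀ k ∈ K p, k ∉ Z f).card) * q ^ 3 := by rw [hswap, Finset.sum_mul]
      _ ≤ (∑ f : W → Fin q, b * (Z f).card) * q ^ 3 :=
          Nat.mul_le_mul_right _ (Finset.sum_le_sum fun f _ => hb _)
      _ = (b * q ^ 2) * ∑ f : W → Fin q, (Z f).card * q := by
          rw [← Finset.mul_sum, ← Finset.sum_mul]; ring
      _ = _ := by rw [hup]
  have hpos : 0 < Q * q ^ Fintype.card W := by positivity
  refine Nat.le_of_mul_le_mul_right (h7.trans (le_of_eq ?_)) hpos
  rw [hq]; ring

open Classical in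
/-- Pairwise intersecting clusters of radius `d` with overlap `t` in a graph whose `d`-shallow
minors have at most `F` edges per vertex: there are few of them. -/
theorem card_le_of_pairwise_intersecting {V : Type*} {G : SimpleGraph V} {h d t F : ℕ}
    (hF : ∀ (m : ℕ) (M : SimpleGraph (Fin m)), IsShallowMinor d M G → M.edgeSet.ncard ≤ F * m)
    (B : Fin h → Set V) (c : Fin h → V) (hB : ∀ i, ∀ u ∈ B i, WalkWithin G (B i) d (c i) u)
    (hc : ∀ i, c i ∈ B i) (hint : ∀ i j, i ≠ j → (B i ∩ B j).Nonempty)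
    (ht : ∀ v, (Finset.univ.filter fun i => v ∈ B i).card ≤ t) :
    h ≤ 1 + t + 16 * F * ((d + 1) * t) := by
  rcases Nat.eq_zero_or_pos h with rfl | hpos
  · omega
  have ht0 : 0 < t := lt_of_lt_of_le
    (Finset.card_pos.2 ⟨⟨0, hpos⟩, by simpa using hc ⟨0, hpos⟩⟩) (ht (c ⟨0, hpos⟩))
  -- Disjoint paths require one center outside the other cluster. The pairs without such a center
  -- are at most `h * t`, by the overlap bound, and are counted separately at the end.
  let g : Fin h → Fin h → Prop := fun i j => i ≠ j ∧ ¬ (c i ∈ B j ∧ c j ∈ B i)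
  have hg : ∀ i j, g i j → g j i := fun i j hij => ⟨hij.1.symm, fun h => hij.2 h.symm⟩
  let side : Fin h → Finset V → Prop := fun i P =>
    ↑P ⊆ B i ∧ c i ∈ P ∧ P.card ≤ d + 1 ∧ ∀ z ∈ P, WalkWithin G (P : Set V) d (c i) z
  have hex : ∀ i j, ∃ P Q : Finset V, g i j → side i P ∧ side j Q ∧
      Disjoint P Q ∧ ∃ x ∈ P, ∃ y ∈ Q, G.Adj x y := by
    intro i j
    by_cases hij : g i j
    · by_cases hcj : c i ∈ B j
      · have hci : c j ∉ B i := fun h => hij.2 ⟨hcj, h⟩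
        obtain ⟨P, Q, h1, h2, h3, x, hx, y, hy, hxy⟩ := exists_disjoint_adjacent_sides (hB j) (hB i)
          (hint j i hij.1.symm) hci
        exact ⟨Q, P, fun _ => ⟨h2, h1, h3.symm, y, hy, x, hx, hxy.symm⟩⟩
      · obtain ⟨P, Q, h1⟩ := exists_disjoint_adjacent_sides (hB i) (hB j) (hint i j hij.1) hcj
        exact ⟨P, Q, fun _ => h1⟩
    · exact ⟨∅, ∅, fun h => absurd h hij⟩
  choose P Q hPQ using hex
  -- The order of the indices makes `S i j` and `S j i` the two sides of the same choice.
  let S : Fin h → Fin h → Finset V := fun i j => if i < j then P i j else Q j i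
  have hS : ∀ i j, g i j → side i (S i j) ∧ Disjoint (S i j) (S j i) ∧
      ∃ x ∈ S i j, ∃ y ∈ S j i, G.Adj x y := by
    intro i j hij
    rcases lt_or_gt_of_ne hij.1 with hlt | hlt
    · obtain ⟨h1, h2, h3, h4⟩ := hPQ i j hij
      simp only [S, hlt, hlt.not_gt, if_true, if_false]
      exact ⟨h1, h3, h4⟩
    · obtain ⟨h1, h2, h3, x, hx, y, hy, hxy⟩ := hPQ j i (hg i j hij)
      simp only [S, hlt, hlt.not_gt, if_true, if_false]
      exact ⟨h2, h3.symm, y, hy, x, hx, hxy.symm⟩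
  let Γ : Finset (Fin h × Fin h) := Finset.univ.filter fun p => g p.1 p.2
  -- The conflicts of a pair are the other clusters that meet its two paths: at most 2(d + 1) path
  -- vertices, each in at most `t` clusters.
  let K : Fin h × Fin h → Finset (Fin h) := fun p => Finset.univ.filter fun k =>
    k ≠ p.1 ∧ k ≠ p.2 ∧ ∃ v ∈ S p.1 p.2 ∪ S p.2 p.1, v ∈ B k
  have hKcard : ∀ p ∈ Γ, (K p).card ≤ 2 * ((d + 1) * t) := by
    intro p hp
    have hgp : g p.1 p.2 := by simpa [Γ] using hp
    calc (K p).card ≤ ((S p.1 p.2 ∪ S p.2 p.1).biUnion fun v =>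
          Finset.univ.filter fun i => v ∈ B i).card := by
          refine Finset.card_le_card fun k hk => ?_
          obtain ⟨-, -, v, hv, hvk⟩ := (Finset.mem_filter.1 hk).2
          exact Finset.mem_biUnion.2 ⟨v, hv, by simpa using hvk⟩
      _ ≤ (S p.1 p.2 ∪ S p.2 p.1).card * t := Finset.card_biUnion_le_card_mul _ _ _ fun v _ => ht v
      _ ≤ ((d + 1) + (d + 1)) * t := by
          refine Nat.mul_le_mul_right _ ((Finset.card_union_le _ _).trans (add_le_add ?_ ?_))
          · exact (hS _ _ hgp).1.2.2.1
          · exact (hS _ _ (hg _ _ hgp)).1.2.2.1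
      _ = _ := by ring
  have hKsymm : ∀ i j, K (i, j) = K (j, i) := by
    intro i j
    ext k
    simp only [K, Finset.mem_filter, Finset.mem_univ, true_and, Finset.union_comm (S i j)]
    tauto
  have hmain := card_pairs_le_of_sampling (Γ := Γ) (K := K) (Q := 2 * ((d + 1) * t)) (b := 2 * F)
    (fun p hp => by
      have hgp : g p.1 p.2 := by simpa [Γ] using hp
      exact hgp.1) (by positivity) hKcard
    (fun p _ => by simp [K]) (by
      intro A
      let M : SimpleGraph (Fin h) :=
        { Adj := fun i j => g i j ∧ i ∈ A ∧ j ∈ A ∧ ∀ k ∈ K (i, j), k ∉ A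
          symm := ⟨fun i j hij => ⟨hg _ _ hij.1, hij.2.2.1, hij.2.1, hKsymm i j ▸ hij.2.2.2⟩⟩
          loopless := ⟨fun i hi => hi.1.1 rfl⟩ }
      -- The cluster of `i` in the minor is the union of its paths towards its neighbours in `M`,
      -- all starting at `c i`; hence its radius is still at most `d`.
      have hbound := card_darts_le_of_shallow hF M
        (fun i => ⋃ (j) (_ : M.Adj i j), (S i j : Set V)) ?_ ?_ ?_
      · refine le_trans (le_of_eq ?_) (hbound.trans (Nat.mul_le_mul_left _ (Finset.card_le_card ?_)))
        · congr 1
          ext p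
          simp [Γ, M]
        · intro i hi
          obtain ⟨j, hj⟩ := ((@Finset.mem_filter _ _ (_) _ _).1 hi).2
          exact hj.2.1
      · rintro i ⟨j, hj⟩
        refine WalkWithin.isShallowCluster (c := c i) ?_ ?_
        · exact Set.mem_iUnion₂.2 ⟨j, hj, (hS i j hj.1).1.2.1⟩
        · intro u hu
          obtain ⟨l, hl, hul⟩ := Set.mem_iUnion₂.1 hu
          refine ((hS i l hl.1).1.2.2.2 u hul).mono ?_ le_rfl
          exact Set.subset_iUnion₂ (s := fun j (_ : M.Adj i j) => (S i j : Set V)) l hl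
      · intro i j hij
        refine Set.disjoint_left.2 fun v hv hv' => ?_
        obtain ⟨a, ha, hva⟩ := Set.mem_iUnion₂.1 hv
        obtain ⟨b, hb, hvb⟩ := Set.mem_iUnion₂.1 hv'
        have hvi : v ∈ B i := (hS i a ha.1).1.1 hva
        have hvj : v ∈ B j := (hS j b hb.1).1.1 hvb
        -- Otherwise the path from `i` to `a` meets the cluster of the sampled index `j`, which is a
        -- conflict. So a common vertex can only lie on both sides of the pair (i, j), and these are
        -- disjoint.
        have haj : a = j := by
          by_contra hne
          refine ha.2.2.2 j ?_ hb.2.1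
          simp only [K, Finset.mem_filter, Finset.mem_univ, true_and]
          exact ⟨hij.symm, Ne.symm hne, v, Finset.mem_union_left _ hva, hvj⟩
        have hbi : b = i := by
          by_contra hne
          refine hb.2.2.2 i ?_ ha.2.1
          simp only [K, Finset.mem_filter, Finset.mem_univ, true_and]
          exact ⟨hij, Ne.symm hne, v, Finset.mem_union_left _ hvb, hvi⟩
        subst haj hbi
        exact Finset.disjoint_left.1 (hS _ _ ha.1).2.1 hva hvb
      · intro i j hij
        obtain ⟨x, hx, y, hy, hxy⟩ := (hS i j hij.1).2.2
        exact ⟨x, Set.mem_iUnion₂.2 ⟨j, hij, hx⟩, y, Set.mem_iUnion₂.2 ⟨i, hij.symm, hy⟩, hxy⟩)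
  rw [Fintype.card_fin] at hmain
  have hcount : h * (h - 1) ≤ Γ.card + h * t := by
    have h1 : (Finset.univ.filter fun p : Fin h × Fin h => p.1 ≠ p.2).card = h * (h - 1) := by
      have := Finset.offDiag_card (Finset.univ : Finset (Fin h))
      rw [Finset.card_univ, Fintype.card_fin, ← Nat.mul_sub_one] at this
      rw [← this]
      congr 1
      ext p
      simp [Finset.mem_offDiag]
    have h2 : (Finset.univ.filter fun p : Fin h × Fin h => c p.1 ∈ B p.2).card ≤ h * t := by
      rw [Finset.card_filter, Fintype.sum_prod_type]
      calc _ ≤ ∑ _i : Fin h, t := Finset.sum_le_sum fun i _ => by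
            rw [← Finset.card_filter]; exact ht (c i)
        _ = _ := by simp
    rw [← h1]
    refine le_trans (Finset.card_le_card ?_)
      ((Finset.card_union_le _ _).trans (Nat.add_le_add_left h2 _))
    intro p hp
    simp only [Finset.mem_filter, Finset.mem_univ, true_and, Finset.mem_union, Γ, g] at hp ⊢
    tauto
  have hle : h - 1 ≤ t + 16 * F * ((d + 1) * t) := by
    refine Nat.le_of_mul_le_mul_left (le_trans hcount ?_) hpos
    refine (Nat.add_le_add_right hmain _).trans (le_of_eq ?_)
    ring
  omega

end Sampling

/-! ### Intersection graphs and preference clusters -/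

section Clusters

/-- The intersection graph of a family of sets. -/
def intersectionGraph {ι V : Type*} (C : ι → Set V) : SimpleGraph ι where
  Adj x y := x ≠ y ∧ (C x ∩ C y).Nonempty
  symm := ⟨fun _ _ h => ⟨h.1.symm, Set.inter_comm _ _ ▸ h.2⟩⟩
  loopless := ⟨fun _ h => h.1 rfl⟩

/-- One step between intersecting clusters costs at most 2ρ: from a center to a common vertex and on
to the next center. -/
theorem WalkWithin.of_intersectionGraph {ι V : Type*} {G : SimpleGraph V} {C : ι → Set V}
    {cen : ι → V} {ρ : ℕ} (hcen : ∀ x, cen x ∈ C x)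
    (hC : ∀ x, ∀ w ∈ C x, WalkWithin G (C x) ρ (cen x) w) {A : Set ι} {D : ℕ} {x y : ι}
    (h : WalkWithin (intersectionGraph C) A D x y) :
    WalkWithin G (⋃ z ∈ A, C z) (2 * ρ * D) (cen x) (cen y) := by
  obtain ⟨p, hp, hs⟩ := h
  induction p generalizing D with
  | @nil x => exact .refl (Set.mem_iUnion₂.2 ⟨x, hs x (by simp), hcen x⟩)
  | @cons x z y hxz p ih =>
    simp only [SimpleGraph.Walk.length_cons] at hp
    have h1 := ih (D := D - 1) (by omega) fun u hu => hs u (by simp [hu])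
    obtain ⟨w, hwx, hwz⟩ := hxz.2
    have hx : C x ⊆ ⋃ z ∈ A, C z := Set.subset_iUnion₂ (s := fun z (_ : z ∈ A) => C z) x
      (hs x (by simp))
    have hz : C z ⊆ ⋃ z ∈ A, C z := Set.subset_iUnion₂ (s := fun z (_ : z ∈ A) => C z) z
      (hs z (by simp))
    refine ((((hC x w hwx).mono hx le_rfl).trans ((hC z w hwz).symm.mono hz le_rfl)).trans h1).mono
      subset_rfl ?_
    obtain ⟨D', rfl⟩ : ∃ D', D = D' + 1 := ⟨D - 1, by omega⟩
    simp only [Nat.add_sub_cancel]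
    exact le_of_eq (by ring)

open Classical in
/-- Shallow clique models in the intersection graph of shallow clusters with bounded overlap are
small if the shallow minors of the underlying graph are sparse. -/
theorem IsCliqueModel.card_le_of_intersectionGraph {ι V : Type*} [Fintype ι]
    {G : SimpleGraph V} {C : ι → Set V} {cen : ι → V} {ρ t D F : ℕ} (hcen : ∀ x, cen x ∈ C x)
    (hC : ∀ x, ∀ w ∈ C x, WalkWithin G (C x) ρ (cen x) w)
    (ht : ∀ w, (Finset.univ.filter fun x => w ∈ C x).card ≤ t)
    (hF : ∀ (m : ℕ) (M : SimpleGraph (Fin m)), IsShallowMinor (2 * ρ * D + ρ) M G →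
      M.edgeSet.ncard ≤ F * m)
    {𝒜 : Finset (Finset ι)} (h𝒜 : IsCliqueModel (intersectionGraph C) D 𝒜) :
    𝒜.card ≤ 1 + t + 16 * F * ((2 * ρ * D + ρ + 1) * t) := by
  let e : Fin 𝒜.card ≃ 𝒜 := 𝒜.equivFin.symm
  have hinj : ∀ i j, i ≠ j → (e i : Finset ι) ≠ e j := fun i j hij h =>
    hij (e.injective (Subtype.ext h))
  choose c hc hcw using fun i => h𝒜.shallow (e i) (e i).2
  have hsub : ∀ i, ∀ x ∈ (e i : Finset ι), C x ⊆ ⋃ z ∈ ((e i : Finset ι) : Set ι), C z :=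
    fun i x hx => Set.subset_iUnion₂ (s := fun z (_ : z ∈ ((e i : Finset ι) : Set ι)) => C z) x hx
  -- Each cluster of the model is replaced by the union of its members in `G`. Adjacent clusters
  -- then intersect.
  refine card_le_of_pairwise_intersecting hF
    (fun i => ⋃ z ∈ ((e i : Finset ι) : Set ι), C z) (fun i => cen (c i)) ?_ ?_ ?_ ?_
  · intro i u hu
    obtain ⟨x, hx, hux⟩ := Set.mem_iUnion₂.1 hu
    exact ((hcw i x hx).of_intersectionGraph hcen hC).trans ((hC x u hux).mono (hsub i x hx) le_rfl)
  · exact fun i => hsub i _ (hc i) (hcen _)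
  · intro i j hij
    obtain ⟨x, hx, y, hy, -, w, hwx, hwy⟩ := h𝒜.adjacent _ (e i).2 _ (e j).2 (hinj i j hij)
    exact ⟨w, hsub i x hx hwx, hsub j y hy hwy⟩
  · intro v
    refine le_trans ?_ (ht v)
    -- The overlap does not grow: unions that contain `v` have members containing `v`, and these are
    -- distinct since the model clusters are disjoint.
    have hsel : ∀ i, ∃ x, v ∈ (⋃ z ∈ ((e i : Finset ι) : Set ι), C z) →
        x ∈ (e i : Finset ι) ∧ v ∈ C x := by
      intro i
      by_cases hi : v ∈ ⋃ z ∈ ((e i : Finset ι) : Set ι), C z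
      · obtain ⟨x, hx, hvx⟩ := Set.mem_iUnion₂.1 hi
        exact ⟨x, fun _ => ⟨hx, hvx⟩⟩
      · exact ⟨c i, fun h => absurd h hi⟩
    choose x hx using hsel
    refine Finset.card_le_card_of_injOn x (fun i hi => ?_) (fun i hi j hj hij => ?_)
    · have hi' := (Finset.mem_filter.1 (Finset.mem_coe.1 hi)).2
      simpa using (hx i hi').2
    · have hi' := (Finset.mem_filter.1 (Finset.mem_coe.1 hi)).2
      have hj' := (Finset.mem_filter.1 (Finset.mem_coe.1 hj)).2
      by_contra hne
      exact Finset.disjoint_left.1 (h𝒜.disjoint _ (e i).2 _ (e j).2 (hinj i j hne)) (hx i hi').1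
        (hij ▸ (hx j hj').1)

/-- In a finite set ordered by an injective key, the elements of rank less than `δ` are as many as
one expects. -/
theorem card_filter_rank_lt {α β : Type*} [LinearOrder β] (S : Finset α) {key : α → β}
    (hkey : Function.Injective key) (δ : ℕ) :
    (S.filter fun a => (S.filter fun b => key b < key a).card < δ).card = min δ S.card := by
  classical
  set rank : α → ℕ := fun a => (S.filter fun b => key b < key a).card with hrank
  have hmono : ∀ a ∈ S, ∀ b, key a < key b → rank a < rank b := by
    intro a ha b hab
    refine Finset.card_lt_card ⟨fun c hc => ?_, fun hcon => ?_⟩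
    · rw [Finset.mem_filter] at hc ⊢
      exact ⟨hc.1, hc.2.trans hab⟩
    · exact lt_irrefl _ (Finset.mem_filter.1 (hcon (Finset.mem_filter.2 ⟨ha, hab⟩))).2
  have hinj : Set.InjOn rank S := by
    intro a ha b hb hab
    rcases lt_trichotomy (key a) (key b) with h | h | h
    · exact absurd hab (hmono a ha b h).ne
    · exact hkey h
    · exact absurd hab (hmono b hb a h).ne'
  have himg : S.image rank = Finset.range S.card := by
    refine Finset.eq_of_subset_of_card_le (fun r hr => ?_) ?_
    · obtain ⟨a, ha, rfl⟩ := Finset.mem_image.1 hr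
      refine Finset.mem_range.2 (Finset.card_lt_card ⟨Finset.filter_subset _ _, fun hcon => ?_⟩)
      exact lt_irrefl _ (Finset.mem_filter.1 (hcon ha)).2
    · rw [Finset.card_image_of_injOn hinj, Finset.card_range]
  calc (S.filter fun a => rank a < δ).card = ((S.filter fun a => rank a < δ).image rank).card :=
        (Finset.card_image_of_injOn (hinj.mono (Finset.coe_subset.2 (Finset.filter_subset _ _)))).symm
    _ = ((S.image rank).filter fun r => r < δ).card := by rw [Finset.filter_image]
    _ = (Finset.range (min δ S.card)).card := by
        rw [himg]; congr 1; ext r; simp [and_comm]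
    _ = _ := Finset.card_range _

variable {n : ℕ}

/-- The order of preference among dominators of `w`: by distance, then by index. -/
noncomputable def distKey (G : SimpleGraph (Fin n)) (w a : Fin n) : ℕ∞ ×ₗ Fin n :=
  toLex (G.edist a w, a)

theorem distKey_injective (G : SimpleGraph (Fin n)) (w : Fin n) :
    Function.Injective (distKey G w) := fun a b h => by
  have := congrArg (fun x => (ofLex x).2) h
  simpa [distKey] using this

theorem distKey_lt_iff {G : SimpleGraph (Fin n)} {w a b : Fin n} :
    distKey G w a < distKey G w b ↔
      G.edist a w < G.edist b w ∨ G.edist a w = G.edist b w ∧ a < b := by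
  simp [distKey, Prod.Lex.toLex_lt_toLex]

/-- The number of dominators in `S` that `w` prefers to `a`. -/
noncomputable def preferenceRank (G : SimpleGraph (Fin n)) (S : Finset (Fin n)) (w a : Fin n) : ℕ :=
  (S.filter fun b => distKey G w b < distKey G w a).card

/-- The vertices at distance at most `ρ` from `a` for which `a` is among the `δ` preferred
dominators in `S`. -/
def preferenceCluster (G : SimpleGraph (Fin n)) (S : Finset (Fin n)) (δ ρ : ℕ) (a : Fin n) :
    Set (Fin n) :=
  {w | G.edist a w ≤ ρ ∧ preferenceRank G S w a < δ}

theorem self_mem_preferenceCluster {G : SimpleGraph (Fin n)} {S : Finset (Fin n)} {δ ρ : ℕ}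
    (hδ : 0 < δ) (a : Fin n) : a ∈ preferenceCluster G S δ ρ a := by
  refine ⟨by simp, ?_⟩
  convert hδ
  rw [preferenceRank, Finset.card_eq_zero, Finset.filter_eq_empty_iff]
  intro b _ hb
  rcases distKey_lt_iff.1 hb with h | ⟨h, h'⟩
  · simp at h
  · rw [SimpleGraph.edist_self, SimpleGraph.edist_eq_zero_iff] at h
    exact h'.ne h

/-- A shortest path from `a` to `w` stays in the cluster. If `z` on it prefers `b` to `a`, then so
does `w`: going through `z`, `b` is no farther from `w` than `a`, and ties are broken by an order
independent of the vertex. Hence ranks do not increase from `w` to `z`. -/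
theorem walkWithin_preferenceCluster {G : SimpleGraph (Fin n)} {S : Finset (Fin n)} {δ ρ : ℕ}
    {a w : Fin n} (hw : w ∈ preferenceCluster G S δ ρ a) :
    WalkWithin G (preferenceCluster G S δ ρ a) ρ a w := by
  obtain ⟨hd, hr⟩ := hw
  have hne : G.edist a w ≠ ⊤ := fun h => by
    rw [h] at hd; exact (ENat.natCast_ne_top ρ) (top_le_iff.1 hd)
  obtain ⟨p, hp⟩ := SimpleGraph.exists_walk_of_edist_ne_top hne
  refine ⟨p, by rw [← hp] at hd; exact_mod_cast hd, fun z hz => ?_⟩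
  have h1 : G.edist a z ≤ (p.takeUntil z hz).length := SimpleGraph.Walk.edist_le _
  have h2 : G.edist z w ≤ (p.dropUntil z hz).length := SimpleGraph.Walk.edist_le _
  have h3 : (p.takeUntil z hz).length + (p.dropUntil z hz).length = p.length := by
    rw [← SimpleGraph.Walk.length_append, SimpleGraph.Walk.take_spec]
  have h4 : G.edist a z + G.edist z w ≤ G.edist a w := by
    rw [← hp, ← h3]; push_cast; exact add_le_add h1 h2
  have hzw : G.edist z w ≠ ⊤ := ne_top_of_le_ne_top (ENat.natCast_ne_top _) h2
  refine ⟨le_self_add.trans (h4.trans hd), lt_of_le_of_lt (Finset.card_le_card fun b hb => ?_) hr⟩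
  rw [Finset.mem_filter] at hb ⊢
  refine ⟨hb.1, distKey_lt_iff.2 ?_⟩
  have h5 : G.edist b w ≤ G.edist b z + G.edist z w := SimpleGraph.edist_triangle
  rcases distKey_lt_iff.1 hb.2 with h | ⟨h, hba⟩
  · exact Or.inl (h5.trans_lt (((ENat.add_lt_add_iff_right hzw).2 h).trans_le h4))
  · have h6 : G.edist b w ≤ G.edist a w := h5.trans (h ▸ h4)
    exact h6.lt_or_eq.imp id fun h => ⟨h, hba⟩

-- Only the `δ` dominators that `w` ranks first have `w` in their clusters.
open Classical in
theorem card_preferenceCluster_overlap_le {G : SimpleGraph (Fin n)} {S : Finset (Fin n)} {δ ρ : ℕ}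
    (w : Fin n) :
    (Finset.univ.filter fun a : S => w ∈ preferenceCluster G S δ ρ a).card ≤ δ := by
  have h1 := (card_filter_rank_lt S (distKey_injective G w) δ).trans_le (min_le_left _ _)
  refine le_trans ?_ h1
  refine Finset.card_le_card_of_injOn Subtype.val (fun a ha => ?_) Subtype.val_injective.injOn
  have := (Finset.mem_filter.1 (Finset.mem_coe.1 ha)).2
  exact Finset.mem_coe.2 (Finset.mem_filter.2 ⟨a.2, this.2⟩)

open Classical in
/-- The preferred dominators of `v` are within its reach. -/
theorem edist_le_of_preferenceRank_lt {G : SimpleGraph (Fin n)} {S : Finset (Fin n)} {m r : ℕ}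
    {v a : Fin n} (hm : m ≤ (S.filter fun u => G.edist u v ≤ (r : ℕ∞)).card)
    (ha : preferenceRank G S v a < m) : G.edist a v ≤ r := by
  by_contra! hcon
  refine absurd (hm.trans (Finset.card_le_card fun b hb => ?_)) ha.not_ge
  rw [Finset.mem_filter] at hb ⊢
  exact ⟨hb.1, distKey_lt_iff.2 (Or.inl (hb.2.trans_lt hcon))⟩

end Clusters

/-! ### Exchanges and the counting argument for local optima -/

section Exchange

variable {n : ℕ}

/-- The preference clusters of two candidate solutions. -/
def exchangeCluster (G : SimpleGraph (Fin n)) (S X : Finset (Fin n)) (δ ρ : ℕ) :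
    S ⊕ X → Set (Fin n) :=
  Sum.elim (fun a => preferenceCluster G S δ ρ a) (fun b => preferenceCluster G X δ ρ b)

theorem center_mem_exchangeCluster {G : SimpleGraph (Fin n)} {S X : Finset (Fin n)} {δ ρ : ℕ}
    (hδ : 0 < δ) (x : S ⊕ X) :
    Sum.elim Subtype.val Subtype.val x ∈ exchangeCluster G S X δ ρ x := by
  rcases x with a | b <;> exact self_mem_preferenceCluster hδ _

theorem walkWithin_exchangeCluster {G : SimpleGraph (Fin n)} {S X : Finset (Fin n)} {δ ρ : ℕ}
    (x : S ⊕ X) (w : Fin n) (hw : w ∈ exchangeCluster G S X δ ρ x) :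
    WalkWithin G (exchangeCluster G S X δ ρ x) ρ (Sum.elim Subtype.val Subtype.val x) w := by
  rcases x with a | b <;> exact walkWithin_preferenceCluster hw

open Classical in
theorem card_exchangeCluster_overlap_le {G : SimpleGraph (Fin n)} {S X : Finset (Fin n)} {δ ρ : ℕ}
    (w : Fin n) :
    (Finset.univ.filter fun x : S ⊕ X => w ∈ exchangeCluster G S X δ ρ x).card ≤ 2 * δ := by
  rw [← Finset.card_toLeft_add_card_toRight, two_mul]
  refine add_le_add (le_trans (Finset.card_le_card fun a ha => ?_)
    (card_preferenceCluster_overlap_le (G := G) (S := S) (ρ := ρ) w))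
    (le_trans (Finset.card_le_card fun a ha => ?_)
    (card_preferenceCluster_overlap_le (G := G) (S := X) (ρ := ρ) w))
  · have := (Finset.mem_filter.1 (Finset.mem_toLeft.1 ha)).2
    exact Finset.mem_filter.2 ⟨Finset.mem_univ _, this⟩
  · have := (Finset.mem_filter.1 (Finset.mem_toRight.1 ha)).2
    exact Finset.mem_filter.2 ⟨Finset.mem_univ _, this⟩

/-- The solution obtained from `S` by removing the vertices of `S` in `J` and adding the vertices of
`X` in `W`. -/
def exchange {S X : Finset (Fin n)} (J W : Finset (S ⊕ X)) : Finset (Fin n) :=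
  (S \ J.toLeft.map ⟨Subtype.val, Subtype.val_injective⟩) ∪
    W.toRight.map ⟨Subtype.val, Subtype.val_injective⟩

/-- A target keeps its first choices in `S` unless one of them is removed. In that case the target
is a common vertex of the removed cluster and of those of all its first choices in `X`, so these
belong to `W` and are added. -/
theorem exchange_isFeasible {I : DominationInstance n} {S X : Finset (Fin n)} {δ ρ : ℕ}
    (hS : I.IsFeasible S) (hX : I.IsFeasible X)
    (hδ : ∀ v ∈ I.targets, I.demand v ≤ δ) (hρ : ∀ v ∈ I.targets, I.reach v ≤ ρ)
    {J W : Finset (S ⊕ X)}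
    (hJ : ∀ x ∈ J, ∀ y, (intersectionGraph (exchangeCluster I.graph S X δ ρ)).Adj x y → y ∈ W) :
    I.IsFeasible (exchange J W) := by
  classical
  refine ⟨fun u hu => ?_, fun v hv => ?_⟩
  · rcases Finset.mem_union.1 hu with hu | hu
    · exact hS.1 (Finset.sdiff_subset hu)
    · obtain ⟨b, -, rfl⟩ := Finset.mem_map.1 hu
      exact hX.1 b.2
  have key : ∀ {T : Finset (Fin n)}, I.IsFeasible T → ∀ a ∈ T,
      preferenceRank I.graph T v a < I.demand v →
      I.graph.edist a v ≤ I.reach v ∧ v ∈ preferenceCluster I.graph T δ ρ a := by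
    intro T hT a _ hr
    have h1 := edist_le_of_preferenceRank_lt (by convert hT.2 v hv) hr
    exact ⟨h1, h1.trans (by exact_mod_cast hρ v hv), hr.trans_le (hδ v hv)⟩
  have hcard : ∀ {T : Finset (Fin n)}, I.IsFeasible T →
      (T.filter fun a => preferenceRank I.graph T v a < I.demand v).card = I.demand v := by
    intro T hT
    refine (card_filter_rank_lt T (distKey_injective I.graph v) (I.demand v)).trans
      (min_eq_left ?_)
    exact (hT.2 v hv).trans (Finset.card_le_card (Finset.filter_subset _ _))
  have hfin : ∀ {T : Finset (Fin n)}, I.IsFeasible T →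
      (∀ a ∈ T, preferenceRank I.graph T v a < I.demand v → a ∈ exchange J W) →
      I.demand v ≤ ((exchange J W).filter fun u => I.graph.edist u v ≤ (I.reach v : ℕ∞)).card := by
    intro T hT hTE
    refine (hcard hT).symm.trans_le (Finset.card_le_card fun a ha => ?_)
    obtain ⟨h1, h2⟩ := Finset.mem_filter.1 ha
    exact Finset.mem_filter.2 ⟨hTE a h1 h2, (key hT a h1 h2).1⟩
  by_cases hcase : ∃ a : S, Sum.inl a ∈ J ∧ preferenceRank I.graph S v a < I.demand v
  · obtain ⟨a, haJ, har⟩ := hcase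
    have h1 := (key hS a a.2 har).2
    refine hfin hX fun b hb hbr => ?_
    have h2 := (key hX b hb hbr).2
    -- The disjoint sum makes this an edge even if both sides are the same vertex of the graph.
    have h3 : Sum.inr ⟨b, hb⟩ ∈ W := hJ _ haJ _ ⟨by simp, v, h1, h2⟩
    exact Finset.mem_union_right _ (Finset.mem_map.2 ⟨⟨b, hb⟩, Finset.mem_toRight.2 h3, rfl⟩)
  · push Not at hcase
    refine hfin hS fun a ha har => Finset.mem_union_left _ (Finset.mem_sdiff.2 ⟨ha, fun hcon => ?_⟩)
    obtain ⟨a', ha', rfl⟩ := Finset.mem_map.1 hcon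
    exact absurd har (hcase a' (Finset.mem_toLeft.1 ha')).not_gt

theorem card_exchange_add_le {S X : Finset (Fin n)} (J W : Finset (S ⊕ X)) :
    (exchange J W).card + J.toLeft.card ≤ S.card + W.toRight.card := by
  have h1 : J.toLeft.map ⟨Subtype.val, Subtype.val_injective⟩ ⊆ S := fun u hu => by
    obtain ⟨b, -, rfl⟩ := Finset.mem_map.1 hu
    exact b.2
  have h2 := Finset.card_sdiff_add_card_eq_card h1
  have h3 := Finset.card_union_le (S \ J.toLeft.map ⟨Subtype.val, Subtype.val_injective⟩)
    (W.toRight.map ⟨Subtype.val, Subtype.val_injective⟩)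
  rw [Finset.card_map] at h2 h3
  unfold exchange
  omega

/-- Only members of `W` are touched, so a part of size at most `ℓ` is a legal exchange. -/
theorem card_symmDiff_exchange_le {S X : Finset (Fin n)} {J W : Finset (S ⊕ X)} (hJW : J ⊆ W) :
    (symmDiff S (exchange J W)).card ≤ W.card := by
  have h1 : symmDiff S (exchange J W) ⊆ W.toLeft.map ⟨Subtype.val, Subtype.val_injective⟩ ∪
      W.toRight.map ⟨Subtype.val, Subtype.val_injective⟩ := by
    have h2 : J.toLeft.map ⟨Subtype.val, Subtype.val_injective⟩ ⊆
        W.toLeft.map ⟨Subtype.val, Subtype.val_injective⟩ :=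
      Finset.map_subset_map.2 (Finset.toLeft_subset_toLeft hJW)
    intro u hu
    have h3 := @h2 u
    simp only [Finset.mem_symmDiff, exchange, Finset.mem_union, Finset.mem_sdiff] at hu ⊢
    tauto
  have h2 := Finset.card_le_card h1
  have h3 := Finset.card_union_le (W.toLeft.map ⟨Subtype.val, Subtype.val_injective⟩)
    (W.toRight.map ⟨Subtype.val, Subtype.val_injective⟩)
  rw [Finset.card_map, Finset.card_map, Finset.card_toLeft_add_card_toRight] at h3
  exact h2.trans h3

/-- A locally optimal solution compared with another one by means of a division of the intersection
graph into parts of size at most `ℓ`. -/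
theorem DominationInstance.IsLocallyOptimal.two_mul_card_le {I : DominationInstance n}
    {S X : Finset (Fin n)} {δ ρ ℓ : ℕ} (hS : I.IsLocallyOptimal ℓ S) (hX : I.IsFeasible X)
    (hδ : ∀ v ∈ I.targets, I.demand v ≤ δ) (hρ : ∀ v ∈ I.targets, I.reach v ≤ ρ)
    {𝒲 : Finset (Finset (S ⊕ X))} (hcov : ∀ x, ∃ W ∈ 𝒲, x ∈ W)
    (hadj : ∀ x y, (intersectionGraph (exchangeCluster I.graph S X δ ρ)).Adj x y →
      ∃ W ∈ 𝒲, x ∈ W ∧ y ∈ W) (hℓ : ∀ W ∈ 𝒲, W.card ≤ ℓ) :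
    2 * S.card ≤ ∑ W ∈ 𝒲, W.card := by
  classical
  let m : S ⊕ X → ℕ := fun x => (𝒲.filter fun W => x ∈ W).card
  -- The interior of a part. An edge at an interior vertex lies in some part containing that vertex,
  -- which can only be `W`.
  let J : Finset (S ⊕ X) → Finset (S ⊕ X) := fun W => W.filter fun x => m x = 1
  have hJ : ∀ W ∈ 𝒲, (J W).toLeft.card ≤ W.toRight.card := by
    intro W hW
    have hfeas : I.IsFeasible (exchange (J W) W) := by
      refine exchange_isFeasible hS.1 hX hδ hρ fun x hx y hxy => ?_
      obtain ⟨hxW, hx1⟩ := Finset.mem_filter.1 hx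
      obtain ⟨W', hW', hxW', hyW'⟩ := hadj x y hxy
      have := Finset.card_le_one.1 hx1.le W (by simp [hW, hxW]) W' (by simp [hW', hxW'])
      exact this ▸ hyW'
    by_contra! hcon
    refine hS.2 _ ⟨hfeas, (card_symmDiff_exchange_le (Finset.filter_subset _ _)).trans (hℓ W hW), ?_⟩
    have := card_exchange_add_le (J W) W
    omega
  have h1 : ∑ W ∈ 𝒲, (J W).toLeft.card + ∑ W ∈ 𝒲, W.toLeft.card
      = ∑ a : S, ((if m (.inl a) = 1 then 1 else 0) + m (.inl a)) := by
    have h2 : ∀ W : Finset (S ⊕ X), W.toLeft.card = ∑ a : S, if Sum.inl a ∈ W then 1 else 0 := by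
      intro W
      rw [← Finset.card_filter]
      congr 1
      ext a
      simp
    simp only [h2]
    rw [Finset.sum_comm, Finset.sum_comm (s := 𝒲) (f := fun W a => if Sum.inl a ∈ W then 1 else 0),
      ← Finset.sum_add_distrib]
    refine Finset.sum_congr rfl fun a _ => ?_
    congr 1
    · by_cases ha : m (.inl a) = 1
      · simp only [J, Finset.mem_filter, ha, and_true, if_true]
        rw [← Finset.card_filter]
        exact ha
      · simp [J, ha]
    · rw [← Finset.card_filter]
  -- A vertex in exactly one part counts once as a member and once as interior; any other counts at
  -- least twice as a member.
  have h2 : ∀ a : S, 2 ≤ (if m (.inl a) = 1 then 1 else 0) + m (.inl a) := by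
    intro a
    obtain ⟨W, hW, haW⟩ := hcov (.inl a)
    have : 0 < m (.inl a) := Finset.card_pos.2 ⟨W, by simp [hW, haW]⟩
    split_ifs <;> omega
  calc 2 * S.card = ∑ _a : S, 2 := by simp [mul_comm]
    _ ≤ ∑ a : S, ((if m (.inl a) = 1 then 1 else 0) + m (.inl a)) :=
        Finset.sum_le_sum fun a _ => h2 a
    _ = ∑ W ∈ 𝒲, (J W).toLeft.card + ∑ W ∈ 𝒲, W.toLeft.card := h1.symm
    _ ≤ ∑ W ∈ 𝒲, W.toRight.card + ∑ W ∈ 𝒲, W.toLeft.card :=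
        Nat.add_le_add_right (Finset.sum_le_sum hJ) _
    _ = ∑ W ∈ 𝒲, W.card := by
        rw [← Finset.sum_add_distrib]
        exact Finset.sum_congr rfl fun W _ => by
          rw [add_comm, Finset.card_toLeft_add_card_toRight]

end Exchange

/-! ### Divisions from separators, and the separator parameters -/

section Division

/-- Strongly sublinear balanced separations of all vertex subsets yield divisions into parts of size
at most `r` with small total excess. -/
theorem exists_division {ι : Type*} [DecidableEq ι] {H : SimpleGraph ι} {β c η r : ℝ}
    (hβ0 : 0 < β) (hβ1 : β ≤ 1) (hc : 0 < c) (hη0 : 0 < η) (hη1 : η ≤ 1) (hr : 0 < r)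
    (hsep : ∀ U : Finset ι, U.Nonempty → ∃ A B : Finset ι, A ∪ B = U ∧
      (∀ x ∈ U, ∀ y ∈ U, H.Adj x y → x ∈ A ∧ y ∈ A ∨ x ∈ B ∧ y ∈ B) ∧
      (A.card + B.card : ℝ) ≤ U.card + c * (U.card : ℝ) ^ (1 - β) ∧
      (A.card : ℝ) ≤ 2 / 3 * U.card + c * (U.card : ℝ) ^ (1 - β) ∧
      (B.card : ℝ) ≤ 2 / 3 * U.card + c * (U.card : ℝ) ^ (1 - β))
    (hrη : 4 * c / ((4 / 3 : ℝ) ^ β - 1) ≤ η * (r / 4) ^ β) (U : Finset ι) :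
    ∃ 𝒲 : Finset (Finset ι), (∀ W ∈ 𝒲, (W.card : ℝ) ≤ r) ∧ (∀ x ∈ U, ∃ W ∈ 𝒲, x ∈ W) ∧
      (∀ x ∈ U, ∀ y ∈ U, H.Adj x y → ∃ W ∈ 𝒲, x ∈ W ∧ y ∈ W) ∧
      ((∑ W ∈ 𝒲, W.card : ℕ) : ℝ) ≤ (1 + η) * U.card := by
  set κ := (4 / 3 : ℝ) ^ β - 1 with hκ
  have hκ0 : 0 < κ := by
    have := Real.one_lt_rpow (x := 4 / 3) (by norm_num) hβ0
    linarith
  have hκ1 : κ ≤ 1 / 3 := by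
    have := Real.rpow_le_rpow_of_exponent_le (x := 4 / 3) (by norm_num) hβ1
    rw [Real.rpow_one] at this
    linarith
  -- Chosen so that the gain `D * κ` from concavity exceeds the cost (1 + η)c ≤ 2c of a split.
  set D := 4 * c / κ with hD
  have hDκ : D * κ = 4 * c := by rw [hD]; field_simp
  have hD0 : 0 < D := by positivity
  have hDc : 12 * c ≤ D := by nlinarith
  have hsmall : ∀ U : Finset ι, (U.card : ℝ) ≤ r → ∃ 𝒲 : Finset (Finset ι),
      (∀ W ∈ 𝒲, (W.card : ℝ) ≤ r) ∧ (∀ x ∈ U, ∃ W ∈ 𝒲, x ∈ W) ∧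
      (∀ x ∈ U, ∀ y ∈ U, H.Adj x y → ∃ W ∈ 𝒲, x ∈ W ∧ y ∈ W) ∧
      ((∑ W ∈ 𝒲, W.card : ℕ) : ℝ) ≤ U.card := fun U hU =>
    ⟨{U}, by simpa using hU, by simp, fun x hx y hy _ => by simp [hx, hy], by simp⟩
  -- The negative term in the bound is a credit that pays for the excess of later splits. It is at
  -- most ηN as soon as N ≥ r/4, which makes the base case hold.
  have main : ∀ (N : ℕ) (U : Finset ι), U.card = N → r / 4 ≤ N → ∃ 𝒲 : Finset (Finset ι),
      (∀ W ∈ 𝒲, (W.card : ℝ) ≤ r) ∧ (∀ x ∈ U, ∃ W ∈ 𝒲, x ∈ W) ∧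
      (∀ x ∈ U, ∀ y ∈ U, H.Adj x y → ∃ W ∈ 𝒲, x ∈ W ∧ y ∈ W) ∧
      ((∑ W ∈ 𝒲, W.card : ℕ) : ℝ) ≤ (1 + η) * N - D * (N : ℝ) ^ (1 - β) := by
    intro N
    induction N using Nat.strong_induction_on with
    | _ N ih =>
    intro U hU hrN
    have hN0 : (0 : ℝ) < N := by linarith [hr]
    have hpow : (N : ℝ) ^ (1 - β) * (N : ℝ) ^ β = N := by
      rw [← Real.rpow_add hN0]; simp
    have hNβ : (0 : ℝ) < (N : ℝ) ^ β := Real.rpow_pos_of_pos hN0 _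
    have hN1β : (0 : ℝ) < (N : ℝ) ^ (1 - β) := Real.rpow_pos_of_pos hN0 _
    have hDN : D ≤ η * (N : ℝ) ^ β := hrη.trans
      (mul_le_mul_of_nonneg_left (Real.rpow_le_rpow (by positivity) hrN hβ0.le) hη0.le)
    have hDN' : D * (N : ℝ) ^ (1 - β) ≤ η * N := by
      calc D * (N : ℝ) ^ (1 - β) ≤ (η * (N : ℝ) ^ β) * (N : ℝ) ^ (1 - β) :=
            mul_le_mul_of_nonneg_right hDN hN1β.le
        _ = η * ((N : ℝ) ^ (1 - β) * (N : ℝ) ^ β) := by ring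
        _ = η * N := by rw [hpow]
    rcases le_or_gt (N : ℝ) r with hNr | hNr
    · obtain ⟨𝒲, h1, h2, h3, h4⟩ := hsmall U (by rw [hU]; exact hNr)
      refine ⟨𝒲, h1, h2, h3, h4.trans ?_⟩
      rw [hU]; linarith
    have hs : c * (N : ℝ) ^ (1 - β) ≤ N / 12 := by nlinarith
    obtain ⟨A, B, hAB, hadj, hsum, hA, hB⟩ := hsep U
      (Finset.card_pos.1 (by rw [hU]; exact_mod_cast hN0))
    rw [hU] at hsum hA hB
    have hABN : (N : ℝ) ≤ A.card + B.card := by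
      have := Finset.card_union_le A B
      rw [hAB, hU] at this
      exact_mod_cast this
    -- 2/3 + 1/12 = 3/4. Each side thus keeps at least N/4 > r/4, and the induction hypothesis
    -- applies to both.
    have hA' : (A.card : ℝ) ≤ 3 / 4 * N := by linarith
    have hB' : (B.card : ℝ) ≤ 3 / 4 * N := by linarith
    have hA0 : r / 4 ≤ A.card := by linarith
    have hB0 : r / 4 ≤ B.card := by linarith
    obtain ⟨𝒲₁, a1, a2, a3, a4⟩ := ih A.card (by exact_mod_cast (by linarith : (A.card : ℝ) < N))
      A rfl hA0
    obtain ⟨𝒲₂, b1, b2, b3, b4⟩ := ih B.card (by exact_mod_cast (by linarith : (B.card : ℝ) < N))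
      B rfl hB0
    refine ⟨𝒲₁ ∪ 𝒲₂, fun W hW => (Finset.mem_union.1 hW).elim (a1 W) (b1 W), fun x hx => ?_,
      fun x hx y hy hxy => ?_, ?_⟩
    · rw [← hAB] at hx
      rcases Finset.mem_union.1 hx with hx | hx
      · obtain ⟨W, hW, hxW⟩ := a2 x hx
        exact ⟨W, Finset.mem_union_left _ hW, hxW⟩
      · obtain ⟨W, hW, hxW⟩ := b2 x hx
        exact ⟨W, Finset.mem_union_right _ hW, hxW⟩
    · rcases hadj x hx y hy hxy with ⟨hx, hy⟩ | ⟨hx, hy⟩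
      · obtain ⟨W, hW, hxW⟩ := a3 x hx y hy hxy
        exact ⟨W, Finset.mem_union_left _ hW, hxW⟩
      · obtain ⟨W, hW, hxW⟩ := b3 x hx y hy hxy
        exact ⟨W, Finset.mem_union_right _ hW, hxW⟩
    · have hun : ((∑ W ∈ 𝒲₁ ∪ 𝒲₂, W.card : ℕ) : ℝ)
          ≤ ((∑ W ∈ 𝒲₁, W.card : ℕ) : ℝ) + ((∑ W ∈ 𝒲₂, W.card : ℕ) : ℝ) := by
        have := Finset.sum_union_inter (s₁ := 𝒲₁) (s₂ := 𝒲₂) (f := fun W => W.card)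
        exact_mod_cast (by omega :
          (∑ W ∈ 𝒲₁ ∪ 𝒲₂, W.card) ≤ (∑ W ∈ 𝒲₁, W.card) + ∑ W ∈ 𝒲₂, W.card)
      -- For a ≤ 3N/4, a^(1-β) = a · a^(-β) ≥ a · (3N/4)^(-β). Adding both sides gains the factor
      -- (4/3)^β = 1 + κ in the credit.
      have hconc : ∀ a : ℝ, 0 < a → a ≤ 3 / 4 * N →
          a * ((4 / 3 : ℝ) ^ β * (N : ℝ) ^ (-β)) ≤ a ^ (1 - β) := by
        intro a ha haN
        have e1 : a ^ (1 - β) = a * a ^ (-β) := by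
          rw [sub_eq_add_neg, Real.rpow_add ha, Real.rpow_one]
        have e2 : (4 / 3 : ℝ) ^ β * (N : ℝ) ^ (-β) = (3 / 4 * N : ℝ) ^ (-β) := by
          rw [Real.mul_rpow (by norm_num) hN0.le, Real.rpow_neg (by norm_num : (0 : ℝ) ≤ 3 / 4),
            ← Real.inv_rpow (by norm_num)]
          norm_num
        rw [e1, e2]
        exact mul_le_mul_of_nonneg_left
          (Real.rpow_le_rpow_of_nonpos ha haN (by linarith)) ha.le
      have hNneg : (N : ℝ) * (N : ℝ) ^ (-β) = (N : ℝ) ^ (1 - β) := by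
        rw [sub_eq_add_neg, Real.rpow_add hN0, Real.rpow_one]
      have hE : 0 ≤ (4 / 3 : ℝ) ^ β * (N : ℝ) ^ (-β) := by positivity
      have h5 : (1 + κ) * (N : ℝ) ^ (1 - β)
          ≤ (A.card : ℝ) ^ (1 - β) + (B.card : ℝ) ^ (1 - β) := by
        have hA1 := hconc A.card (by linarith) hA'
        have hB1 := hconc B.card (by linarith) hB'
        have h6 := mul_le_mul_of_nonneg_right hABN hE
        have h7 : (N : ℝ) * ((4 / 3 : ℝ) ^ β * (N : ℝ) ^ (-β)) = (1 + κ) * (N : ℝ) ^ (1 - β) := by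
          rw [← hNneg, hκ]; ring
        linarith
      have h8 := mul_le_mul_of_nonneg_left h5 hD0.le
      have h9 : D * ((1 + κ) * (N : ℝ) ^ (1 - β))
          = D * (N : ℝ) ^ (1 - β) + 4 * (c * (N : ℝ) ^ (1 - β)) := by
        linear_combination (N : ℝ) ^ (1 - β) * hDκ
      have h10 := mul_le_mul_of_nonneg_left hsum (by linarith : (0 : ℝ) ≤ 1 + η)
      have h11 : 0 < c * (N : ℝ) ^ (1 - β) := by positivity
      nlinarith
  rcases le_or_gt (r / 4) U.card with h | h
  · obtain ⟨𝒲, h1, h2, h3, h4⟩ := main _ U rfl h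
    refine ⟨𝒲, h1, h2, h3, h4.trans ?_⟩
    have : 0 ≤ D * (U.card : ℝ) ^ (1 - β) := by positivity
    linarith
  · obtain ⟨𝒲, h1, h2, h3, h4⟩ := hsmall U (by linarith)
    refine ⟨𝒲, h1, h2, h3, h4.trans ?_⟩
    have : (0 : ℝ) ≤ η * U.card := by positivity
    linarith

/-- Bernoulli's inequality (1 + 1/L)^L ≥ 2, cleared of denominators. -/
theorem two_mul_pow_self_le (L : ℕ) (hL : 0 < L) : 2 * L ^ L ≤ (L + 1) ^ L := by
  have key : ∀ j : ℕ, L ^ j * (L + j) ≤ (L + 1) ^ j * L := by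
    intro j
    induction j with
    | zero => simp
    | succ j ih =>
      calc L ^ (j + 1) * (L + (j + 1)) ≤ (L ^ j * (L + j)) * (L + 1) := by
            rw [pow_succ, mul_assoc, mul_assoc]
            refine Nat.mul_le_mul_left _ ?_
            nlinarith
        _ ≤ ((L + 1) ^ j * L) * (L + 1) := Nat.mul_le_mul_right _ ih
        _ = _ := by ring
  have := key L
  refine Nat.le_of_mul_le_mul_right (c := L) ?_ hL
  calc 2 * L ^ L * L = L ^ L * (L + L) := by ring
    _ ≤ _ := this

/-- Radius L(log₂ N + 1) forces slow growth: fast growth would double a ball every `L` steps and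
exceed `N`. -/
theorem mul_pow_lt_of_log (N L : ℕ) (hL : 0 < L) :
    N * L ^ (L * (Nat.log 2 N + 1)) < (L + 1) ^ (L * (Nat.log 2 N + 1)) := by
  have h1 : N < 2 ^ (Nat.log 2 N + 1) := Nat.lt_pow_succ_log_self (by norm_num) N
  calc N * L ^ (L * (Nat.log 2 N + 1))
      < 2 ^ (Nat.log 2 N + 1) * L ^ (L * (Nat.log 2 N + 1)) :=
        Nat.mul_lt_mul_of_pos_right h1 (by positivity)
    _ = (2 * L ^ L) ^ (Nat.log 2 N + 1) := by rw [mul_pow, pow_mul]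
    _ ≤ ((L + 1) ^ L) ^ (Nat.log 2 N + 1) := Nat.pow_le_pow_left (two_mul_pow_self_le L hL) _
    _ = _ := by rw [← pow_mul]

/-- Powers of logarithms are dominated by powers. -/
theorem log_pow_le_rpow (p : ℕ) {γ : ℝ} (hγ : 0 < γ) :
    ∃ c : ℝ, 0 < c ∧ ∀ N : ℕ, 0 < N → ((Nat.log 2 N + 1 : ℕ) : ℝ) ^ p ≤ c * (N : ℝ) ^ γ := by
  set e : ℝ := γ / (p + 1) with he
  have he0 : 0 < e := by positivity
  refine ⟨(1 + 2 / e) ^ p, by positivity, fun N hN => ?_⟩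
  have hN1 : (1 : ℝ) ≤ N := by exact_mod_cast hN
  have h1 : ((Nat.log 2 N : ℕ) : ℝ) * Real.log 2 ≤ Real.log N := by
    rw [← Real.log_pow]
    refine Real.log_le_log (by positivity) ?_
    exact_mod_cast Nat.pow_log_le_self 2 hN.ne'
  have h2 : Real.log N ≤ (N : ℝ) ^ e / e := Real.log_le_rpow_div (by positivity) he0
  have h3 : (1 : ℝ) / 2 ≤ Real.log 2 := by linarith [Real.log_two_gt_d9]
  have h4 : (1 : ℝ) ≤ (N : ℝ) ^ e := Real.one_le_rpow hN1 he0.le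
  have h5 : ((Nat.log 2 N + 1 : ℕ) : ℝ) ≤ (1 + 2 / e) * (N : ℝ) ^ e := by
    push_cast
    have h6 : ((Nat.log 2 N : ℕ) : ℝ) * (1 / 2) ≤ (N : ℝ) ^ e / e :=
      (mul_le_mul_of_nonneg_left h3 (by positivity)).trans (h1.trans h2)
    have h7 : (1 + 2 / e) * (N : ℝ) ^ e = (N : ℝ) ^ e + 2 * ((N : ℝ) ^ e / e) := by ring
    linarith
  calc ((Nat.log 2 N + 1 : ℕ) : ℝ) ^ p ≤ ((1 + 2 / e) * (N : ℝ) ^ e) ^ p :=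
        pow_le_pow_left₀ (by positivity) h5 p
    _ = (1 + 2 / e) ^ p * (N : ℝ) ^ (e * p) := by
        rw [mul_pow, ← Real.rpow_natCast ((N : ℝ) ^ e), ← Real.rpow_mul (by positivity)]
    _ ≤ (1 + 2 / e) ^ p * (N : ℝ) ^ γ := by
        refine mul_le_mul_of_nonneg_left (Real.rpow_le_rpow_of_exponent_le hN1 ?_) (by positivity)
        rw [he, div_mul_eq_mul_div, div_le_iff₀ (by positivity)]
        nlinarith

/-- The choice of the parameters of a separation of a set of size `N`. -/
theorem exists_separation_parameters (b k : ℕ) :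
    ∃ c : ℝ, 0 < c ∧ ∀ N : ℕ, 0 < N → ∃ L d : ℕ, N * L ^ d < (L + 1) ^ d ∧
      ∀ μ : ℕ, L * μ ≤ N →
        ((μ + b * (d + 1) ^ (k + 1) * (1 + b * (d + 1) ^ (k + 1) * (2 * d + 1)) : ℕ) : ℝ)
          ≤ c * (N : ℝ) ^ (1 - 1 / (2 * k + 6 : ℝ)) := by
  set q : ℝ := 2 * k + 6 with hq
  have hq0 : 0 < q := by positivity
  obtain ⟨c, hc, hlog⟩ := log_pow_le_rpow (2 * k + 3) (γ := 2 / q) (by positivity)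
  refine ⟨2 + 2 * (b + 1) ^ 2 * 2 ^ (2 * k + 3) * c, by positivity, fun N hN => ?_⟩
  have hN1 : (1 : ℝ) ≤ N := by exact_mod_cast hN
  -- With L ≈ x and d ≈ x log N, the layers contribute N/L ≈ x^(2k+5) and the clusters d^(2k+3) ≈
  -- x^(2k+3) (log N)^(2k+3). The missing factor x² absorbs the logarithms.
  set x : ℝ := (N : ℝ) ^ (1 / q) with hx
  have hx1 : 1 ≤ x := Real.one_le_rpow hN1 (by positivity)
  have hxpow : ∀ j : ℕ, x ^ j = (N : ℝ) ^ (j / q) := fun j => by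
    rw [hx, ← Real.rpow_natCast, ← Real.rpow_mul (by positivity)]
    congr 1; ring
  have hexp : (N : ℝ) ^ (1 - 1 / q) = x ^ (2 * k + 5) := by
    rw [hxpow]
    congr 1
    rw [eq_div_iff hq0.ne', sub_mul, div_mul_cancel₀ _ hq0.ne', hq]
    push_cast; ring
  have hNx : (N : ℝ) = x ^ (2 * k + 5) * x := by
    rw [← pow_succ, hxpow]
    have : ((2 * k + 5 + 1 : ℕ) : ℝ) / q = 1 := by
      rw [div_eq_one_iff_eq hq0.ne', hq]; push_cast; ring
    rw [this, Real.rpow_one]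
  set L := ⌊x⌋₊ with hL
  have hL1 : 1 ≤ L := Nat.le_floor (by simpa using hx1)
  have hL1' : (1 : ℝ) ≤ L := by exact_mod_cast hL1
  have hLx : (L : ℝ) ≤ x := Nat.floor_le (by linarith)
  have hxL : x ≤ 2 * L := by
    have := Nat.lt_floor_add_one x
    rw [← hL] at this
    linarith
  set m := Nat.log 2 N + 1 with hm
  refine ⟨L, L * m, mul_pow_lt_of_log N L hL1, fun μ hμ => ?_⟩
  rw [hexp]
  have hμ' : (μ : ℝ) ≤ 2 * x ^ (2 * k + 5) := by
    have h1 : (L : ℝ) * μ ≤ N := by exact_mod_cast hμ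
    have h2 : x * μ ≤ x * (2 * x ^ (2 * k + 5)) := by
      calc x * μ ≤ 2 * L * μ := mul_le_mul_of_nonneg_right hxL (by positivity)
        _ ≤ 2 * N := by linarith
        _ = _ := by rw [hNx]; ring
    exact le_of_mul_le_mul_left h2 (by linarith)
  set d := L * m with hd
  have hd1 : ((d + 1 : ℕ) : ℝ) ≤ 2 * (x * m) := by
    have hm1 : (1 : ℝ) ≤ m := by exact_mod_cast Nat.succ_le_succ (Nat.zero_le _)
    have h1 : (L : ℝ) * m ≤ x * m := mul_le_mul_of_nonneg_right hLx (by positivity)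
    have h2 : 1 ≤ x * m := one_le_mul_of_one_le_of_one_le hx1 hm1
    rw [hd]; push_cast; linarith
  have hσ : b * (d + 1) ^ (k + 1) * (1 + b * (d + 1) ^ (k + 1) * (2 * d + 1))
      ≤ 2 * (b + 1) ^ 2 * (d + 1) ^ (2 * k + 3) := by
    have h1 : 1 ≤ (d + 1) ^ (k + 1) := Nat.one_le_pow _ _ (by omega)
    calc b * (d + 1) ^ (k + 1) * (1 + b * (d + 1) ^ (k + 1) * (2 * d + 1))
        ≤ (b + 1) * (d + 1) ^ (k + 1) *
          ((b + 1) * (d + 1) ^ (k + 1) + (b + 1) * (d + 1) ^ (k + 1) * (2 * d + 1)) := by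
          gcongr
          · omega
          · nlinarith
          · omega
      _ = _ := by ring
  have hσ' : ((b * (d + 1) ^ (k + 1) * (1 + b * (d + 1) ^ (k + 1) * (2 * d + 1)) : ℕ) : ℝ)
      ≤ 2 * (b + 1) ^ 2 * 2 ^ (2 * k + 3) * c * x ^ (2 * k + 5) := by
    calc ((b * (d + 1) ^ (k + 1) * (1 + b * (d + 1) ^ (k + 1) * (2 * d + 1)) : ℕ) : ℝ)
        ≤ ((2 * (b + 1) ^ 2 * (d + 1) ^ (2 * k + 3) : ℕ) : ℝ) := by exact_mod_cast hσ
      _ = 2 * (b + 1 : ℝ) ^ 2 * ((d + 1 : ℕ) : ℝ) ^ (2 * k + 3) := by push_cast; ring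
      _ ≤ 2 * (b + 1 : ℝ) ^ 2 * (2 * (x * m)) ^ (2 * k + 3) := by gcongr
      _ = 2 * (b + 1 : ℝ) ^ 2 * 2 ^ (2 * k + 3) * x ^ (2 * k + 3) * (m : ℝ) ^ (2 * k + 3) := by
          rw [mul_pow, mul_pow]; ring
      _ ≤ 2 * (b + 1 : ℝ) ^ 2 * 2 ^ (2 * k + 3) * x ^ (2 * k + 3) * (c * x ^ 2) := by
          refine mul_le_mul_of_nonneg_left ?_ (by positivity)
          rw [hxpow 2]
          exact_mod_cast hlog N hN
      _ = _ := by ring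
  push_cast at hσ' ⊢
  linarith

end Division

/-! ### Polynomial expansion and the approximation ratio -/

section Approximation

/-- The asymptotic bound is made uniform in `r` by adding bounds for the finitely many initial
values; (r + 1)^k is at least one also for r = 0. -/
theorem GraphClass.HasPolynomialExpansion.exists_edge_bound {𝒞 : GraphClass} {k : ℕ}
    (h : 𝒞.HasPolynomialExpansion k) :
    ∃ a : ℕ, ∀ (r n : ℕ) (G : SimpleGraph (Fin n)), ⟨n, G⟩ ∈ 𝒞 →
      ∀ (m : ℕ) (M : SimpleGraph (Fin m)), IsShallowMinor r M G →
        M.edgeSet.ncard ≤ a * (r + 1) ^ k * m := by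
  obtain ⟨hfin, a, ha⟩ := h
  obtain ⟨r₀, hr₀⟩ := eventually_atTop.1 ha
  choose f hf using fun r => ENNReal.exists_nat_gt (hfin r)
  refine ⟨⌈a⌉₊ + ∑ r ∈ Finset.range r₀, f r, fun r n G hG m M hM => ?_⟩
  have h1 : 𝒞.expansion r ≤ (((⌈a⌉₊ + ∑ r ∈ Finset.range r₀, f r) * (r + 1) ^ k : ℕ) : ENNReal) := by
    rcases lt_or_ge r r₀ with hr | hr
    · refine (hf r).le.trans ?_
      have h2 : f r ≤ ∑ r ∈ Finset.range r₀, f r :=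
        Finset.single_le_sum (f := f) (fun _ _ => Nat.zero_le _) (Finset.mem_range.2 hr)
      have h3 : 1 ≤ (r + 1) ^ k := Nat.one_le_pow _ _ (by omega)
      exact_mod_cast (h2.trans (Nat.le_add_left _ _)).trans (Nat.le_mul_of_pos_right _ h3)
    · refine (hr₀ r hr).trans ?_
      push_cast
      have h2 : (a : ENNReal) ≤ (⌈a⌉₊ : ENNReal) := by
        exact_mod_cast Nat.le_ceil a
      gcongr
      · exact h2.trans le_self_add
      · exact le_self_add
  have h0 : (M.edgeSet.ncard : ENNReal) / m ≤ shallowDensity r G :=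
    le_iSup_of_le m (le_iSup_of_le M
      (le_iSup (fun _ : IsShallowMinor r M G => (M.edgeSet.ncard : ENNReal) / m) hM))
  have h2 : (M.edgeSet.ncard : ENNReal) / m ≤ 𝒞.expansion r :=
    h0.trans (le_iSup₂_of_le (f := fun (G : Σ n : ℕ, SimpleGraph (Fin n)) (_ : G ∈ 𝒞) =>
        shallowDensity r G.2) ⟨n, G⟩ hG le_rfl)
  rcases Nat.eq_zero_or_pos m with rfl | hm
  · have : M.edgeSet = ∅ := by
      ext e
      induction e with
      | _ x y => exact x.elim0
    simp [this]
  · have h3 := (ENNReal.div_le_iff (by exact_mod_cast hm.ne') (ENNReal.natCast_ne_top m)).1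
      (h2.trans h1)
    exact_mod_cast h3

/-- The intersection graphs of preference clusters of two solutions have strongly sublinear
separations. -/
theorem exists_separation_exchangeCluster {𝒞 : GraphClass} {k : ℕ}
    (h𝒞 : 𝒞.HasPolynomialExpansion k) {δ : ℕ} (hδ : 0 < δ) (ρ : ℕ) :
    ∃ c : ℝ, 0 < c ∧ ∀ (n : ℕ) (G : SimpleGraph (Fin n)), ⟨n, G⟩ ∈ 𝒞 →
      ∀ (S X : Finset (Fin n)) (U : Finset (S ⊕ X)), U.Nonempty → ∃ A B : Finset (S ⊕ X),
      A ∪ B = U ∧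
      (∀ x ∈ U, ∀ y ∈ U, (intersectionGraph (exchangeCluster G S X δ ρ)).Adj x y →
        x ∈ A ∧ y ∈ A ∨ x ∈ B ∧ y ∈ B) ∧
      (A.card + B.card : ℝ) ≤ U.card + c * (U.card : ℝ) ^ (1 - 1 / (2 * k + 6 : ℝ)) ∧
      (A.card : ℝ) ≤ 2 / 3 * U.card + c * (U.card : ℝ) ^ (1 - 1 / (2 * k + 6 : ℝ)) ∧
      (B.card : ℝ) ≤ 2 / 3 * U.card + c * (U.card : ℝ) ^ (1 - 1 / (2 * k + 6 : ℝ)) := by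
  obtain ⟨a, ha⟩ := h𝒞.exists_edge_bound
  -- The overlap is 2δ because both solutions contribute. The density O(d^k) times the radius O(d)
  -- gives the power `k + 1`.
  set b := 1 + 2 * δ + 16 * a * (4 * ρ + 1) ^ (k + 1) * (2 * δ) with hb
  obtain ⟨c, hc, hpar⟩ := exists_separation_parameters b k
  refine ⟨2 * c, by positivity, fun n G hG S X U hU => ?_⟩
  classical
  obtain ⟨L, d, hd, hμ⟩ := hpar U.card (Finset.card_pos.2 hU)
  have hK : ∀ 𝒜 : Finset (Finset (S ⊕ X)),
      IsCliqueModel (intersectionGraph (exchangeCluster G S X δ ρ)) (2 * d) 𝒜 →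
      𝒜.card ≤ b * (d + 1) ^ (k + 1) := by
    intro 𝒜 h𝒜
    refine (h𝒜.card_le_of_intersectionGraph (center_mem_exchangeCluster hδ)
      walkWithin_exchangeCluster (fun w => by convert card_exchangeCluster_overlap_le w)
      (fun m M hM => ha _ n G hG m M hM)).trans ?_
    have h1 : 2 * ρ * (2 * d) + ρ + 1 ≤ (4 * ρ + 1) * (d + 1) := by nlinarith
    have h2 : 1 ≤ (d + 1) ^ (k + 1) := Nat.one_le_pow _ _ (by omega)
    calc 1 + 2 * δ + 16 * (a * (2 * ρ * (2 * d) + ρ + 1) ^ k) *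
          ((2 * ρ * (2 * d) + ρ + 1) * (2 * δ))
        = 1 + 2 * δ + 16 * a * (2 * ρ * (2 * d) + ρ + 1) ^ (k + 1) * (2 * δ) := by ring
      _ ≤ (1 + 2 * δ) * (d + 1) ^ (k + 1) + 16 * a * ((4 * ρ + 1) * (d + 1)) ^ (k + 1) * (2 * δ) := by
          gcongr
          exact Nat.le_mul_of_pos_right _ h2
      _ = _ := by rw [hb, mul_pow]; ring
  obtain ⟨A, B, M, hAB, hadj, hM, h1, h2, h3⟩ := hasSeparation_of_cliqueModel_card_le U hK hd
  have hσ := hμ M.card hM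
  set σ := M.card + b * (d + 1) ^ (k + 1) * (1 + b * (d + 1) ^ (k + 1) * (2 * d + 1))
  have h1' : (A.card + B.card : ℝ) ≤ U.card + 2 * σ := by exact_mod_cast h1
  have h2' : (3 * A.card : ℝ) ≤ 2 * U.card + 3 * σ := by exact_mod_cast h2
  have h3' : (3 * B.card : ℝ) ≤ 2 * U.card + 3 * σ := by exact_mod_cast h3
  have h4 : (0 : ℝ) ≤ σ := Nat.cast_nonneg _
  exact ⟨A, B, hAB, hadj, by linarith, by linarith, by linarith⟩

theorem exchangeSize_pos {C : ℝ} (hC : 0 < C) (k : ℕ) (ε : ℝ) : 1 ≤ exchangeSize C k ε :=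
  Nat.ceil_pos.2 (mul_pos hC (lt_of_lt_of_le one_pos (le_max_left _ _)))

/-- The division argument needs only ε^(-(2k+6)). For ε ≤ 1/2 the logarithm is at least 1/2, so its
power costs at most the constant 2^(2k+5); for larger ε the maximum is at least one and ε is capped
at 1/2. -/
theorem le_exchangeSize {k : ℕ} {ε D : ℝ} (hε : 0 < ε) (hD : 0 < D) :
    4 * (4 * D / min ε (1 / 2)) ^ (2 * k + 6)
      ≤ exchangeSize (4 * (4 * D) ^ (2 * k + 6) * 2 ^ (2 * k + 6)) k ε := by
  refine le_trans ?_ (Nat.le_ceil _)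
  have hD' : 0 < (4 * D) ^ (2 * k + 6) := by positivity
  rcases le_total ε (1 / 2) with h | h
  · rw [min_eq_left h]
    have h1 : (1 : ℝ) / 2 ≤ Real.log (1 / ε) := by
      have : Real.log 2 ≤ Real.log (1 / ε) := by
        refine Real.log_le_log (by norm_num) ?_
        rw [le_div_iff₀ hε]; linarith
      linarith [Real.log_two_gt_d9]
    have h2 : ((1 : ℝ) / 2) ^ (2 * k + 5) ≤ Real.log (1 / ε) ^ (2 * k + 5) :=
      pow_le_pow_left₀ (by norm_num) h1 _
    have h3 : (1 : ℝ) ≤ 2 ^ (2 * k + 6) * (1 / 2) ^ (2 * k + 5) := by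
      rw [pow_succ 2 (2 * k + 5), mul_right_comm, ← mul_pow]; norm_num
    calc 4 * (4 * D / ε) ^ (2 * k + 6)
        = 4 * (4 * D) ^ (2 * k + 6) * (1 / ε) ^ (2 * k + 6) * 1 := by
          rw [div_eq_mul_one_div (4 * D), mul_pow]; ring
      _ ≤ 4 * (4 * D) ^ (2 * k + 6) * (1 / ε) ^ (2 * k + 6) *
            (2 ^ (2 * k + 6) * (1 / 2) ^ (2 * k + 5)) := by gcongr
      _ = 4 * (4 * D) ^ (2 * k + 6) * 2 ^ (2 * k + 6) *
            ((1 / ε) ^ (2 * k + 6) * (1 / 2) ^ (2 * k + 5)) := by ring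
      _ ≤ 4 * (4 * D) ^ (2 * k + 6) * 2 ^ (2 * k + 6) *
            ((1 / ε) ^ (2 * k + 6) * Real.log (1 / ε) ^ (2 * k + 5)) := by gcongr
      _ ≤ _ := by gcongr; exact le_max_right _ _
  · rw [min_eq_right h]
    calc 4 * (4 * D / (1 / 2)) ^ (2 * k + 6)
        = 4 * (4 * D) ^ (2 * k + 6) * 2 ^ (2 * k + 6) * 1 := by
          rw [show 4 * D / (1 / 2) = 4 * D * 2 by ring, mul_pow]; ring
      _ ≤ _ := by gcongr; exact le_max_left _ _

/-- For classes of polynomial expansion, locally optimal solutions are approximate. -/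
theorem exists_isApproximation_of_isLocallyOptimal {𝒞 : GraphClass} {k : ℕ}
    (h𝒞 : 𝒞.HasPolynomialExpansion k) (δ ρ : ℕ) :
    ∃ C : ℝ, 0 < C ∧ ∀ ε : ℝ, 0 < ε → ∀ (n : ℕ) (I : DominationInstance n), ⟨n, I.graph⟩ ∈ 𝒞 →
      (∀ v ∈ I.targets, I.demand v ≤ δ ∧ I.reach v ≤ ρ) →
      ∀ S, I.IsLocallyOptimal (exchangeSize C k ε) S → I.IsApproximation ε S := by
  -- The demand bound is raised by one so that every cluster contains its own center even if all
  -- demands are zero.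
  obtain ⟨c, hc, hsep⟩ := exists_separation_exchangeCluster h𝒞 (Nat.succ_pos δ) ρ
  set q : ℝ := 2 * k + 6 with hq
  have hq1 : 1 ≤ q := by rw [hq]; linarith [(Nat.cast_nonneg k : (0 : ℝ) ≤ k)]
  set D : ℝ := 4 * c / ((4 / 3 : ℝ) ^ (1 / q) - 1) with hD
  have hβ0 : 0 < 1 / q := by positivity
  have hD0 : 0 < D := by
    have := Real.one_lt_rpow (x := 4 / 3) (by norm_num) hβ0
    exact div_pos (by linarith) (by linarith)
  refine ⟨4 * (4 * D) ^ (2 * k + 6) * 2 ^ (2 * k + 6), by positivity,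
    fun ε hε n I hI hbd S hS => ⟨hS.1, fun X hX => ?_⟩⟩
  set ℓ := exchangeSize (4 * (4 * D) ^ (2 * k + 6) * 2 ^ (2 * k + 6)) k ε
  set e := min ε (1 / 2) with he
  have he0 : 0 < e := lt_min hε (by norm_num)
  have he1 : e ≤ 1 / 2 := min_le_right _ _
  have hℓ : 4 * (4 * D / e) ^ (2 * k + 6) ≤ (ℓ : ℝ) := le_exchangeSize hε hD0
  have hℓ0 : (0 : ℝ) < ℓ := lt_of_lt_of_le (by positivity) hℓ
  have hroot : D ≤ e / 4 * ((ℓ : ℝ) / 4) ^ (1 / q) := by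
    have h1 : (4 * D / e) ≤ ((ℓ : ℝ) / 4) ^ (1 / q) := by
      have h2 : (4 * D / e) = ((4 * D / e) ^ (2 * k + 6)) ^ (1 / q) := by
        rw [← Real.rpow_natCast, ← Real.rpow_mul (by positivity)]
        have : ((2 * k + 6 : ℕ) : ℝ) * (1 / q) = 1 := by
          rw [hq]; push_cast; field_simp
        rw [this, Real.rpow_one]
      rw [h2]
      exact Real.rpow_le_rpow (by positivity) (by linarith) hβ0.le
    calc D = e / 4 * (4 * D / e) := by field_simp
      _ ≤ _ := by gcongr
  obtain ⟨𝒲, hW, hcov, hadj, hsum⟩ := exists_division (η := e / 4) (r := ℓ) hβ0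
    (by rw [div_le_one (by linarith)]; exact hq1) hc (by positivity) (by linarith) hℓ0
    (hsep n I.graph hI S X) hroot Finset.univ
  have hmain := hS.two_mul_card_le hX (fun v hv => (hbd v hv).1.trans (Nat.le_succ δ))
    (fun v hv => (hbd v hv).2) (fun x => hcov x (Finset.mem_univ x))
    (fun x y hxy => hadj x (Finset.mem_univ x) y (Finset.mem_univ y) hxy)
    (fun W hW' => by exact_mod_cast hW W hW')
  have h1 : (2 * S.card : ℝ) ≤ (1 + e / 4) * (S.card + X.card) := by
    calc (2 * S.card : ℝ) ≤ ((∑ W ∈ 𝒲, W.card : ℕ) : ℝ) := by exact_mod_cast hmain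
      _ ≤ _ := hsum
      _ = _ := by simp
  have hX0 : (0 : ℝ) ≤ X.card := Nat.cast_nonneg _
  have h2 : (S.card : ℝ) ≤ (1 + e) * X.card := by
    have h3 : (1 - e / 4) * S.card ≤ (1 - e / 4) * ((1 + e) * X.card) := by
      -- The slack is e/2 - e²/4, nonnegative for e ≤ 1/2. With η = e/4 this turns (1 - η)|S| ≤ (1 +
      -- η)|X| into the ratio 1 + e.
      have h4 : (1 + e / 4) ≤ (1 - e / 4) * (1 + e) := by nlinarith
      nlinarith [mul_le_mul_of_nonneg_right h4 hX0]
    exact le_of_mul_le_mul_left h3 (by linarith)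
  refine h2.trans (mul_le_mul_of_nonneg_right ?_ hX0)
  linarith [min_le_left ε (1 / 2)]

end Approximation

/-! ### Frame rule and step-counting rules for the machine -/

section Ram

@[simp] theorem RamState.setReg_reg (s : RamState) (x v y : ℕ) :
    (s.setReg x v).reg y = if y = x then v else s.reg y := by
  simp [RamState.setReg, Function.update_apply]

@[simp] theorem RamState.setReg_arr (s : RamState) (x v : ℕ) : (s.setReg x v).arr = s.arr := rfl

@[simp] theorem RamState.setArr_reg (s : RamState) (a i v : ℕ) : (s.setArr a i v).reg = s.reg := rfl

@[simp] theorem RamState.setArr_arr (s : RamState) (a i v b : ℕ) :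
    (s.setArr a i v).arr b = if b = a then Function.update (s.arr a) i v else s.arr b := by
  simp [RamState.setArr, Function.update_apply]

namespace RamProgram

/-- The registers that a program may change. -/
def regs : RamProgram → List ℕ
  | const x _ => [x]
  | add x _ _ => [x]
  | sub x _ _ => [x]
  | load x _ _ => [x]
  | store _ _ _ => []
  | seq p q => p.regs ++ q.regs
  | ifLt _ _ p q => p.regs ++ q.regs
  | whileLt _ _ p => p.regs

/-- The arrays that a program may change. -/
def arrs : RamProgram → List ℕ
  | const _ _ => []
  | add _ _ _ => []
  | sub _ _ _ => []
  | load _ _ _ => []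
  | store a _ _ => [a]
  | seq p q => p.arrs ++ q.arrs
  | ifLt _ _ p q => p.arrs ++ q.arrs
  | whileLt _ _ p => p.arrs

/-- The effect of a program without loops. -/
def exec : RamProgram → RamState → RamState
  | const x c, s => s.setReg x c
  | add x y z, s => s.setReg x (s.reg y + s.reg z)
  | sub x y z, s => s.setReg x (s.reg y - s.reg z)
  | load x a i, s => s.setReg x (s.arr a (s.reg i))
  | store a i x, s => s.setArr a (s.reg i) (s.reg x)
  | seq p q, s => q.exec (p.exec s)
  | ifLt x y p q, s => if s.reg x < s.reg y then p.exec s else q.exec s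
  | whileLt _ _ _, s => s

/-- The program has no loops. -/
def loopFree : RamProgram → Bool
  | seq p q => p.loopFree && q.loopFree
  | ifLt _ _ p q => p.loopFree && q.loopFree
  | whileLt _ _ _ => false
  | _ => true

/-- A bound on the number of steps of a program without loops. -/
def size : RamProgram → ℕ
  | seq p q => p.size + q.size
  | ifLt _ _ p q => p.size + q.size + 1
  | _ => 1

theorem exists_runs_exec (p : RamProgram) (hp : p.loopFree = true) (s : RamState) :
    ∃ t, RamRuns p s t (p.exec s) ∧ t ≤ p.size := by
  induction p generalizing s with
  | const x c => exact ⟨1, .const s x c, le_rfl⟩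
  | add x y z => exact ⟨1, .add s x y z, le_rfl⟩
  | sub x y z => exact ⟨1, .sub s x y z, le_rfl⟩
  | load x a i => exact ⟨1, .load s x a i, le_rfl⟩
  | store a i x => exact ⟨1, .store s a i x, le_rfl⟩
  | seq p q ihp ihq =>
    simp only [loopFree, Bool.and_eq_true] at hp
    obtain ⟨t, ht, hts⟩ := ihp hp.1 s
    obtain ⟨t', ht', hts'⟩ := ihq hp.2 (p.exec s)
    exact ⟨t + t', .seq ht ht', add_le_add hts hts'⟩
  | ifLt x y p q ihp ihq =>
    simp only [loopFree, Bool.and_eq_true] at hp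
    simp only [exec, size]
    by_cases h : s.reg x < s.reg y
    · obtain ⟨t, ht, hts⟩ := ihp hp.1 s
      rw [if_pos h]
      exact ⟨t + 1, .ifLt_true h ht, by omega⟩
    · obtain ⟨t, ht, hts⟩ := ihq hp.2 s
      rw [if_neg h]
      exact ⟨t + 1, .ifLt_false h ht, by omega⟩
  | whileLt => simp [loopFree] at hp

end RamProgram

/-- The stores agree outside of the registers `R` and the arrays `A`. -/
def RamState.Agree (R A : List ℕ) (s s' : RamState) : Prop :=
  (∀ x, x ∉ R → s'.reg x = s.reg x) ∧ ∀ a, a ∉ A → s'.arr a = s.arr a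

theorem RamState.Agree.trans {R A R' A' : List ℕ} {s s' s'' : RamState} (h : s.Agree R A s')
    (h' : s'.Agree R' A' s'') : s.Agree (R ++ R') (A ++ A') s'' := by
  constructor
  · intro x hx
    rw [List.mem_append, not_or] at hx
    rw [h'.1 x hx.2, h.1 x hx.1]
  · intro x hx
    rw [List.mem_append, not_or] at hx
    rw [h'.2 x hx.2, h.2 x hx.1]

theorem RamState.Agree.mono {R A R' A' : List ℕ} {s s' : RamState} (h : s.Agree R A s')
    (hR : R ⊆ R') (hA : A ⊆ A') : s.Agree R' A' s' :=
  ⟨fun x hx => h.1 x fun hx' => hx (hR hx'), fun x hx => h.2 x fun hx' => hx (hA hx')⟩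

/-- The frame rule: registers and arrays that the text of a program never writes are preserved.
Membership in the lists is decidable, which makes these side conditions automatic for concrete
programs. -/
theorem RamRuns.agree {p : RamProgram} {s s' : RamState} {t : ℕ} (h : RamRuns p s t s') :
    s.Agree p.regs p.arrs s' := by
  induction h with
  | const s x c => exact ⟨by simp +contextual [RamProgram.regs], by simp⟩
  | add s x y z => exact ⟨by simp +contextual [RamProgram.regs], by simp⟩
  | sub s x y z => exact ⟨by simp +contextual [RamProgram.regs], by simp⟩
  | load s x a i => exact ⟨by simp +contextual [RamProgram.regs], by simp⟩
  | store s a i x => exact ⟨by simp, by simp +contextual [RamProgram.arrs]⟩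
  | seq _ _ ih ih' => exact ih.trans ih'
  | ifLt_true _ _ ih => exact ih.mono (by simp [RamProgram.regs]) (by simp [RamProgram.arrs])
  | ifLt_false _ _ ih => exact ih.mono (by simp [RamProgram.regs]) (by simp [RamProgram.arrs])
  | while_step _ _ _ ih ih' =>
    exact (ih.trans ih').mono (by simp [RamProgram.regs]) (by simp [RamProgram.arrs])
  | while_stop _ => exact ⟨fun _ _ => rfl, fun _ _ => rfl⟩

/-- Started in `s`, the program halts after at most `b ^ j` steps in a store with property `Q`. -/
def Runs (b j : ℕ) (p : RamProgram) (s : RamState) (Q : RamState → Prop) : Prop :=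
  ∃ t s', RamRuns p s t s' ∧ t ≤ b ^ j ∧ Q s'

namespace Runs

variable {b i j : ℕ} {p q : RamProgram} {s : RamState} {Q Q' : RamState → Prop}

theorem weaken (h : Runs b i p s Q) (hb : 2 ≤ b) (hij : i ≤ j)
    (hQ : ∀ s', s.Agree p.regs p.arrs s' → Q s' → Q' s') : Runs b j p s Q' := by
  obtain ⟨t, s', h1, h2, h3⟩ := h
  exact ⟨t, s', h1, h2.trans (Nat.pow_le_pow_right (by omega) hij), hQ s' h1.agree h3⟩

/-- Costs are tracked only as exponents of `b`: sequencing adds one to the exponent, a loop of at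
most `b` rounds adds three. -/
theorem seq (hb : 2 ≤ b) (h : Runs b j p s Q')
    (h' : ∀ s', s.Agree p.regs p.arrs s' → Q' s' → Runs b j q s' Q) :
    Runs b (j + 1) (.seq p q) s Q := by
  obtain ⟨t, s', h1, h2, h3⟩ := h
  obtain ⟨t', s'', h1', h2', h3'⟩ := h' s' h1.agree h3
  refine ⟨t + t', s'', .seq h1 h1', ?_, h3'⟩
  calc t + t' ≤ b ^ j * 2 := by omega
    _ ≤ b ^ (j + 1) := by rw [pow_succ]; exact Nat.mul_le_mul_left _ hb

theorem of_exec (hb : 2 ≤ b) (hp : p.loopFree = true) (hj : p.size ≤ 2 ^ j) (hQ : Q (p.exec s)) :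
    Runs b j p s Q := by
  obtain ⟨t, ht, hts⟩ := p.exists_runs_exec hp s
  exact ⟨t, _, ht, hts.trans (hj.trans (Nat.pow_le_pow_left hb j)), hQ⟩

theorem exec_seq (hb : 2 ≤ b) (hp : p.loopFree = true) (hj : p.size ≤ 2 ^ j)
    (h : ∀ s', s.Agree p.regs p.arrs s' → s' = p.exec s → Runs b j q s' Q) :
    Runs b (j + 1) (.seq p q) s Q :=
  seq hb (of_exec (Q := fun s' => s' = p.exec s) hb hp hj rfl) h

end Runs

/-- Repeat `body` while register `i` counts from zero up to the value of register `m`; register `3`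
holds the constant one. -/
def RamProgram.forLoop (i m : ℕ) (body : RamProgram) : RamProgram :=
  .seq (.const i 0) (.whileLt i m (.seq body (.add i i 3)))

/-- The rule for loops that count from zero to the value of register `m`. -/
theorem Runs.forLoop {b j i m : ℕ} {body : RamProgram} {s : RamState}
    (I : ℕ → RamState → Prop) (hb : 2 ≤ b) (hm : s.reg m ≤ b) (h1 : s.reg 3 = 1)
    (hi : i ∉ body.regs ∧ m ∉ body.regs ∧ 3 ∉ body.regs ∧ m ≠ i ∧ 3 ≠ i)
    (h0 : I 0 (s.setReg i 0))
    (hstep : ∀ k s', k < s.reg m → s'.reg i = k → s.Agree (i :: body.regs) body.arrs s' → I k s' →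
      Runs b j body s' fun s'' => I (k + 1) (s''.setReg i (k + 1))) :
    Runs b (j + 3) (.forLoop i m body) s fun s' => I (s.reg m) s' := by
  obtain ⟨hib, hmb, h3b, hmi, h3i⟩ := hi
  -- Induction on the number `d` of remaining rounds; each costs the body plus two steps, and the
  -- final failing test costs one.
  have key : ∀ d k s', k + d = s.reg m → s'.reg i = k →
      s.Agree (i :: body.regs) body.arrs s' → I k s' →
      ∃ t s'', RamRuns (.whileLt i m (.seq body (.add i i 3))) s' t s'' ∧
        t ≤ d * (b ^ j + 2) + 1 ∧ I (s.reg m) s'' := by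
    intro d
    induction d with
    | zero =>
      intro k s' hk hik hag hI
      have hm' : s'.reg m = s.reg m := hag.1 m (by simp [hmi, hmb])
      have : k = s.reg m := by omega
      have hnot : ¬ s'.reg i < s'.reg m := by rw [hik, hm']; omega
      exact ⟨1, s', RamRuns.while_stop hnot, by omega, this ▸ hI⟩
    | succ d ih =>
      intro k s' hk hik hag hI
      have hm' : s'.reg m = s.reg m := hag.1 m (by simp [hmi, hmb])
      obtain ⟨t, s₁, hr, ht, hI₁⟩ := hstep k s' (by omega) hik hag hI
      have hi₁ : s₁.reg i = k := by rw [hr.agree.1 i hib, hik]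
      have h3₁ : s₁.reg 3 = 1 := by
        rw [hr.agree.1 3 h3b, hag.1 3 (by simp [h3i, h3b]), h1]
      have hstep1 : RamRuns (.add i i 3) s₁ 1 (s₁.setReg i (k + 1)) := by
        have := RamRuns.add s₁ i i 3
        rwa [hi₁, h3₁] at this
      have hag' : s.Agree (i :: body.regs) body.arrs (s₁.setReg i (k + 1)) := by
        refine ((hag.trans hr.agree).trans hstep1.agree).mono ?_ ?_ <;>
          simp [RamProgram.regs, RamProgram.arrs]
      obtain ⟨t', s₂, hr', ht', hI₂⟩ := ih (k + 1) _ (by omega) (by simp) hag' hI₁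
      refine ⟨(t + 1) + t' + 1, s₂, .while_step (by rw [hik, hm']; omega) (.seq hr hstep1) hr', ?_,
        hI₂⟩
      rw [Nat.succ_mul]; omega
  obtain ⟨t, s', hr, ht, hI⟩ := key (s.reg m) 0 (s.setReg i 0) (by omega) (by simp)
    ⟨fun x hx => by simp at hx; simp [hx], fun _ _ => rfl⟩ h0
  refine ⟨1 + t, s', .seq (.const s i 0) hr, ?_, hI⟩
  have hbj : b ≤ b ^ (j + 1) := Nat.le_self_pow (by omega) b
  calc 1 + t ≤ b * (b ^ j + 2) + 2 := by
        have := Nat.mul_le_mul_right (b ^ j + 2) hm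
        omega
    _ = b ^ (j + 1) + 2 * b + 2 := by ring
    _ ≤ b ^ (j + 1) * 4 := by omega
    _ ≤ b ^ (j + 1) * (b * b) := Nat.mul_le_mul_left _ (Nat.mul_le_mul hb hb)
    _ = b ^ (j + 3) := by ring

end Ram

/-! ### Distances by rounds of edge relaxation -/

section Distances

variable {n : ℕ}

/-- The array `a` holds upper bounds on the distances from `v`, where values of at least `n` carry
no information; distances of at most `j` are exact, and the edges in `proc` have been relaxed for
round `j`. -/
structure DistInv (G : SimpleGraph (Fin n)) (v : Fin n) (j : ℕ) (proc : ℕ → ℕ → Prop)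
    (a : ℕ → ℕ) : Prop where
  sound : ∀ u : Fin n, a u < n → G.edist v u ≤ a u
  attained : ∀ u : Fin n, ∀ m ≤ j, G.edist v u ≤ m → a u ≤ m
  relaxed : ∀ x y : Fin n, proc x y → G.Adj x y → G.edist v x ≤ j → a y ≤ j + 1

namespace DistInv

variable {G : SimpleGraph (Fin n)} {v : Fin n} {j : ℕ} {proc proc' : ℕ → ℕ → Prop} {a : ℕ → ℕ}

theorem mono (h : DistInv G v j proc a) (hp : ∀ x y : Fin n, proc' x y → proc x y) :
    DistInv G v j proc' a :=
  ⟨h.sound, h.attained, fun x y hxy => h.relaxed x y (hp x y hxy)⟩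

theorem init (ha : ∀ u : Fin n, a u = if u = v then 0 else n) :
    DistInv G v 0 (fun _ _ => False) a := by
  refine ⟨fun u hu => ?_, fun u m hm hu => ?_, fun _ _ h => h.elim⟩
  · by_cases h : u = v
    · simp [h]
    · simp [ha, h] at hu
  · obtain rfl : m = 0 := by omega
    have : v = u := by simpa using hu
    simp [ha, this]

/-- Entries only decrease, so upper bounds survive. A new entry below `n` comes from an informative
entry at `x`, so the triangle inequality gives soundness. -/
theorem relax (h : DistInv G v j proc a) {x y : Fin n} (hxy : G.Adj x y) (hlt : a x + 1 < a y) :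
    DistInv G v j (fun x' y' => proc x' y' ∨ x' = x ∧ y' = y)
      (Function.update a y (a x + 1)) := by
  have hle : ∀ u, Function.update a (y : ℕ) (a x + 1) u ≤ a u := fun u => by
    by_cases hu : u = y
    · subst hu; simp; omega
    · simp [hu]
  refine ⟨fun u hu => ?_, fun u m hm hum => (hle u).trans (h.attained u m hm hum), ?_⟩
  · by_cases huy : u = y
    · subst huy
      simp only [Function.update_self] at hu ⊢
      have h1 := h.sound x (by omega)
      have h2 : G.edist v u ≤ G.edist v x + G.edist x u := SimpleGraph.edist_triangle
      rw [SimpleGraph.edist_eq_one_iff_adj.2 hxy] at h2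
      refine h2.trans ?_
      push_cast
      gcongr
    · have : (u : ℕ) ≠ y := fun h => huy (Fin.ext h)
      rw [Function.update_of_ne this] at hu ⊢
      exact h.sound u hu
  · rintro x' y' (hp | ⟨h1, h2⟩) hadj hd
    · exact (hle y').trans (h.relaxed x' y' hp hadj hd)
    · obtain rfl := Fin.ext h1
      obtain rfl := Fin.ext h2
      have := h.attained x' j le_rfl hd
      simpa using this

/-- If the edge exists, the entry at `y` already is at most one more than that at `x`, which is at
most `j` when `x` is within distance `j`. -/
theorem skip (h : DistInv G v j proc a) {x y : Fin n} (hxy : ¬ (G.Adj x y ∧ a x + 1 < a y)) :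
    DistInv G v j (fun x' y' => proc x' y' ∨ x' = x ∧ y' = y) a := by
  refine ⟨h.sound, h.attained, ?_⟩
  rintro x' y' (hp | ⟨h1, h2⟩) hadj hd
  · exact h.relaxed x' y' hp hadj hd
  · obtain rfl := Fin.ext h1
    obtain rfl := Fin.ext h2
    have := h.attained x' j le_rfl hd
    by_contra! hcon
    exact hxy ⟨hadj, by omega⟩

/-- A vertex at distance j + 1 has a predecessor at distance at most `j`, and the edge from it has
been relaxed. -/
theorem next (h : DistInv G v j proc a) (hp : ∀ x y : Fin n, proc x y) :
    DistInv G v (j + 1) (fun _ _ => False) a := by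
  refine ⟨h.sound, fun u m hm hu => ?_, fun _ _ h => h.elim⟩
  rcases Nat.lt_or_ge j m with hlt | hle
  · obtain rfl : m = j + 1 := by omega
    by_cases hj : G.edist v u ≤ j
    · exact (h.attained u j le_rfl hj).trans (Nat.le_succ j)
    · have hne : G.edist v u ≠ ⊤ := fun h => by
        rw [h] at hu; exact ENat.natCast_ne_top _ (top_le_iff.1 hu)
      obtain ⟨p, hpl⟩ := SimpleGraph.exists_walk_of_edist_ne_top hne
      rw [← hpl] at hu
      have hlen : p.reverse.length ≤ j + 1 := by
        rw [SimpleGraph.Walk.length_reverse]; exact_mod_cast hu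
      cases hq : p.reverse with
      | nil => exact absurd (by simp) hj
      | @cons _ x _ hux q =>
        rw [hq, SimpleGraph.Walk.length_cons] at hlen
        refine h.relaxed x u (hp x u) hux.symm (q.reverse.edist_le.trans ?_)
        rw [SimpleGraph.Walk.length_reverse]
        exact_mod_cast (by omega : q.length ≤ j)
  · exact h.attained u m hle hu

/-- A finite distance is realised by a path and hence is less than `n`, so `n` rounds settle all
distances and an entry of at least `n` means unreachable. -/
theorem lt_and_le_iff (h : DistInv G v n proc a) (u : Fin n) (r : ℕ) :
    a u < n ∧ a u ≤ r ↔ G.edist u v ≤ r := by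
  rw [SimpleGraph.edist_comm]
  constructor
  · rintro ⟨h1, h2⟩
    exact (h.sound u h1).trans (by exact_mod_cast h2)
  · intro hr
    have hne : G.edist v u ≠ ⊤ := fun h => by
      rw [h] at hr; exact ENat.natCast_ne_top _ (top_le_iff.1 hr)
    obtain ⟨p, hp⟩ := SimpleGraph.exists_walk_of_edist_ne_top hne
    classical
    have hlt : p.toPath.1.length < n := by simpa using p.toPath.2.length_lt
    have hle : p.length ≤ p.toPath.1.length := by
      have := p.toPath.1.edist_le
      rw [← hp] at this
      exact_mod_cast this
    rw [← hp] at hr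
    have h1 := h.attained u p.length (by omega) (by rw [hp])
    have h2 : p.length ≤ r := by exact_mod_cast hr
    omega

end DistInv

end Distances

/-! ### Initialisation, powers and the table of vertices in reach -/

section Program

open RamProgram

/-- The store holds the instance `I`, the exchange size, and the tables of the program that do not
change after its start. -/
structure Ready {n : ℕ} (I : DominationInstance n) (ℓ : ℕ) (s : RamState) : Prop where
  reg_zero : s.reg 0 = n
  reg_one : s.reg 1 = ℓ
  reg_two : s.reg 2 = 0
  reg_three : s.reg 3 = 1
  reg_five : s.reg 5 = n + 1
  arr_input : ∀ a < 5, s.arr a = (I.encode ℓ).arr a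
  arr_base : ∀ u < n, s.arr 8 u = u * n

variable {n : ℕ} {I : DominationInstance n} {ℓ b : ℕ} {s s' : RamState}

theorem Ready.of_agree {R A : List ℕ} (h : Ready I ℓ s) (hag : s.Agree R A s')
    (hR : ∀ x ∈ [0, 1, 2, 3, 5], x ∉ R) (hA : ∀ a ∈ [0, 1, 2, 3, 4, 8], a ∉ A) : Ready I ℓ s' where
  reg_zero := by rw [hag.1 0 (hR 0 (by simp)), h.reg_zero]
  reg_one := by rw [hag.1 1 (hR 1 (by simp)), h.reg_one]
  reg_two := by rw [hag.1 2 (hR 2 (by simp)), h.reg_two]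
  reg_three := by rw [hag.1 3 (hR 3 (by simp)), h.reg_three]
  reg_five := by rw [hag.1 5 (hR 5 (by simp)), h.reg_five]
  arr_input := fun a ha => by
    rw [hag.2 a (hA a (by interval_cases a <;> simp)), h.arr_input a ha]
  arr_base := by rw [hag.2 8 (hA 8 (by simp))]; exact h.arr_base

open Classical in
theorem Ready.arr_adj (h : Ready I ℓ s) (x y : Fin n) :
    s.arr 0 (x * n + y) = if I.graph.Adj x y then 1 else 0 := by
  rw [h.arr_input 0 (by omega)]
  simp only [DominationInstance.encode, if_true]
  congr 1
  refine propext ⟨?_, fun h => ⟨x, y, rfl, h⟩⟩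
  rintro ⟨u, w, huw, hadj⟩
  -- Row-major positions determine row and column, by division by `n`.
  have h1 : (x : ℕ) = u := by
    have h2 := congrArg (· / n) huw
    have hn : 0 < n := x.pos
    simpa [Nat.add_comm _ (_ : ℕ), Nat.add_mul_div_right _ _ hn, Nat.div_eq_of_lt y.2,
      Nat.div_eq_of_lt w.2] using h2
  have h3 : (y : ℕ) = w := by rw [h1] at huw; omega
  rw [Fin.ext h1, Fin.ext h3]
  exact hadj

theorem Ready.arr_target (h : Ready I ℓ s) (v : Fin n) :
    s.arr 1 v = if v ∈ I.targets then 1 else 0 := by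
  rw [h.arr_input 1 (by omega)]
  simp [DominationInstance.encode, Fin.val_inj]

theorem Ready.arr_candidate (h : Ready I ℓ s) (v : Fin n) :
    s.arr 2 v = if v ∈ I.candidates then 1 else 0 := by
  rw [h.arr_input 2 (by omega)]
  simp [DominationInstance.encode, Fin.val_inj]

theorem Ready.arr_demand (h : Ready I ℓ s) (v : Fin n) : s.arr 3 v = I.demand v := by
  rw [h.arr_input 3 (by omega)]
  simp [DominationInstance.encode]

theorem Ready.arr_reach (h : Ready I ℓ s) (v : Fin n) : s.arr 4 v = I.reach v := by
  rw [h.arr_input 4 (by omega)]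
  simp [DominationInstance.encode]

/-- An instruction without interesting effect. -/
def skipProgram : RamProgram := const 19 0

/-- Set up the constants, the multiples of `n` in array `8`, and all candidates as the current
solution in array `5`. -/
def setupProgram : RamProgram :=
  seq (seq (const 3 1) (seq (add 5 0 3) (const 20 0)))
    (forLoop 8 0 (seq (store 8 8 20) (seq (add 20 20 0) (seq (load 21 2 8) (store 5 8 21)))))

theorem setupProgram_runs (hb : 2 ≤ b) (hn : n ≤ b) :
    Runs b 6 setupProgram (I.encode ℓ) fun s => Ready I ℓ s ∧
      ∀ v : Fin n, s.arr 5 v = if v ∈ I.candidates then 1 else 0 := by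
  refine Runs.exec_seq (j := 5) hb rfl (by decide) fun s₁ _ hs₁ => ?_
  subst hs₁
  refine (Runs.forLoop (j := 2) (fun k s' => s'.reg 20 = k * n ∧
    (∀ u < k, s'.arr 8 u = u * n ∧ s'.arr 5 u = (I.encode ℓ).arr 2 u)) hb ?_ ?_ (by decide) ?_
      ?_).weaken hb (by omega) ?_
  · simpa [exec, DominationInstance.encode] using hn
  · simp [exec]
  · simp [exec]
  · rintro k s' hk hi hag ⟨h20, hI⟩
    have h0 : s'.reg 0 = n := by
      rw [hag.1 0 (by decide)]; simp [exec, DominationInstance.encode]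
    have h2 : s'.arr 2 = (I.encode ℓ).arr 2 := by
      rw [hag.2 2 (by decide)]; simp [exec]
    refine Runs.of_exec hb rfl (by decide) ⟨?_, fun u hu => ?_⟩
    · simp [exec, h20, h0]; ring
    · rcases Nat.lt_succ_iff_lt_or_eq.1 hu with hu | rfl
      · simp [exec, hi, h2, hu.ne, hI u hu]
      · simp [exec, hi, h2, h20]
  · rintro s' hag ⟨-, hI⟩
    have hm : (exec (seq (const 3 1) (seq (add 5 0 3) (const 20 0))) (I.encode ℓ)).reg 0 = n := by
      simp [exec, DominationInstance.encode]
    rw [hm] at hI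
    have hR : Ready I ℓ s' :=
      { reg_zero := by rw [hag.1 0 (by decide), hm]
        reg_one := by rw [hag.1 1 (by decide)]; simp [exec, DominationInstance.encode]
        reg_two := by rw [hag.1 2 (by decide)]; simp [exec, DominationInstance.encode]
        reg_three := by rw [hag.1 3 (by decide)]; simp [exec]
        reg_five := by rw [hag.1 5 (by decide)]; simp [exec, DominationInstance.encode]
        arr_input := fun a ha => by
          rw [hag.2 a (by interval_cases a <;> decide)]; simp [exec]
        arr_base := fun u hu => (hI u hu).1 }
    refine ⟨hR, fun v => ?_⟩
    rw [(hI v v.2).2, ← hR.arr_input 2 (by omega), hR.arr_candidate]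

/-- Compute `n ^ ℓ` in register `4`. -/
def powerProgram : RamProgram :=
  seq (const 4 1) (forLoop 10 1 (seq (const 20 0) (seq (forLoop 9 0 (add 20 20 4)) (add 4 20 2))))

theorem powerProgram_runs (hb : 2 ≤ b) (hn : n ≤ b) (hℓ : ℓ ≤ b) (hs : Ready I ℓ s) :
    Runs b 9 powerProgram s fun s' => s'.reg 4 = n ^ ℓ := by
  refine Runs.exec_seq (j := 8) hb rfl (by decide) fun s₁ hag₁ hs₁ => ?_
  have hR₁ := hs.of_agree hag₁ (by decide) (by decide)
  refine (Runs.forLoop (j := 5) (fun k s' => s'.reg 4 = n ^ k) hb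
    (by rw [hR₁.reg_one]; exact hℓ) hR₁.reg_three (by decide) (by simp [hs₁, exec]) ?_).weaken hb
      (by omega) ?_
  · intro k s' hk hi hag hI
    have hR := hR₁.of_agree hag (by decide) (by decide)
    refine (Runs.exec_seq (j := 4) hb rfl (by decide) fun s₂ hag₂ hs₂ => ?_)
    have hR₂ := hR.of_agree hag₂ (by decide) (by decide)
    have h4 : s₂.reg 4 = n ^ k := by rw [hag₂.1 4 (by decide), hI]
    refine Runs.seq (j := 3) hb (Runs.forLoop (j := 0) (fun k' s' => s'.reg 20 = k' * n ^ k) hb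
      (by rw [hR₂.reg_zero]; exact hn) hR₂.reg_three (by decide) (by simp [hs₂, exec]) ?_)
        fun s₃ hag₃ h20 => ?_
    · intro k' s'' _ hi' hag' hI'
      refine Runs.of_exec hb rfl (by decide) ?_
      have h4' : s''.reg 4 = n ^ k := by rw [hag'.1 4 (by decide), h4]
      simp [exec, hI', h4']; ring
    · have hR₃ := hR₂.of_agree hag₃ (by decide) (by decide)
      refine Runs.of_exec hb rfl (by decide) ?_
      rw [hR₂.reg_zero] at h20
      simp [exec, h20, hR₃.reg_two, pow_succ]; ring
  · intro s' _ h
    rwa [hR₁.reg_one] at h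

/-- Relax the edge from the vertex in register `10` to the vertex in register `9`. -/
def relaxProgram : RamProgram :=
  seq (add 22 21 9) (seq (load 22 0 22) (ifLt 2 22
    (seq (load 23 6 10) (seq (add 23 23 3) (seq (load 24 6 9)
      (ifLt 23 24 (store 6 9 23) skipProgram)))) skipProgram))

theorem relaxProgram_runs (hb : 2 ≤ b) (hs : Ready I ℓ s) {v x y : Fin n} {j : ℕ}
    {proc : ℕ → ℕ → Prop} (hx : s.reg 10 = x) (hy : s.reg 9 = y) (h21 : s.reg 21 = x * n)
    (h : DistInv I.graph v j proc (s.arr 6)) :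
    Runs b 4 relaxProgram s fun s' =>
      DistInv I.graph v j (fun x' y' => proc x' y' ∨ x' = x ∧ y' = y) (s'.arr 6) := by
  refine Runs.of_exec hb rfl (by decide) ?_
  have hadj := hs.arr_adj x y
  by_cases hxy : I.graph.Adj x y
  · rw [if_pos hxy] at hadj
    by_cases hlt : s.arr 6 x + 1 < s.arr 6 y
    · simpa [relaxProgram, exec, h21, hx, hy, hadj, hs.reg_two, hs.reg_three, hlt]
        using h.relax hxy hlt
    · simpa [relaxProgram, exec, h21, hx, hy, hadj, hs.reg_two, hs.reg_three, hlt, skipProgram]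
        using h.skip (fun h => hlt h.2)
  · rw [if_neg hxy] at hadj
    simpa [relaxProgram, exec, h21, hx, hy, hadj, hs.reg_two, hs.reg_three, skipProgram]
      using h.skip (fun h => hxy h.1)

/-- Relax all edges. -/
def sweepProgram : RamProgram :=
  forLoop 10 0 (seq (load 21 8 10) (forLoop 9 0 relaxProgram))

theorem sweepProgram_runs (hb : 2 ≤ b) (hn : n ≤ b) (hs : Ready I ℓ s) {v : Fin n} {j : ℕ}
    (h : DistInv I.graph v j (fun _ _ => False) (s.arr 6)) :
    Runs b 11 sweepProgram s fun s' =>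
      DistInv I.graph v (j + 1) (fun _ _ => False) (s'.arr 6) := by
  refine (Runs.forLoop (j := 8) (fun k s' => DistInv I.graph v j (fun x _ => x < k) (s'.arr 6)) hb
    (by rw [hs.reg_zero]; exact hn) hs.reg_three (by decide)
    (h.mono (by simp)) ?_).weaken hb (by omega) ?_
  · intro k s' hk hi hag hI
    rw [hs.reg_zero] at hk
    have hR := hs.of_agree hag (by decide) (by decide)
    refine Runs.exec_seq (j := 7) hb rfl (by decide) fun s₁ hag₁ hs₁ => ?_
    have hR₁ := hR.of_agree hag₁ (by decide) (by decide)
    have h21 : s₁.reg 21 = k * n := by simp [hs₁, exec, hi, hR.arr_base k hk]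
    -- Processed edges: all those from rows before `k`, and those of row `k` to columns before `k'`.
    refine (Runs.forLoop (j := 4) (fun k' s' =>
      DistInv I.graph v j (fun x y => x < k ∨ x = k ∧ y < k') (s'.arr 6)) hb
      (by rw [hR₁.reg_zero]; exact hn) hR₁.reg_three (by decide) ?_ ?_).weaken hb (by omega) ?_
    · have h6 : s₁.arr 6 = s'.arr 6 := hag₁.2 6 (by decide)
      simpa [h6] using hI
    · intro k' s'' hk' hi' hag' hI'
      rw [hR₁.reg_zero] at hk'
      have hR' := hR₁.of_agree hag' (by decide) (by decide)
      refine (relaxProgram_runs (x := ⟨k, hk⟩) (y := ⟨k', hk'⟩) hb hR' ?_ hi' ?_ hI').weaken hb le_rfl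
        fun s₂ _ h₂ => DistInv.mono (by simpa using h₂) (fun x y hxy => ?_)
      · rw [hag'.1 10 (by decide), hs₁]
        simpa [exec] using hi
      · rw [hag'.1 21 (by decide), h21]
      · omega
    · intro s₂ _ h₂
      rw [hR₁.reg_zero] at h₂
      exact DistInv.mono (by simpa using h₂) (fun x y hxy => by omega)
  · intro s' _ h'
    rw [hs.reg_zero] at h'
    exact h'.next fun x _ => x.2

/-- For the vertex `v` in register `8`, write to array `7` which vertices are in reach of `v`. -/
def nearRowProgram : RamProgram :=
  seq (forLoop 9 0 (store 6 9 0)) (seq (seq (store 6 8 2) (load 20 8 8))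
    (seq (forLoop 11 0 sweepProgram) (forLoop 9 0 (seq (add 22 20 9) (seq (load 23 6 9)
      (seq (load 24 4 8) (seq (const 25 0) (seq
        (ifLt 23 0 (ifLt 24 23 skipProgram (const 25 1)) skipProgram) (store 7 22 25)))))))))

open Classical in
theorem nearRowProgram_runs (hb : 2 ≤ b) (hn : n ≤ b) (hs : Ready I ℓ s) {v : Fin n}
    (hv : s.reg 8 = v) :
    Runs b 17 nearRowProgram s fun s' =>
      (∀ u : Fin n, s'.arr 7 (v * n + u) = if I.graph.edist u v ≤ I.reach v then 1 else 0) ∧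
      ∀ p, (∀ u < n, p ≠ v * n + u) → s'.arr 7 p = s.arr 7 p := by
  refine Runs.seq (j := 16) hb ((Runs.forLoop (j := 0) (fun k s' => ∀ u < k, s'.arr 6 u = n) hb
    (by rw [hs.reg_zero]; exact hn) hs.reg_three (by decide) (by simp) ?_).weaken hb
      (by omega : 3 ≤ 16) fun _ _ h => h) fun s₁ hag₁ hs₁ => ?_
  · intro k s' _ hi hag hI
    have hR := hs.of_agree hag (by decide) (by decide)
    refine Runs.of_exec hb rfl (by decide) fun u hu => ?_
    rcases Nat.lt_succ_iff_lt_or_eq.1 hu with hu | rfl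
    · simp [exec, hi, hu.ne, hI u hu]
    · simp [exec, hi, hR.reg_zero]
  have hR₁ := hs.of_agree hag₁ (by decide) (by decide)
  rw [hs.reg_zero] at hs₁
  have hv₁ : s₁.reg 8 = v := by rw [hag₁.1 8 (by decide), hv]
  refine Runs.exec_seq (j := 15) hb rfl (by decide) fun s₂ hag₂ hs₂ => ?_
  have hR₂ := hR₁.of_agree hag₂ (by decide) (by decide)
  have hv₂ : s₂.reg 8 = v := by rw [hag₂.1 8 (by decide), hv₁]
  have h20 : s₂.reg 20 = v * n := by
    have := hR₁.arr_base v v.2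
    simp [hs₂, exec, hv₁, this]
  have hinit : DistInv I.graph v 0 (fun _ _ => False) (s₂.arr 6) := by
    refine DistInv.init fun u => ?_
    simp [hs₂, exec, hv₁, hR₁.reg_two, Function.update_apply, hs₁ u u.2, Fin.val_inj]
  refine Runs.seq (j := 14) hb (Runs.forLoop (j := 11) (fun k s' =>
    DistInv I.graph v k (fun _ _ => False) (s'.arr 6)) hb
    (by rw [hR₂.reg_zero]; exact hn) hR₂.reg_three (by decide) hinit ?_) fun s₃ hag₃ hs₃ => ?_
  · intro k s' _ _ hag hI
    exact (sweepProgram_runs hb hn (hR₂.of_agree hag (by decide) (by decide)) hI).weaken hb le_rfl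
      fun _ _ h => h
  rw [hR₂.reg_zero] at hs₃
  have hR₃ := hR₂.of_agree hag₃ (by decide) (by decide)
  have hv₃ : s₃.reg 8 = v := by rw [hag₃.1 8 (by decide), hv₂]
  have h20₃ : s₃.reg 20 = v * n := by rw [hag₃.1 20 (by decide), h20]
  have h7 : s₃.arr 7 = s.arr 7 := by
    rw [hag₃.2 7 (by decide), hag₂.2 7 (by decide), hag₁.2 7 (by decide)]
  refine (Runs.forLoop (j := 4) (fun k s' =>
    (∀ u : Fin n, u < k →
      s'.arr 7 (v * n + u) = if I.graph.edist u v ≤ I.reach v then 1 else 0) ∧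
    ∀ p, (∀ u < n, p ≠ v * n + u) → s'.arr 7 p = s.arr 7 p) hb
    (by rw [hR₃.reg_zero]; exact hn) hR₃.reg_three (by decide) (by simp [h7]) ?_).weaken hb
      (by omega) ?_
  · rintro k s' hk hi hag ⟨hI, hI'⟩
    rw [hR₃.reg_zero] at hk
    have hR := hR₃.of_agree hag (by decide) (by decide)
    have hv' : s'.reg 8 = v := by rw [hag.1 8 (by decide), hv₃]
    have h20' : s'.reg 20 = v * n := by rw [hag.1 20 (by decide), h20₃]
    have h6 : s'.arr 6 = s₃.arr 6 := hag.2 6 (by decide)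
    have hiff := hs₃.lt_and_le_iff ⟨k, hk⟩ (I.reach v)
    have hreach := hR.arr_reach v
    have hval : (exec (seq (add 22 20 9) (seq (load 23 6 9)
      (seq (load 24 4 8) (seq (const 25 0) (seq
        (ifLt 23 0 (ifLt 24 23 skipProgram (const 25 1)) skipProgram) (store 7 22 25)))))) s').arr 7
        = Function.update (s'.arr 7) (v * n + k)
          (if I.graph.edist ⟨k, hk⟩ v ≤ I.reach v then 1 else 0) := by
      by_cases h1 : s₃.arr 6 k < n <;> by_cases h2 : I.reach v < s₃.arr 6 k <;>
        simp [exec, skipProgram, ← hiff, hi, hv', h20', h6, hR.reg_zero, hreach, h1, h2, not_le.2,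
          not_lt.1]
    refine Runs.of_exec hb rfl (by decide) ⟨fun u hu => ?_, fun p hp => ?_⟩
    · rw [RamState.setReg_arr, hval]
      rcases Nat.lt_succ_iff_lt_or_eq.1 hu with hu | hu
      · have : v * n + (u : ℕ) ≠ v * n + k := by omega
        rw [Function.update_of_ne this, hI u hu]
      · have : u = ⟨k, hk⟩ := Fin.ext hu
        subst this
        simp
    · rw [RamState.setReg_arr, hval, Function.update_of_ne (hp k hk), hI' p hp]
  · rintro s' - ⟨h1, h2⟩
    rw [hR₃.reg_zero] at h1
    exact ⟨fun u => h1 u u.2, h2⟩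

open Classical in
/-- Array `7` tells which vertices are in reach of which. -/
def NearTable {n : ℕ} (I : DominationInstance n) (s : RamState) : Prop :=
  ∀ v u : Fin n, s.arr 7 (v * n + u) = if I.graph.edist u v ≤ I.reach v then 1 else 0

theorem nearProgram_runs (hb : 2 ≤ b) (hn : n ≤ b) (hs : Ready I ℓ s) :
    Runs b 20 (forLoop 8 0 nearRowProgram) s (NearTable I) := by
  classical
  refine (Runs.forLoop (j := 17) (fun k s' => ∀ v u : Fin n, v < k →
    s'.arr 7 (v * n + u) = if I.graph.edist u v ≤ I.reach v then 1 else 0) hb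
    (by rw [hs.reg_zero]; exact hn) hs.reg_three (by decide) (by simp) ?_).weaken hb le_rfl ?_
  · intro k s' hk hi hag hI
    rw [hs.reg_zero] at hk
    have hR := hs.of_agree hag (by decide) (by decide)
    refine (nearRowProgram_runs (v := ⟨k, hk⟩) hb hn hR hi).weaken hb le_rfl ?_
    rintro s'' - ⟨h1, h2⟩ v u hv
    rcases Nat.lt_succ_iff_lt_or_eq.1 hv with hv | hv
    · rw [RamState.setReg_arr, h2 _ fun w hw heq => ?_, hI v u hv]
      have h3 : ((v : ℕ) + 1) * n ≤ k * n := Nat.mul_le_mul_right n hv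
      have h4 := u.2
      simp only at heq
      rw [Nat.succ_mul] at h3
      omega
    · obtain rfl : v = ⟨k, hk⟩ := Fin.ext hv
      rw [RamState.setReg_arr, h1 u]
  · intro s' _ h v u
    rw [hs.reg_zero] at h
    exact h v u v.2

end Program

/-! ### Enumerating, checking and accepting one exchange -/

section Search

open RamProgram

variable {n : ℕ} {I : DominationInstance n} {ℓ b : ℕ} {s s' : RamState}

/-- The function `a` is the indicator of `S`. -/
def IsIndicator {n : ℕ} (a : ℕ → ℕ) (S : Finset (Fin n)) : Prop :=
  ∀ v : Fin n, a v = if v ∈ S then 1 else 0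

/-- The set of the last `ℓ` digits of `k` in base `n`. -/
def digitSet (n ℓ k : ℕ) : Finset (Fin n) :=
  Finset.univ.filter fun v => ∃ i < ℓ, k / n ^ i % n = v

theorem card_digitSet_le (n ℓ k : ℕ) : (digitSet n ℓ k).card ≤ ℓ := by
  calc (digitSet n ℓ k).card = ((digitSet n ℓ k).image Fin.val).card :=
        (Finset.card_image_of_injective _ Fin.val_injective).symm
    _ ≤ ((Finset.range ℓ).image fun i => k / n ^ i % n).card := by
        refine Finset.card_le_card fun x hx => ?_
        obtain ⟨v, hv, rfl⟩ := Finset.mem_image.1 hx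
        obtain ⟨i, hi, hiv⟩ := (Finset.mem_filter.1 hv).2
        exact Finset.mem_image.2 ⟨i, Finset.mem_range.2 hi, hiv⟩
    _ ≤ ℓ := Finset.card_image_le.trans_eq (Finset.card_range ℓ)

/-- The elements of `Y` are listed as digits, and the remaining positions repeat one of them; hence
`Y` must be nonempty. -/
theorem exists_digitSet_eq {Y : Finset (Fin n)} (hY : Y.Nonempty) (hℓ : Y.card ≤ ℓ) :
    ∃ k < n ^ ℓ, digitSet n ℓ k = Y := by
  obtain ⟨y, hy⟩ := hY
  let e : Fin Y.card ≃ Y := Y.equivFin.symm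
  let f : Fin ℓ → Fin n := fun i => if h : (i : ℕ) < Y.card then e ⟨i, h⟩ else y
  refine ⟨finFunctionFinEquiv f, (finFunctionFinEquiv f).2, ?_⟩
  have hdig : ∀ i : Fin ℓ, (finFunctionFinEquiv f : ℕ) / n ^ (i : ℕ) % n = f i := fun i => by
    have := congrFun (finFunctionFinEquiv.symm_apply_apply f) i
    conv_rhs => rw [← this]
    rfl
  ext v
  simp only [digitSet, Finset.mem_filter, Finset.mem_univ, true_and]
  constructor
  · rintro ⟨i, hi, hiv⟩
    have h1 := hdig ⟨i, hi⟩
    rw [hiv] at h1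
    rw [Fin.ext h1]
    simp only [f]
    split_ifs with h
    · exact (e _).2
    · exact hy
  · intro hv
    obtain ⟨⟨i, hi⟩, he⟩ := e.surjective ⟨v, hv⟩
    refine ⟨i, by omega, (hdig ⟨i, by omega⟩).trans ?_⟩
    simp [f, hi, he]

/-- Copy the current solution from array `5` to array `9`. -/
def copyProgram : RamProgram := forLoop 8 0 (seq (load 20 5 8) (store 9 8 20))

theorem copyProgram_runs (hb : 2 ≤ b) (hn : n ≤ b) (hs : Ready I ℓ s) :
    Runs b 4 copyProgram s fun s' => ∀ u < n, s'.arr 9 u = s'.arr 5 u := by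
  refine (Runs.forLoop (j := 1) (fun k s' => ∀ u < k, s'.arr 9 u = s'.arr 5 u) hb
    (by rw [hs.reg_zero]; exact hn) hs.reg_three (by decide) (by simp) ?_).weaken hb (by omega) ?_
  · intro k s' hk hi hag hI
    refine Runs.of_exec hb rfl (by decide) fun u hu => ?_
    rcases Nat.lt_succ_iff_lt_or_eq.1 hu with hu | rfl
    · simp [exec, hi, hu.ne, hI u hu]
    · simp [exec, hi]
  · intro s' _ h
    rwa [hs.reg_zero] at h

/-- Divide register `21` by `n`: the remainder is left in register `21`, the quotient in register
`22`. -/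
def divProgram : RamProgram :=
  seq (const 22 0) (forLoop 11 4 (ifLt 21 0 skipProgram (seq (sub 21 21 0) (add 22 22 3))))

/-- Division by repeated subtraction, with a fixed number `M > c` of rounds that exceeds the
quotient; rounds after the remainder is below `n` do nothing. -/
theorem divProgram_runs (hb : 2 ≤ b) (hn : 0 < n) (hs : Ready I ℓ s) {M c : ℕ} (hM : M ≤ b)
    (h4 : s.reg 4 = M) (h21 : s.reg 21 = c) (hc : c < M) :
    Runs b 6 divProgram s fun s' => s'.reg 21 = c % n ∧ s'.reg 22 = c / n := by
  refine Runs.exec_seq (j := 5) hb rfl (by decide) fun s₁ hag₁ hs₁ => ?_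
  have hR₁ := hs.of_agree hag₁ (by decide) (by decide)
  have h4₁ : s₁.reg 4 = M := by rw [hag₁.1 4 (by decide), h4]
  refine (Runs.forLoop (j := 2) (fun k s' => s'.reg 21 + n * s'.reg 22 = c ∧
    (s'.reg 21 < n ∨ s'.reg 22 = k)) hb (by rw [h4₁]; exact hM) hR₁.reg_three (by decide)
    (by simp [hs₁, exec, h21]) ?_).weaken hb le_rfl ?_
  · rintro k s' hk hi hag ⟨hI, hI'⟩
    have hR := hR₁.of_agree hag (by decide) (by decide)
    refine Runs.of_exec hb rfl (by decide) ?_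
    by_cases hlt : s'.reg 21 < n
    · simp [exec, skipProgram, hR.reg_zero, hlt, hI]
    · simp [exec, hR.reg_zero, hR.reg_three, hlt]
      rw [Nat.mul_succ]
      omega
  · rintro s' _ ⟨h, h'⟩
    rw [h4₁] at h'
    have hlt : s'.reg 21 < n := by
      rcases h' with h' | h'
      · exact h'
      · rw [h'] at h
        have := Nat.le_mul_of_pos_left M hn
        omega
    rw [← h]
    exact ⟨by rw [Nat.add_mul_mod_self_left, Nat.mod_eq_of_lt hlt],
      by rw [Nat.add_mul_div_left _ _ hn, Nat.div_eq_of_lt hlt, zero_add]⟩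

/-- Toggle the vertices that occur as digits of register `7`. -/
def toggleProgram : RamProgram :=
  seq (add 21 7 2) (forLoop 10 1 (seq divProgram
    (seq (load 23 5 21) (seq (sub 23 3 23) (seq (store 9 21 23) (add 21 22 2))))))

/-- The toggled value is computed from the unchanged array `5`, so a digit that occurs repeatedly
toggles its vertex only once. -/
theorem toggleProgram_runs (hb : 2 ≤ b) (hn : 0 < n) (hℓ : ℓ ≤ b) (hs : Ready I ℓ s)
    {S : Finset (Fin n)} (hS : IsIndicator (s.arr 5) S) (h9 : ∀ u < n, s.arr 9 u = s.arr 5 u)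
    {M k : ℕ} (hM : M ≤ b) (h4 : s.reg 4 = M) (h7 : s.reg 7 = k) (hk : k < M) :
    Runs b 11 toggleProgram s fun s' => IsIndicator (s'.arr 9) (symmDiff S (digitSet n ℓ k)) := by
  refine Runs.exec_seq (j := 10) hb rfl (by decide) fun s₁ hag₁ hs₁ => ?_
  have hR₁ := hs.of_agree hag₁ (by decide) (by decide)
  have h4₁ : s₁.reg 4 = M := by rw [hag₁.1 4 (by decide), h4]
  have h5₁ : s₁.arr 5 = s.arr 5 := hag₁.2 5 (by decide)
  have h9₁ : s₁.arr 9 = s.arr 9 := hag₁.2 9 (by decide)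
  refine (Runs.forLoop (j := 7) (fun i s' => s'.reg 21 = k / n ^ i ∧ ∀ v : Fin n, s'.arr 9 v =
    if ∃ i' < i, k / n ^ i' % n = v then 1 - s.arr 5 v else s.arr 5 v) hb
    (by rw [hR₁.reg_one]; exact hℓ) hR₁.reg_three (by decide) ?_ ?_).weaken hb le_rfl ?_
  · refine ⟨by simp [hs₁, exec, h7, hs.reg_two], fun v => ?_⟩
    simp [h9₁, h9 v v.2]
  · rintro i s' _ _ hag ⟨h21, hI⟩
    have hR := hR₁.of_agree hag (by decide) (by decide)
    have h4' : s'.reg 4 = M := by rw [hag.1 4 (by decide), h4₁]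
    have hlt : k / n ^ i < M := (Nat.div_le_self _ _).trans_lt hk
    refine Runs.seq (j := 6) hb (divProgram_runs hb hn hR hM h4' h21 hlt)
      fun s₂ hag₂ h₂ => ?_
    have hR₂ := hR.of_agree hag₂ (by decide) (by decide)
    have h5₂ : s₂.arr 5 = s.arr 5 := by
      rw [hag₂.2 5 (by decide), hag.2 5 (by decide), h5₁]
    have h9₂ : s₂.arr 9 = s'.arr 9 := hag₂.2 9 (by decide)
    refine Runs.of_exec hb rfl (by decide) ⟨?_, fun v => ?_⟩
    · simp [exec, h₂.2, hR₂.reg_two, Nat.div_div_eq_div_mul, pow_succ]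
    · by_cases hv : k / n ^ i % n = v
      · have hex : ∃ i' < i + 1, k / n ^ i' % n = v := ⟨i, Nat.lt_succ_self i, hv⟩
        rw [if_pos hex]
        simp [exec, h₂.1, hR₂.reg_three, h5₂, hv]
      · have hiff : (∃ i' < i + 1, k / n ^ i' % n = v) ↔ ∃ i' < i, k / n ^ i' % n = v := by
          constructor
          · rintro ⟨i', hi', h⟩
            rcases Nat.lt_succ_iff_lt_or_eq.1 hi' with hi' | rfl
            · exact ⟨i', hi', h⟩
            · exact absurd h hv
          · rintro ⟨i', hi', h⟩
            exact ⟨i', by omega, h⟩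
        simp only [hiff, ← hI v]
        simp [exec, h₂.1, Ne.symm hv, h9₂]
  · rintro s' - ⟨-, h⟩ v
    rw [hR₁.reg_one] at h
    rw [h v, hS v]
    simp only [digitSet, Finset.mem_symmDiff, Finset.mem_filter, Finset.mem_univ, true_and]
    by_cases h1 : v ∈ S <;> by_cases h2 : ∃ i' < ℓ, k / n ^ i' % n = v <;> simp [h1, h2]

theorem card_filter_lt_succ (S : Finset (Fin n)) {k : ℕ} (hk : k < n) :
    (S.filter fun v : Fin n => (v : ℕ) < k + 1).card
      = (S.filter fun v : Fin n => (v : ℕ) < k).card + if ⟨k, hk⟩ ∈ S then 1 else 0 := by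
  have h1 : (S.filter fun v : Fin n => (v : ℕ) < k + 1)
      = (S.filter fun v : Fin n => (v : ℕ) < k) ∪ S.filter fun v => v = ⟨k, hk⟩ := by
    ext v
    simp only [Finset.mem_filter, Finset.mem_union, Fin.ext_iff, Nat.lt_succ_iff_lt_or_eq]
    tauto
  rw [h1, Finset.card_union_of_disjoint, Finset.filter_eq']
  · split_ifs <;> simp
  · refine Finset.disjoint_left.2 fun v hv hv' => ?_
    have h2 := (Finset.mem_filter.1 hv).2
    have h3 := (Finset.mem_filter.1 hv').2
    rw [h3] at h2
    exact lt_irrefl _ h2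

/-- Count in register `27` the vertices in array `9` that are in reach of the vertex in register
`8`. -/
def countProgram : RamProgram :=
  forLoop 9 0 (seq (add 28 26 9) (seq (load 28 7 28) (seq (load 29 9 9) (seq (add 28 28 29)
    (ifLt 3 28 (add 27 27 3) skipProgram)))))

open Classical in
theorem countProgram_runs (hb : 2 ≤ b) (hn : n ≤ b) (hs : Ready I ℓ s) (hN : NearTable I s)
    {S : Finset (Fin n)} (hS : IsIndicator (s.arr 9) S) {v : Fin n} (h26 : s.reg 26 = v * n)
    (h27 : s.reg 27 = 0) :
    Runs b 6 countProgram s fun s' =>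
      s'.reg 27 = (S.filter fun u => I.graph.edist u v ≤ (I.reach v : ℕ∞)).card := by
  refine (Runs.forLoop (j := 3) (fun k s' => s'.reg 27 =
    ((S.filter fun u => I.graph.edist u v ≤ (I.reach v : ℕ∞)).filter fun u : Fin n => (u : ℕ) < k).card) hb
    (by rw [hs.reg_zero]; exact hn) hs.reg_three (by decide) (by simp [h27]) ?_).weaken hb le_rfl ?_
  · intro k s' hk hi hag hI
    rw [hs.reg_zero] at hk
    have hR := hs.of_agree hag (by decide) (by decide)
    have h26' : s'.reg 26 = v * n := by rw [hag.1 26 (by decide), h26]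
    have h7 := hN v ⟨k, hk⟩
    rw [← hag.2 7 (by decide)] at h7
    have h9 := hS ⟨k, hk⟩
    rw [← hag.2 9 (by decide)] at h9
    simp only at h7 h9
    refine Runs.of_exec hb rfl (by decide) ?_
    rw [card_filter_lt_succ _ hk, ← hI]
    -- Both conditions hold exactly if the sum of the two indicators exceeds one.
    by_cases h1 : I.graph.edist ⟨k, hk⟩ v ≤ I.reach v <;> by_cases h2 : ⟨k, hk⟩ ∈ S <;>
      simp [exec, skipProgram, hi, h26', h7, h9, hR.reg_three, h1, h2]
  · intro s' _ h
    rw [hs.reg_zero] at h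
    rw [h]
    congr 1
    exact Finset.filter_true_of_mem fun u _ => u.2

/-- Compute in registers `20` and `21` the cardinalities of the sets in the arrays `5` and `9`, and
in register `22` whether the set in array `9` is infeasible. -/
def checkProgram : RamProgram :=
  seq (seq (const 20 0) (seq (const 21 0) (const 22 0))) (forLoop 8 0
    (seq (seq (load 23 5 8) (seq (add 20 20 23) (seq (load 24 9 8) (seq (add 21 21 24)
      (seq (load 25 2 8) (seq (ifLt 25 24 (const 22 1) skipProgram)
        (seq (load 26 8 8) (const 27 0)))))))) (seq countProgram
      (seq (load 28 1 8) (seq (load 29 3 8)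
        (ifLt 2 28 (ifLt 27 29 (const 22 1) skipProgram) skipProgram))))))

open Classical in
theorem checkProgram_runs (hb : 2 ≤ b) (hn : n ≤ b) (hs : Ready I ℓ s) (hN : NearTable I s)
    {S S' : Finset (Fin n)} (hS : IsIndicator (s.arr 5) S) (hS' : IsIndicator (s.arr 9) S') :
    Runs b 12 checkProgram s fun s' => s'.reg 20 = S.card ∧ s'.reg 21 = S'.card ∧
      s'.reg 22 = if I.IsFeasible S' then 0 else 1 := by
  refine Runs.exec_seq (j := 11) hb rfl (by decide) fun s₁ hag₁ hs₁ => ?_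
  have hR₁ := hs.of_agree hag₁ (by decide) (by decide)
  have h5₁ : s₁.arr 5 = s.arr 5 := hag₁.2 5 (by decide)
  have h9₁ : s₁.arr 9 = s.arr 9 := hag₁.2 9 (by decide)
  have h7₁ : s₁.arr 7 = s.arr 7 := hag₁.2 7 (by decide)
  let ok : Fin n → Prop := fun v => (v ∈ S' → v ∈ I.candidates) ∧
    (v ∈ I.targets →
      I.demand v ≤ (S'.filter fun u => I.graph.edist u v ≤ (I.reach v : ℕ∞)).card)
  refine (Runs.forLoop (j := 8) (fun k s' =>
    s'.reg 20 = (S.filter fun v : Fin n => (v : ℕ) < k).card ∧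
    s'.reg 21 = (S'.filter fun v : Fin n => (v : ℕ) < k).card ∧
    s'.reg 22 = if ∀ v : Fin n, (v : ℕ) < k → ok v then 0 else 1) hb
    (by rw [hR₁.reg_zero]; exact hn) hR₁.reg_three (by decide) (by simp [hs₁, exec]) ?_).weaken hb
      le_rfl ?_
  · rintro k s' hk hi hag ⟨h20, h21, h22⟩
    rw [hR₁.reg_zero] at hk
    have hR := hR₁.of_agree hag (by decide) (by decide)
    have h5 : s'.arr 5 k = if ⟨k, hk⟩ ∈ S then 1 else 0 := by
      rw [hag.2 5 (by decide), h5₁]; exact hS ⟨k, hk⟩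
    have h9 : s'.arr 9 k = if ⟨k, hk⟩ ∈ S' then 1 else 0 := by
      rw [hag.2 9 (by decide), h9₁]; exact hS' ⟨k, hk⟩
    have h2 := hR.arr_candidate ⟨k, hk⟩
    have h8 := hR.arr_base k hk
    simp only at h2
    refine Runs.exec_seq (j := 7) hb rfl (by decide) fun s₂ hag₂ hs₂ => ?_
    have hR₂ := hR.of_agree hag₂ (by decide) (by decide)
    have g20 : s₂.reg 20 = (S.filter fun v : Fin n => (v : ℕ) < k + 1).card := by
      rw [card_filter_lt_succ _ hk, ← h20, ← h5]
      by_cases h1 : ⟨k, hk⟩ ∈ I.candidates <;> by_cases h1' : ⟨k, hk⟩ ∈ S' <;>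
        simp [hs₂, exec, skipProgram, hi, h2, h9, h1, h1']
    have g21 : s₂.reg 21 = (S'.filter fun v : Fin n => (v : ℕ) < k + 1).card := by
      rw [card_filter_lt_succ _ hk, ← h21, ← h9]
      by_cases h1 : ⟨k, hk⟩ ∈ I.candidates <;> by_cases h1' : ⟨k, hk⟩ ∈ S' <;>
        simp [hs₂, exec, skipProgram, hi, h2, h9, h1, h1']
    have g22 : s₂.reg 22 = if (∀ v : Fin n, (v : ℕ) < k → ok v) ∧
        (⟨k, hk⟩ ∈ S' → ⟨k, hk⟩ ∈ I.candidates) then 0 else 1 := by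
      by_cases h1 : ⟨k, hk⟩ ∈ I.candidates <;> by_cases h1' : ⟨k, hk⟩ ∈ S' <;>
        simp [hs₂, exec, skipProgram, hi, h2, h9, h1, h1', h22]
    have g26 : s₂.reg 26 = (⟨k, hk⟩ : Fin n) * n := by
      by_cases h1 : ⟨k, hk⟩ ∈ I.candidates <;> by_cases h1' : ⟨k, hk⟩ ∈ S' <;>
        simp [hs₂, exec, skipProgram, hi, h2, h9, h1, h1', h8]
    have g27 : s₂.reg 27 = 0 := by simp [hs₂, exec]
    have hN₂ : NearTable I s₂ := fun v u => by
      rw [hag₂.2 7 (by decide), hag.2 7 (by decide), h7₁]; exact hN v u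
    have hS₂ : IsIndicator (s₂.arr 9) S' := by
      rw [hag₂.2 9 (by decide), hag.2 9 (by decide), h9₁]; exact hS'
    refine Runs.seq (j := 6) hb (countProgram_runs hb hn hR₂ hN₂ hS₂ g26 g27) fun s₃ hag₃ h27 => ?_
    have hR₃ := hR₂.of_agree hag₃ (by decide) (by decide)
    have h1 := hR₃.arr_target ⟨k, hk⟩
    have h3 := hR₃.arr_demand ⟨k, hk⟩
    have hi₃ : s₃.reg 8 = k := by rw [hag₃.1 8 (by decide), hag₂.1 8 (by decide), hi]
    rw [← hag₃.1 20 (by decide)] at g20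
    rw [← hag₃.1 21 (by decide)] at g21
    rw [← hag₃.1 22 (by decide)] at g22
    have hok : (∀ v : Fin n, (v : ℕ) < k + 1 → ok v) ↔
        ((∀ v : Fin n, (v : ℕ) < k → ok v) ∧ (⟨k, hk⟩ ∈ S' → ⟨k, hk⟩ ∈ I.candidates)) ∧
        (⟨k, hk⟩ ∈ I.targets → I.demand ⟨k, hk⟩ ≤ s₃.reg 27) := by
      rw [h27]
      constructor
      · intro h
        exact ⟨⟨fun v hv => h v (by omega), (h ⟨k, hk⟩ (Nat.lt_succ_self k)).1⟩,
          (h ⟨k, hk⟩ (Nat.lt_succ_self k)).2⟩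
      · rintro ⟨⟨h, h'⟩, h''⟩ v hv
        rcases Nat.lt_succ_iff_lt_or_eq.1 hv with hv | hv
        · exact h v hv
        · obtain rfl : v = ⟨k, hk⟩ := Fin.ext hv
          exact ⟨h', h''⟩
    simp only at h1 h3
    refine Runs.of_exec hb rfl (by decide) ?_
    simp only [hok]
    by_cases ht : ⟨k, hk⟩ ∈ I.targets <;> by_cases hd : s₃.reg 27 < I.demand ⟨k, hk⟩ <;>
      simp [exec, skipProgram, hi₃, h1, h3, hR₃.reg_two, ht, hd, g20, g21, g22, not_le.2, not_lt.1]
  · rintro s' - ⟨h20, h21, h22⟩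
    rw [hR₁.reg_zero] at h20 h21 h22
    have hfull : ∀ T : Finset (Fin n), (T.filter fun v : Fin n => (v : ℕ) < n) = T := fun T =>
      Finset.filter_true_of_mem fun v _ => v.2
    rw [hfull] at h20 h21
    refine ⟨h20, h21, h22.trans ?_⟩
    congr 1
    refine propext ⟨fun h => ⟨fun v hv => (h v v.2).1 hv, fun v hv => ?_⟩,
      fun h v _ => ⟨fun hv => h.1 hv, fun hv => ?_⟩⟩
    · convert (h v v.2).2 hv
    · convert h.2 v hv

/-- If the set in array `9` is feasible and smaller than the current solution, it becomes the
current solution. -/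
def acceptProgram : RamProgram :=
  seq (seq (const 23 0) (ifLt 21 20 (ifLt 22 3 (const 23 1) skipProgram) skipProgram))
    (forLoop 8 0 (ifLt 2 23 (seq (load 24 9 8) (store 5 8 24)) skipProgram))

open Classical in
theorem acceptProgram_runs (hb : 2 ≤ b) (hn : n ≤ b) (hs : Ready I ℓ s)
    {S S' : Finset (Fin n)} (hS : IsIndicator (s.arr 5) S) (hS' : IsIndicator (s.arr 9) S')
    (h20 : s.reg 20 = S.card) (h21 : s.reg 21 = S'.card)
    (h22 : s.reg 22 = if I.IsFeasible S' then 0 else 1) :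
    Runs b 6 acceptProgram s fun s' =>
      IsIndicator (s'.arr 5) (if I.IsFeasible S' ∧ S'.card < S.card then S' else S) := by
  refine Runs.exec_seq (j := 5) hb rfl (by decide) fun s₁ hag₁ hs₁ => ?_
  have hR₁ := hs.of_agree hag₁ (by decide) (by decide)
  have h5₁ : s₁.arr 5 = s.arr 5 := hag₁.2 5 (by decide)
  have h9₁ : s₁.arr 9 = s.arr 9 := hag₁.2 9 (by decide)
  have h23 : s₁.reg 23 = if I.IsFeasible S' ∧ S'.card < S.card then 1 else 0 := by
    by_cases h1 : I.IsFeasible S' <;> by_cases h2 : S'.card < S.card <;>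
      simp [hs₁, exec, skipProgram, h20, h21, h22, hs.reg_three, h1, h2]
  refine (Runs.forLoop (j := 2) (fun k s' => ∀ v : Fin n, s'.arr 5 v =
    if I.IsFeasible S' ∧ S'.card < S.card ∧ v < k then s.arr 9 v else s.arr 5 v) hb
    (by rw [hR₁.reg_zero]; exact hn) hR₁.reg_three (by decide) (by simp [h5₁]) ?_).weaken hb
      le_rfl ?_
  · intro k s' hk hi hag hI
    have hR := hR₁.of_agree hag (by decide) (by decide)
    have h23' : s'.reg 23 = s₁.reg 23 := hag.1 23 (by decide)
    have h9 : s'.arr 9 = s.arr 9 := by rw [hag.2 9 (by decide), h9₁]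
    rw [h23] at h23'
    refine Runs.of_exec hb rfl (by decide) fun v => ?_
    by_cases hc : I.IsFeasible S' ∧ S'.card < S.card
    · by_cases hv : (v : ℕ) = k
      · simp [exec, h23', hc, hR.reg_two, hi, h9, hv]
      · have : (v : ℕ) < k + 1 ↔ (v : ℕ) < k := by omega
        have h1 := hI v
        simp [hc] at h1
        simp [exec, h23', hc, hR.reg_two, hi, h9, hv, this, h1]
    · have h1 := hI v
      rw [if_neg (fun h => hc ⟨h.1, h.2.1⟩)] at h1 ⊢
      simp [exec, h23', hc, hR.reg_two, skipProgram, h1]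
  · intro s' _ h v
    rw [hR₁.reg_zero] at h
    rw [h v]
    by_cases hc : I.IsFeasible S' ∧ S'.card < S.card
    · rw [if_pos ⟨hc.1, hc.2, v.2⟩, if_pos hc, hS' v]
    · rw [if_neg (fun h => hc ⟨h.1, h.2.1⟩), if_neg hc, hS v]

end Search

/-! ### The complete local search and its running time -/

section LocalSearch

open RamProgram

variable {n : ℕ} {I : DominationInstance n} {ℓ b : ℕ} {s s' : RamState}

open Classical in
/-- The solution after testing the exchange with number `k`. -/
noncomputable def nextSolution (I : DominationInstance n) (ℓ : ℕ) (S : Finset (Fin n)) (k : ℕ) :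
    Finset (Fin n) :=
  if I.IsFeasible (symmDiff S (digitSet n ℓ k)) ∧ (symmDiff S (digitSet n ℓ k)).card < S.card
  then symmDiff S (digitSet n ℓ k) else S

theorem isImprovement_iff {S : Finset (Fin n)} {k : ℕ} :
    I.IsImprovement ℓ S (symmDiff S (digitSet n ℓ k)) ↔
      I.IsFeasible (symmDiff S (digitSet n ℓ k)) ∧
        (symmDiff S (digitSet n ℓ k)).card < S.card := by
  refine ⟨fun h => ⟨h.1, h.2.2⟩, fun h => ⟨h.1, ?_, h.2⟩⟩
  rw [symmDiff_symmDiff_cancel_left]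
  exact card_digitSet_le n ℓ k

theorem nextSolution_cases (S : Finset (Fin n)) (k : ℕ) :
    I.IsImprovement ℓ S (nextSolution I ℓ S k) ∨
      nextSolution I ℓ S k = S ∧ ¬ I.IsImprovement ℓ S (symmDiff S (digitSet n ℓ k)) := by
  classical
  unfold nextSolution
  split_ifs with h
  · exact Or.inl (isImprovement_iff.2 h)
  · exact Or.inr ⟨rfl, fun h' => h (isImprovement_iff.1 h')⟩

/-- An improvement `B` differs from `S`, so the symmetric difference is a nonempty set of at most
`ℓ` vertices and occurs as a set of digits. -/
theorem isLocallyOptimal_of_forall {S : Finset (Fin n)} (hS : I.IsFeasible S)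
    (h : ∀ k < n ^ ℓ, ¬ I.IsImprovement ℓ S (symmDiff S (digitSet n ℓ k))) :
    I.IsLocallyOptimal ℓ S := by
  refine ⟨hS, fun B hB => ?_⟩
  have hne : (symmDiff S B).Nonempty := by
    rw [Finset.nonempty_iff_ne_empty]
    intro h0
    have : S = B := symmDiff_eq_bot.1 h0
    exact absurd hB.2.2 (by rw [this]; exact lt_irrefl _)
  obtain ⟨k, hk, hkY⟩ := exists_digitSet_eq hne hB.2.1
  refine h k hk ?_
  rw [hkY, symmDiff_symmDiff_cancel_left]
  exact hB

/-- Test the exchange whose number is in register `7`. -/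
def candidateProgram : RamProgram :=
  seq copyProgram (seq toggleProgram (seq checkProgram acceptProgram))

theorem candidateProgram_runs (hb : 2 ≤ b) (hnb : n ≤ b) (hn : 0 < n) (hℓ : ℓ ≤ b)
    (hM : n ^ ℓ ≤ b) (hs : Ready I ℓ s) (hN : NearTable I s) {S : Finset (Fin n)}
    (hS : IsIndicator (s.arr 5) S) {k : ℕ} (h4 : s.reg 4 = n ^ ℓ) (h7 : s.reg 7 = k)
    (hk : k < n ^ ℓ) :
    Runs b 15 candidateProgram s fun s' => IsIndicator (s'.arr 5) (nextSolution I ℓ S k) := by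
  refine Runs.seq (j := 14) hb ((copyProgram_runs hb hnb hs).weaken hb (by omega)
    fun _ _ h => h) fun s₁ hag₁ h₁ => ?_
  have hR₁ := hs.of_agree hag₁ (by decide) (by decide)
  have hS₁ : IsIndicator (s₁.arr 5) S := by rw [hag₁.2 5 (by decide)]; exact hS
  refine Runs.seq (j := 13) hb ((toggleProgram_runs hb hn hℓ hR₁ hS₁ h₁ hM
    (by rw [hag₁.1 4 (by decide), h4]) (by rw [hag₁.1 7 (by decide), h7]) hk).weaken hb (by omega)
    fun _ _ h => h) fun s₂ hag₂ h₂ => ?_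
  have hR₂ := hR₁.of_agree hag₂ (by decide) (by decide)
  have hS₂ : IsIndicator (s₂.arr 5) S := by rw [hag₂.2 5 (by decide)]; exact hS₁
  have hN₂ : NearTable I s₂ := fun v u => by
    rw [hag₂.2 7 (by decide), hag₁.2 7 (by decide)]; exact hN v u
  refine Runs.seq (j := 12) hb (checkProgram_runs hb hnb hR₂ hN₂ hS₂ h₂) fun s₃ hag₃ h₃ => ?_
  have hR₃ := hR₂.of_agree hag₃ (by decide) (by decide)
  refine (acceptProgram_runs hb hnb hR₃ (S := S) (S' := symmDiff S (digitSet n ℓ k)) ?_ ?_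
    h₃.1 h₃.2.1 h₃.2.2).weaken hb (by omega) fun _ _ h => h
  · rw [hag₃.2 5 (by decide)]; exact hS₂
  · rw [hag₃.2 9 (by decide)]; exact h₂

/-- One pass over all exchanges. -/
def passProgram : RamProgram := forLoop 7 4 candidateProgram

/-- Improvements are applied at once during the pass. Only if none occurs have all exchanges been
tested against the same `S`; otherwise the size has dropped. -/
theorem passProgram_runs (hb : 2 ≤ b) (hnb : n ≤ b) (hℓ1 : 1 ≤ ℓ) (hℓ : ℓ ≤ b)
    (hM : n ^ ℓ ≤ b) (hs : Ready I ℓ s) (hN : NearTable I s) {S : Finset (Fin n)}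
    (hS : IsIndicator (s.arr 5) S) (hf : I.IsFeasible S) (h4 : s.reg 4 = n ^ ℓ) :
    Runs b 18 passProgram s fun s' => ∃ S' : Finset (Fin n), IsIndicator (s'.arr 5) S' ∧
      Relation.ReflTransGen (I.IsImprovement ℓ) S S' ∧ I.IsFeasible S' ∧
      (S' = S ∧ I.IsLocallyOptimal ℓ S ∨ S'.card < S.card) := by
  refine (Runs.forLoop (j := 15) (fun k s' => ∃ S' : Finset (Fin n), IsIndicator (s'.arr 5) S' ∧
      Relation.ReflTransGen (I.IsImprovement ℓ) S S' ∧ I.IsFeasible S' ∧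
      ((S' = S ∧ ∀ k' < k, ¬ I.IsImprovement ℓ S (symmDiff S (digitSet n ℓ k'))) ∨
        S'.card < S.card)) hb
    (by rw [h4]; exact hM) hs.reg_three (by decide)
    ⟨S, by simpa using hS, .refl, hf, Or.inl ⟨rfl, by simp⟩⟩ ?_).weaken hb le_rfl ?_
  · rintro k s' hk hi hag ⟨S', hS', hreach, hf', hcase⟩
    rw [h4] at hk
    -- For n = 0 there are no exchanges, since 0^ℓ = 0 for ℓ ≥ 1.
    have hn : 0 < n := by
      by_contra! h0
      obtain rfl : n = 0 := by omega
      rw [zero_pow (by omega)] at hk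
      omega
    have hR := hs.of_agree hag (by decide) (by decide)
    have hN' : NearTable I s' := fun v u => by rw [hag.2 7 (by decide)]; exact hN v u
    refine (candidateProgram_runs hb hnb hn hℓ hM hR hN' hS' (by rw [hag.1 4 (by decide), h4]) hi
      hk).weaken hb le_rfl fun s'' _ h'' => ⟨nextSolution I ℓ S' k, by simpa using h'', ?_⟩
    rcases nextSolution_cases (I := I) (ℓ := ℓ) S' k with himp | ⟨heq, hno⟩
    · refine ⟨hreach.tail himp, himp.1, Or.inr ?_⟩
      rcases hcase with ⟨rfl, -⟩ | hlt
      · exact himp.2.2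
      · exact himp.2.2.trans hlt
    · rw [heq]
      refine ⟨hreach, hf', hcase.imp (fun h => ⟨h.1, fun k' hk' => ?_⟩) id⟩
      rcases Nat.lt_succ_iff_lt_or_eq.1 hk' with hk' | rfl
      · exact h.2 k' hk'
      · rw [← h.1]; exact hno
  · rintro s' - ⟨S', h1, h2, h3, h4'⟩
    rw [h4] at h4'
    exact ⟨S', h1, h2, h3, h4'.imp (fun h => ⟨h.1, isLocallyOptimal_of_forall hf h.2⟩) id⟩

/-- The local search algorithm. -/
def localSearchProgram : RamProgram :=
  seq setupProgram (seq powerProgram (seq (forLoop 8 0 nearRowProgram) (forLoop 6 5 passProgram)))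

theorem localSearchProgram_runs (hb : 2 ≤ b) (hnb : n + 1 ≤ b) (hℓ1 : 1 ≤ ℓ) (hℓ : ℓ ≤ b)
    (hM : n ^ ℓ ≤ b) (hf : I.IsFeasible I.candidates) :
    Runs b 24 localSearchProgram (I.encode ℓ) fun s => I.IsLocalSearchResult ℓ (s.output n) := by
  have hnb' : n ≤ b := by omega
  refine Runs.seq (j := 23) hb ((setupProgram_runs hb hnb').weaken hb (by omega) fun _ _ h => h)
    fun s₁ _ h₁ => ?_
  obtain ⟨hR₁, hS₁⟩ := h₁
  refine Runs.seq (j := 22) hb ((powerProgram_runs hb hnb' hℓ hR₁).weaken hb (by omega)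
    fun _ _ h => h) fun s₂ hag₂ h4 => ?_
  have hR₂ := hR₁.of_agree hag₂ (by decide) (by decide)
  refine Runs.seq (j := 21) hb ((nearProgram_runs hb hnb' hR₂).weaken hb (by omega)
    fun _ _ h => h) fun s₃ hag₃ hN => ?_
  have hR₃ := hR₂.of_agree hag₃ (by decide) (by decide)
  have h4₃ : s₃.reg 4 = n ^ ℓ := by rw [hag₃.1 4 (by decide), h4]
  have hS₃ : IsIndicator (s₃.arr 5) I.candidates := by
    rw [hag₃.2 5 (by decide), hag₂.2 5 (by decide)]; exact hS₁
  -- Each pass ends with an optimal solution or loses a vertex. After n + 1 passes the alternative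
  -- would read |S| + n + 1 ≤ n.
  refine (Runs.forLoop (j := 18) (fun g s' => ∃ S : Finset (Fin n), IsIndicator (s'.arr 5) S ∧
      Relation.ReflTransGen (I.IsImprovement ℓ) I.candidates S ∧ I.IsFeasible S ∧
      (I.IsLocallyOptimal ℓ S ∨ S.card + g ≤ n)) hb
    (by rw [hR₃.reg_five]; exact hnb) hR₃.reg_three (by decide)
    ⟨I.candidates, by simpa using hS₃, .refl, hf, Or.inr ?_⟩ ?_).weaken hb le_rfl ?_
  · simpa using Finset.card_le_univ I.candidates
  · rintro g s' _ _ hag ⟨S, hS, hreach, hfS, hcase⟩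
    have hR := hR₃.of_agree hag (by decide) (by decide)
    have hN' : NearTable I s' := fun v u => by rw [hag.2 7 (by decide)]; exact hN v u
    refine (passProgram_runs hb hnb' hℓ1 hℓ hM hR hN' hS hfS
      (by rw [hag.1 4 (by decide), h4₃])).weaken hb le_rfl ?_
    rintro s'' - ⟨S', hS', hreach', hfS', hcase'⟩
    refine ⟨S', by simpa using hS', hreach.trans hreach', hfS', ?_⟩
    rcases hcase' with ⟨rfl, hopt⟩ | hlt
    · exact Or.inl hopt
    · rcases hcase with hopt | hle
      -- An optimal solution is left unchanged by further passes, since no improving step can start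
      -- from it.
      · rcases Relation.ReflTransGen.cases_head hreach' with rfl | ⟨T, hT, -⟩
        · exact Or.inl hopt
        · exact absurd hT (hopt.2 T)
      · exact Or.inr (by omega)
  · rintro s' - ⟨S, hS, hreach, -, hcase⟩
    rw [hR₃.reg_five] at hcase
    have hout : s'.output n = S := by
      ext v
      simp [RamState.output, hS v]
    rw [hout]
    exact ⟨hreach, hcase.resolve_right (by omega)⟩

theorem localSearchProgram_isLocalSearchProgram : IsLocalSearchProgram localSearchProgram 48 := by
  intro n I ℓ hℓ hf
  set N := max n 2 with hN
  have hN2 : 2 ≤ N := le_max_right _ _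
  have hnN : n ≤ N := le_max_left _ _
  have hNN : N ^ 2 ≤ N ^ (2 * ℓ) := Nat.pow_le_pow_right (by omega) (by omega)
  have hNb : N + 1 ≤ N ^ (2 * ℓ) := by nlinarith
  have hℓb : ℓ ≤ N ^ (2 * ℓ) := by
    calc ℓ ≤ 2 ^ ℓ := Nat.lt_two_pow_self.le
      _ ≤ N ^ ℓ := Nat.pow_le_pow_left hN2 ℓ
      _ ≤ N ^ (2 * ℓ) := Nat.pow_le_pow_right (by omega) (by omega)
  have hM : n ^ ℓ ≤ N ^ (2 * ℓ) :=
    (Nat.pow_le_pow_left hnN ℓ).trans (Nat.pow_le_pow_right (by omega) (by omega))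
  -- The base N^(2ℓ) bounds n + 1, ℓ and n^ℓ at once; the exponent 24 then gives 2 · 24 = 48.
  obtain ⟨t, s, hr, ht, hres⟩ :=
    localSearchProgram_runs (I := I) (b := N ^ (2 * ℓ)) (by omega) (by omega) hℓ hℓb hM hf
  refine ⟨t, s, hr, ht.trans_eq ?_, hres⟩
  rw [← pow_mul]
  congr 1
  ring

end LocalSearch

theorem mainTheorem7 :
    ∃ (P : RamProgram) (c : ℕ), IsLocalSearchProgram P c ∧
      ∀ (k : ℕ) (𝒞 : GraphClass), 𝒞.HasPolynomialExpansion k →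
      ∀ (maxDemand maxReach : ℕ), ∃ C : ℝ, 0 < C ∧
      ∀ (ε : ℝ), 0 < ε →
      ∀ (n : ℕ) (I : DominationInstance n), ⟨n, I.graph⟩ ∈ 𝒞 →
        I.IsFeasible I.candidates →
        (∀ v ∈ I.targets, I.demand v ≤ maxDemand ∧ I.reach v ≤ maxReach) →
          (∀ S, I.IsLocallyOptimal (exchangeSize C k ε) S → I.IsApproximation ε S) ∧
          ∃ (t : ℕ) (s : RamState), RamRuns P (I.encode (exchangeSize C k ε)) t s ∧
            t ≤ (max n 2) ^ (c * exchangeSize C k ε) ∧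
            I.IsLocalSearchResult (exchangeSize C k ε) (s.output n) ∧
            I.IsApproximation ε (s.output n) := by
  refine ⟨localSearchProgram, 48, localSearchProgram_isLocalSearchProgram,
    fun k 𝒞 h𝒞 maxDemand maxReach => ?_⟩
  obtain ⟨C, hC, hopt⟩ := exists_isApproximation_of_isLocallyOptimal h𝒞 maxDemand maxReach
  refine ⟨C, hC, fun ε hε n I hI hf hbd => ⟨hopt ε hε n I hI hbd, ?_⟩⟩
  obtain ⟨t, s, hr, ht, hres⟩ :=
    localSearchProgram_isLocalSearchProgram n I _ (exchangeSize_pos hC k ε) hf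
  exact ⟨t, s, hr, ht, hres, hopt ε hε n I hI hbd _ hres.2⟩
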